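/- **Setting.** Let $n\ge 1$, let $\mathbb R^n_\pm=\{x\in\mathbb R^n:\pm x_n>0\}$, and for $f:\mathbb R^n\to\mathbb C$ let $f_\pm=f|_{\mathbb R^n_\pm}$. *BMO on $\mathbb R^n$ and on half-spaces.* $\mathrm{BMO}(\mathbb R^n)$ is the set of locally integrable $f$ with $\sup_Q\frac1{|Q|}\int_Q|f-f_Q|\,dx<\infty$, the supremum being over all cubes $Q$ and $f_Q$ being the average of $f$ over $Q$. For $\Omega=\mathbb R^n_\pm$, $\mathrm{BMO}_r(\Omega)$ is the set of restrictions to $\Omega$ of functions in $\mathrm{BMO}(\mathbb R^n)$, and $\mathrm{BMO}_z(\Omega)$ is the set of functions on $\Omega$ whose extension by $0$ to $\mathbb R^n$ lies in $\mathrm{BMO}(\mathbb R^n)$. *Laplacians.* The Neumann (resp. Dirichlet) Laplacian on $\Omega=\mathbb R^n_\pm$ is the nonnegative self-adjoint operator on $L^2(\Omega)$ of the form $\int_\Omega\nabla u\cdot\overline{\nabla v}\,dx$ with form domain $W^{1,2}(\Omega)$ (resp. $W^{1,2}_0(\Omega)$). On $L^2(\mathbb R^n)$, $\Delta_N$ (resp.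 $\Delta_D$) acts as the Neumann (resp. Dirichlet) Laplacian separately on $\mathbb R^n_+$ and on $\mathbb R^n_-$, and $\Delta_{DN}$ acts as the Neumann Laplacian on $\mathbb R^n_+$ and as the Dirichlet Laplacian on $\mathbb R^n_-$. *BMO associated with an operator.* Let $\mathcal M(\mathbb R^n)$ be the set of locally integrable $f$ with $\int_{\mathbb R^n}\frac{|f(x)|^2}{1+|x|^{n+d}}\,dx<\infty$ for some $d>0$. For $L\in\{\Delta_N,\Delta_D,\Delta_{DN}\}$ the heat semigroup $e^{-tL}$, $t>0$, is extended from $L^2(\mathbb R^n)$ to $\mathcal M(\mathbb R^n)$ by integration against its kernel. Put $$\mathrm{BMO}_L(\mathbb R^n)=\Big\{f\in\mathcal M(\mathbb R^n):\ \sup_{B(y,r)}\frac1{|B(y,r)|}\int_{B(y,r)}|f-e^{-r^2L}f|\,dx<\infty\Big\},$$ the supremum being over all balls, and $$\mathcal K_L=\{f\in\mathcal M(\mathbb R^n):\ e^{-tL}f=f\ \text{a.e. for all }t>0\}.$$ The space $\mathrm{BMO}_L(\mathbb R^n)$ is considered modulo $\mathcal K_L$. **Proposition 4.2.** Modulo $\mathcal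 K_L$ in each case, $$\mathrm{BMO}_{\Delta_N}(\mathbb R^n)=\{f\in\mathcal M(\mathbb R^n): f_+\in\mathrm{BMO}_r(\mathbb R^n_+)\text{ and }f_-\in\mathrm{BMO}_r(\mathbb R^n_-)\},$$ $$\mathrm{BMO}_{\Delta_D}(\mathbb R^n)=\{f\in\mathcal M(\mathbb R^n): f_+\in\mathrm{BMO}_z(\mathbb R^n_+)\text{ and }f_-\in\mathrm{BMO}_z(\mathbb R^n_-)\},$$ $$\mathrm{BMO}_{\Delta_{DN}}(\mathbb R^n)=\{f\in\mathcal M(\mathbb R^n): f_+\in\mathrm{BMO}_r(\mathbb R^n_+)\text{ and }f_-\in\mathrm{BMO}_z(\mathbb R^n_-)\}.$$ Explicitly, for each of the three operators $L$, a function $f$ lies in $\mathrm{BMO}_L(\mathbb R^n)$ if and only if there is a $g$ in the set on the right-hand side with $f-g\in\mathcal K_L$. -/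

import Mathlib

open MeasureTheory Filter Topology
open scoped ContDiff ComplexConjugate

noncomputable section

namespace HeatBMO

/-- `ℝⁿ` with the Euclidean norm and Lebesgue measure. -/
abbrev E (n : ℕ) : Type := EuclideanSpace ℝ (Fin n)

/-! ### Half-spaces -/

/-- The index of the last coordinate `xₙ` of `x ∈ ℝⁿ`, `n ≥ 1`. -/
def lastIdx (n : ℕ) [NeZero n] : Fin n := ⟨n - 1, Nat.sub_lt (NeZero.pos n) Nat.one_pos⟩

/-- `ℝⁿ₊ = {x : xₙ > 0}`. -/
def upper (n : ℕ) [NeZero n] : Set (E n) := {x | 0 < x (lastIdx n)}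

/-- `ℝⁿ₋ = {x : xₙ < 0}`. -/
def lower (n : ℕ) [NeZero n] : Set (E n) := {x | x (lastIdx n) < 0}

/-! ### Classical BMO, and BMO on an open set -/

/-- The cube with centre `c` and side length `l`, with sides parallel to the axes. -/
def cube {n : ℕ} (c : E n) (l : ℝ) : Set (E n) := {x | ∀ i, |x i - c i| ≤ l / 2}

/-- The BMO seminorm `sup_Q |Q|⁻¹ ∫_Q |f - f_Q|`, over all cubes. -/
def bmoNorm {n : ℕ} (f : E n → ℂ) : ENNReal :=
  ⨆ (c : E n) (l : ℝ) (_ : 0 < l),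
    ⨍⁻ x in cube c l, ‖f x - ⨍ z in cube c l, f z ∂volume‖ₑ ∂volume

/-- The classical space `BMO(ℝⁿ)`, as a set of functions. -/
def BMO (n : ℕ) : Set (E n → ℂ) := {f | LocallyIntegrable f volume ∧ bmoNorm f < ⊤}

/-- `BMO_r(Ω)`: the restrictions to `Ω` of functions in `BMO(ℝⁿ)`. -/
def BMOr {n : ℕ} (Ω : Set (E n)) : Set (Ω → ℂ) := {f | ∃ F ∈ BMO n, Ω.domRestrict F = f}

/-- `BMO_z(Ω)`: the functions on `Ω` whose extension by zero lies in `BMO(ℝⁿ)`. -/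
def BMOz {n : ℕ} (Ω : Set (E n)) : Set (Ω → ℂ) :=
  {f | Function.extend (Subtype.val : Ω → E n) f 0 ∈ BMO n}

/-! ### Sobolev spaces

A function on an open set `Ω` is represented here by a function on `ℝⁿ`
whose values outside `Ω` play no role. -/

/-- The `i`-th partial derivative. -/
def partialD {n : ℕ} (i : Fin n) (φ : E n → ℂ) (x : E n) : ℂ :=
  fderiv ℝ φ x (EuclideanSpace.single i 1)

/-- `φ ∈ C_c^∞(Ω)`. -/
def IsTest {n : ℕ} (Ω : Set (E n)) (φ : E n → ℂ) : Prop :=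
  ContDiff ℝ ∞ φ ∧ HasCompactSupport φ ∧ tsupport φ ⊆ Ω

/-- `u ∈ W^{1,2}(Ω)`, with weak gradient `G = (G₁, …, Gₙ)`. -/
def IsW12 {n : ℕ} (Ω : Set (E n)) (u : E n → ℂ) (G : Fin n → E n → ℂ) : Prop :=
  MemLp u 2 (volume.restrict Ω) ∧ (∀ i, MemLp (G i) 2 (volume.restrict Ω)) ∧
    ∀ φ, IsTest Ω φ → ∀ i, ∫ x in Ω, u x * partialD i φ x = -∫ x in Ω, G i x * φ x

/-- `u ∈ W₀^{1,2}(Ω)`, the closure of `C_c^∞(Ω)` in `W^{1,2}(Ω)`, with weak gradient `G`. -/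
def IsW012 {n : ℕ} (Ω : Set (E n)) (u : E n → ℂ) (G : Fin n → E n → ℂ) : Prop :=
  IsW12 Ω u G ∧ ∃ φ : ℕ → E n → ℂ, (∀ k, IsTest Ω (φ k)) ∧
    Tendsto (fun k => eLpNorm (φ k - u) 2 (volume.restrict Ω)) atTop (𝓝 0) ∧
    ∀ i, Tendsto (fun k => eLpNorm (partialD i (φ k) - G i) 2 (volume.restrict Ω)) atTop (𝓝 0)

/-! ### Neumann and Dirichlet Laplacians

The Laplacians are nonnegative, that is `Δ = -∑ ∂ᵢ²`. An unbounded operator `L` is represented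
by its graph: `L u g` says that `u` is in the domain and `L u = g`. -/

/-- The self-adjoint operator on `L²(Ω)` of the form `∫_Ω ∇u · conj ∇v` with form domain `V`:
`u ∈ V`, `g ∈ L²(Ω)` and `∫_Ω ∇u · conj ∇v = ∫_Ω g conj v` for all `v ∈ V`. -/
def formOperator {n : ℕ} (Ω : Set (E n)) (V : (E n → ℂ) → (Fin n → E n → ℂ) → Prop)
    (u g : E n → ℂ) : Prop :=
  MemLp g 2 (volume.restrict Ω) ∧ ∃ G, V u G ∧ ∀ v H, V v H →
    ∫ x in Ω, ∑ i, G i x * conj (H i x) = ∫ x in Ω, g x * conj (v x)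

/-- The Neumann Laplacian on `Ω`. -/
def neumannOn {n : ℕ} (Ω : Set (E n)) : (E n → ℂ) → (E n → ℂ) → Prop :=
  formOperator Ω (IsW12 Ω)

/-- The Dirichlet Laplacian on `Ω`. -/
def dirichletOn {n : ℕ} (Ω : Set (E n)) : (E n → ℂ) → (E n → ℂ) → Prop :=
  formOperator Ω (IsW012 Ω)

/-- `Δ_N`: the Neumann Laplacian on both half-spaces. -/
def laplaceN (n : ℕ) [NeZero n] (u g : E n → ℂ) : Prop :=
  neumannOn (upper n) u g ∧ neumannOn (lower n) u g

/-- `Δ_D`: the Dirichlet Laplacian on both half-spaces. -/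
def laplaceD (n : ℕ) [NeZero n] (u g : E n → ℂ) : Prop :=
  dirichletOn (upper n) u g ∧ dirichletOn (lower n) u g

/-- `Δ_DN`: the Neumann Laplacian on the upper, the Dirichlet Laplacian on the lower half-space. -/
def laplaceDN (n : ℕ) [NeZero n] (u g : E n → ℂ) : Prop :=
  neumannOn (upper n) u g ∧ dirichletOn (lower n) u g

/-! ### The heat semigroup of an operator -/

/-- `T t = exp(-tL)` for `t > 0`: for every `f ∈ L²(ℝⁿ)`, the curve `t ↦ T t f` is the solution of
the abstract Cauchy problem `u' = -L u`, `u(0+) = f` in `L²(ℝⁿ)`. For a nonnegative self-adjoint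
`L` this determines `T t`, `t > 0`. -/
def IsHeatSemigroup {n : ℕ} (L : (E n → ℂ) → (E n → ℂ) → Prop)
    (T : ℝ → Lp ℂ 2 (volume : Measure (E n)) →L[ℂ] Lp ℂ 2 (volume : Measure (E n))) : Prop :=
  ∀ f, Tendsto (fun t => T t f) (𝓝[>] 0) (𝓝 f) ∧
    ∀ t, 0 < t → ∃ g : Lp ℂ 2 (volume : Measure (E n)),
      L (T t f) g ∧ HasDerivAt (fun s => T s f) (-g) t

/-- `p t x y`, `t > 0`, is the heat kernel of `L`:
`exp(-tL) f (x) = ∫ p t x y f(y) dy` for all `f ∈ L²(ℝⁿ)` and almost all `x`. -/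
def IsHeatKernel {n : ℕ} (L : (E n → ℂ) → (E n → ℂ) → Prop) (p : ℝ → E n → E n → ℂ) : Prop :=
  ∃ T, IsHeatSemigroup L T ∧ ∀ t, 0 < t → Measurable (Function.uncurry (p t)) ∧
    ∀ f : Lp ℂ 2 (volume : Measure (E n)), ∀ᵐ x,
      Integrable (fun y => p t x y * f y) ∧ T t f x = ∫ y, p t x y * f y

open Classical in
/-- The heat kernel of `L` (it is unique up to null sets; `0` if there is none). -/
def heatKernel {n : ℕ} (L : (E n → ℂ) → (E n → ℂ) → Prop) : ℝ → E n → E n → ℂ :=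
  if h : ∃ p, IsHeatKernel L p then h.choose else 0

/-- `exp(-tL) f`, extended from `L²(ℝⁿ)` to functions `f ∈ ℳ(ℝⁿ)` by the heat kernel. -/
def heat {n : ℕ} (L : (E n → ℂ) → (E n → ℂ) → Prop) (t : ℝ) (f : E n → ℂ) (x : E n) : ℂ :=
  ∫ y, heatKernel L t x y * f y

/-! ### BMO associated with an operator -/

/-- `ℳ(ℝⁿ)`: locally integrable, with `∫ |f|² / (1 + |x|^{n+d}) < ∞` for some `d > 0`. -/
def tempered (n : ℕ) : Set (E n → ℂ) :=
  {f | LocallyIntegrable f volume ∧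
    ∃ d : ℝ, 0 < d ∧ Integrable (fun x => ‖f x‖ ^ 2 / (1 + ‖x‖ ^ ((n : ℝ) + d))) volume}

/-- The seminorm `sup_{B(y,r)} |B(y,r)|⁻¹ ∫_{B(y,r)} |f - exp(-r²L) f|`, over all balls. -/
def bmoNormOp {n : ℕ} (L : (E n → ℂ) → (E n → ℂ) → Prop) (f : E n → ℂ) : ENNReal :=
  ⨆ (y : E n) (r : ℝ) (_ : 0 < r),
    ⨍⁻ x in Metric.ball y r, ‖f x - heat L (r ^ 2) f x‖ₑ ∂volume

/-- `BMO_L(ℝⁿ)`, as a set of functions (before the quotient by `kernelSpace L` is taken: two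
functions are the same element of the space if their difference lies in `kernelSpace L`). -/
def BMOop {n : ℕ} (L : (E n → ℂ) → (E n → ℂ) → Prop) : Set (E n → ℂ) :=
  {f | f ∈ tempered n ∧ bmoNormOp L f < ⊤}

/-- `𝒦_L = {f ∈ ℳ(ℝⁿ) : exp(-tL) f = f for all t > 0}`. -/
def kernelSpace {n : ℕ} (L : (E n → ℂ) → (E n → ℂ) → Prop) : Set (E n → ℂ) :=
  {f | f ∈ tempered n ∧ ∀ t : ℝ, 0 < t → heat L t f =ᵐ[volume] f}

end HeatBMO

end

/-! The proof is the method of images followed by a splitting of functions on the whole space.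
Neumann corresponds to parity `1` and Dirichlet to parity `-1`. On the half-space with sign `s`, the
semigroup of `L` is the Euclidean heat semigroup applied to the even or odd extension `halfExt s (b
s) f`, restricted back to the half-space (`ActsByReflection`, proved in
`actsByReflection_halfLaplace`). Since the heat flow preserves parity, the seminorm of `f` is finite
exactly when both extensions `F` have bounded averages of `|F - exp(r²Δ) F|` over balls of radius
`r`, which is `HeatOsc`.

On the whole space there are two directions. A BMO function of polynomial growth satisfies `HeatOsc`
(`BMO.heatOsc`): write `F(x) - exp(r²Δ)F(x)` as a Gaussian average of `F(x) - F(x-z)`. Conversely,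
suppose `HeatOsc` holds. For `s ≤ t`, the function `F - exp(sΔ)F` has bounded averages at scale
`√s`, so `exp(tΔ)` turns it into a Lipschitz function with constant of order `1/√t`
(`norm_euclHeat_sub_le`). Along `t = 2^k` the differences `exp(tΔ)F(x) - exp(tΔ)F(0)` therefore
change by a geometric sequence and converge to some `h(x)`, called `caloric`. The tail estimate
gives `F - h ∈ BMO` (`sub_caloric_mem_BMO`). The flow moves `h` only by a constant `c(s)`, which
doubles with `s` and stays bounded, so it vanishes and `h` is invariant (`euclHeat_caloric`).

The limit `h` inherits the parity of `F`. Gluing the two limits thus gives an element of the kernel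
space of `L`, and what remains on each half-space extends to a BMO function of the right parity. For
odd parity, half the sum of such a function and its even extension is the extension by zero, so the
condition becomes the one with `BMOz`; for even parity it is the one with `BMOr`.

Because the heat kernel of `L` is an arbitrary choice among kernels satisfying the definition, both
existence and uniqueness are needed. Existence: the reflected flow is shown to solve the Cauchy
problem, by integration by parts on half-spaces. Uniqueness: an energy argument determines the
semigroup, and a countable π-system determines the kernel almost everywhere. -/

open scoped ENNReal NNReal Pointwise

noncomputable section

namespace HeatBMO

variable {n : ℕ}

/-! ### Polynomially bounded weights and the heat kernel of the Euclidean space -/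

/-- `F` is integrable against `(1 + |x|)^{-N}` for some `N`. -/
def PolyInt (F : E n → ℂ) : Prop :=
  ∃ N : ℕ, Integrable (fun x => ((1 + ‖x‖) ^ N)⁻¹ • F x) volume

/-- A continuous kernel with Gaussian decay. -/
def GaussDecay (k : E n → ℂ) : Prop :=
  Continuous k ∧ ∃ C b : ℝ, 0 < b ∧ ∀ w, ‖k w‖ ≤ C * Real.exp (-b * ‖w‖ ^ 2)

/-- Convolution with the kernel `k`. -/
def conv (k F : E n → ℂ) (x : E n) : ℂ := ∫ y, k (x - y) * F y

lemma one_add_pow_le_exp (N : ℕ) {r : ℝ} (hr : 0 ≤ r) :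
    (1 + r) ^ N ≤ N.factorial * Real.exp (1 + r) := by
  have h := Real.pow_div_factorial_le_exp (1 + r) (by positivity) N
  have hN : (0 : ℝ) < N.factorial := by exact_mod_cast N.factorial_pos
  rw [div_le_iff₀ hN] at h
  linarith

lemma exp_mul_pow_le (N : ℕ) {b : ℝ} (hb : 0 < b) {r : ℝ} (hr : 0 ≤ r) :
    Real.exp (-b * r ^ 2) * (1 + r) ^ N ≤ N.factorial * Real.exp (1 + 1 / (4 * b)) := by
  have hN : (0 : ℝ) ≤ N.factorial := by positivity
  calc Real.exp (-b * r ^ 2) * (1 + r) ^ N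
      ≤ Real.exp (-b * r ^ 2) * (N.factorial * Real.exp (1 + r)) := by
        gcongr; exact one_add_pow_le_exp N hr
    _ = N.factorial * Real.exp (-b * r ^ 2 + (1 + r)) := by
        rw [Real.exp_add (-b * r ^ 2)]; ring
    _ ≤ N.factorial * Real.exp (1 + 1 / (4 * b)) := by
        refine mul_le_mul_of_nonneg_left (Real.exp_le_exp.2 ?_) hN
        have : 0 ≤ b * (r - 1 / (2 * b)) ^ 2 := by positivity
        have h2 : b * (r - 1 / (2 * b)) ^ 2 = b * r ^ 2 - r + 1 / (4 * b) := by
          field_simp; ring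
        linarith

/-- From `1 + |y| ≤ (1 + |x|)(1 + |x - y|)`: Gaussian decay in `x - y` transfers a polynomial weight
from `y` to `x`. This is why convolution with a Gaussian is defined on functions of polynomial
growth and preserves them. -/
lemma exp_mul_weight_le (N : ℕ) {b : ℝ} (hb : 0 < b) (x y : E n) :
    Real.exp (-b * ‖x - y‖ ^ 2) * (1 + ‖y‖) ^ N
      ≤ N.factorial * Real.exp (1 + 1 / (4 * b)) * (1 + ‖x‖) ^ N := by
  have h1 : 1 + ‖y‖ ≤ (1 + ‖x‖) * (1 + ‖x - y‖) := by
    have : ‖y‖ ≤ ‖x‖ + ‖x - y‖ := by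
      simpa using norm_sub_le x (x - y)
    nlinarith [mul_nonneg (norm_nonneg x) (norm_nonneg (x - y))]
  calc Real.exp (-b * ‖x - y‖ ^ 2) * (1 + ‖y‖) ^ N
      ≤ Real.exp (-b * ‖x - y‖ ^ 2) * ((1 + ‖x‖) * (1 + ‖x - y‖)) ^ N := by gcongr
    _ = (Real.exp (-b * ‖x - y‖ ^ 2) * (1 + ‖x - y‖) ^ N) * (1 + ‖x‖) ^ N := by
        rw [mul_pow]; ring
    _ ≤ _ := mul_le_mul_of_nonneg_right (exp_mul_pow_le N hb (norm_nonneg (x - y))) (by positivity)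

lemma continuous_weight_inv (N : ℕ) : Continuous fun x : E n => ((1 + ‖x‖) ^ N)⁻¹ :=
  Continuous.inv₀ (by fun_prop) fun x : E n => (by positivity : (1 + ‖x‖) ^ N ≠ 0)

lemma PolyInt.aesm {F : E n → ℂ} (hF : PolyInt F) : AEStronglyMeasurable F volume := by
  obtain ⟨N, hN⟩ := hF
  have hc : Continuous fun x : E n => (1 + ‖x‖) ^ N := by fun_prop
  have := hc.aestronglyMeasurable (μ := volume) |>.smul hN.aestronglyMeasurable
  refine this.congr (ae_of_all _ fun x => ?_)
  exact smul_inv_smul₀ (by positivity : (1 + ‖x‖) ^ N ≠ 0) (F x)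

lemma PolyInt.mono_exp {F : E n → ℂ} (hF : PolyInt F) : ∃ N₀ : ℕ, ∀ N, N₀ ≤ N →
    Integrable (fun x => ((1 + ‖x‖) ^ N)⁻¹ • F x) volume := by
  have hm := hF.aesm
  obtain ⟨N, hN⟩ := hF
  refine ⟨N, fun M hM => hN.mono ?_ (ae_of_all _ fun x => ?_)⟩
  · exact (continuous_weight_inv _).aestronglyMeasurable.smul hm
  · rw [norm_smul, norm_smul]
    gcongr
    rw [Real.norm_of_nonneg (by positivity), Real.norm_of_nonneg (by positivity)]
    gcongr
    linarith [norm_nonneg x]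

lemma PolyInt.congr {F G : E n → ℂ} (hF : PolyInt F) (h : F =ᵐ[volume] G) : PolyInt G := by
  obtain ⟨N, hN⟩ := hF
  refine ⟨N, hN.congr ?_⟩
  filter_upwards [h] with x hx
  rw [hx]

lemma PolyInt.add {F G : E n → ℂ} (hF : PolyInt F) (hG : PolyInt G) : PolyInt (F + G) := by
  obtain ⟨N, hN⟩ := hF.mono_exp
  obtain ⟨M, hM⟩ := hG.mono_exp
  refine ⟨max N M, ((hN (max N M) (le_max_left _ _)).add (hM (max N M) (le_max_right _ _))).congr
    (ae_of_all _ fun x => ?_)⟩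
  simp

lemma PolyInt.const_mul {F : E n → ℂ} (hF : PolyInt F) (c : ℂ) :
    PolyInt (fun x => c * F x) := by
  obtain ⟨N, hN⟩ := hF
  refine ⟨N, (hN.const_mul c).congr (ae_of_all _ fun x => ?_)⟩
  simp; ring

lemma PolyInt.sub {F G : E n → ℂ} (hF : PolyInt F) (hG : PolyInt G) : PolyInt (F - G) := by
  refine (hF.add (hG.const_mul (-1))).congr (ae_of_all _ fun x => ?_)
  simp [sub_eq_add_neg]

lemma PolyInt.mono {F G : E n → ℂ} (hF : PolyInt F) (hG : AEStronglyMeasurable G volume)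
    (h : ∀ x, ‖G x‖ ≤ ‖F x‖) : PolyInt G := by
  obtain ⟨N, hN⟩ := hF
  refine ⟨N, hN.mono ?_ (ae_of_all _ fun x => ?_)⟩
  · exact (continuous_weight_inv _).aestronglyMeasurable.smul hG
  · rw [norm_smul, norm_smul]
    gcongr
    exact h x

lemma PolyInt.indicator {F : E n → ℂ} (hF : PolyInt F) {s : Set (E n)} (hs : MeasurableSet s) :
    PolyInt (s.indicator F) :=
  hF.mono (hF.aesm.indicator hs) fun _ => norm_indicator_le_norm_self _ _

lemma PolyInt.comp_isometry {F : E n → ℂ} (hF : PolyInt F) (σ : E n ≃ₗᵢ[ℝ] E n) :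
    PolyInt (fun x => F (σ x)) := by
  obtain ⟨N, hN⟩ := hF
  refine ⟨N, ?_⟩
  have := (σ.measurePreserving.integrable_comp_emb
    σ.toHomeomorph.toMeasurableEquiv.measurableEmbedding).2 hN
  refine this.congr (ae_of_all _ fun x => ?_)
  simp

lemma integrable_weight (n : ℕ) : Integrable (fun x : E n => ((1 + ‖x‖) ^ (n + 1))⁻¹) volume := by
  have := integrable_one_add_norm (E := E n) (μ := volume) (r := ((n + 1 : ℕ) : ℝ)) (by simp)
  refine this.congr (ae_of_all _ fun x => ?_)
  simp only
  rw [Real.rpow_neg (by positivity), Real.rpow_natCast]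

lemma polyInt_of_bound {F : E n → ℂ} (hm : AEStronglyMeasurable F volume) (C : ℝ) (N : ℕ)
    (h : ∀ x, ‖F x‖ ≤ C * (1 + ‖x‖) ^ N) : PolyInt F := by
  refine ⟨N + (n + 1), ((integrable_weight n).const_mul C).mono' ?_ (ae_of_all _ fun x => ?_)⟩
  · exact (continuous_weight_inv _).aestronglyMeasurable.smul hm
  · rw [norm_smul, Real.norm_of_nonneg (by positivity), pow_add, mul_inv]
    have : 0 < (1 + ‖x‖) ^ N := by positivity
    calc _ ≤ ((1 + ‖x‖) ^ N)⁻¹ * ((1 + ‖x‖) ^ (n + 1))⁻¹ * (C * (1 + ‖x‖) ^ N) := by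
          gcongr; exact h x
      _ = _ := by field_simp

lemma polyInt_const (c : ℂ) : PolyInt (fun _ : E n => c) :=
  polyInt_of_bound (by fun_prop) ‖c‖ 0 (by simp)

lemma PolyInt.locallyIntegrable {F : E n → ℂ} (hF : PolyInt F) :
    LocallyIntegrable F volume := by
  obtain ⟨N, hN⟩ := hF
  have h := hN.locallyIntegrable
  have hc : Continuous fun x : E n => (1 + ‖x‖) ^ N := by fun_prop
  rw [← locallyIntegrableOn_univ] at h ⊢
  have := h.continuousOn_smul isOpen_univ.isLocallyClosed hc.continuousOn
  convert this using 2 with x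
  exact (smul_inv_smul₀ (by positivity : (1 + ‖x‖) ^ N ≠ 0) (F x)).symm

/-- Cauchy-Schwarz: the weight is at most `1` and integrable, hence square integrable. -/
lemma MemLp.polyInt {F : E n → ℂ} (hF : MemLp F 2 volume) : PolyInt F := by
  refine ⟨n + 1, ?_⟩
  have hw : MemLp (fun x : E n => ((1 + ‖x‖) ^ (n + 1))⁻¹) 2 volume := by
    have hm : AEStronglyMeasurable (fun x : E n => ((1 + ‖x‖) ^ (n + 1))⁻¹) volume :=
      (integrable_weight n).aestronglyMeasurable
    rw [memLp_two_iff_integrable_sq_norm hm]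
    refine (integrable_weight n).mono' (hm.norm.pow 2) (ae_of_all _ fun x => ?_)
    have h1 : ((1 + ‖x‖) ^ (n + 1))⁻¹ ≤ 1 :=
      inv_le_one_of_one_le₀ (one_le_pow₀ (by linarith [norm_nonneg x]))
    have h0 : 0 ≤ ((1 + ‖x‖) ^ (n + 1))⁻¹ := by positivity
    simp only [norm_pow, norm_norm]
    rw [Real.norm_of_nonneg h0]
    nlinarith
  have := hF.smul hw (r := 1)
  exact memLp_one_iff_integrable.1 this

lemma GaussDecay.exists_bound {k : E n → ℂ} (hk : GaussDecay k) (N : ℕ) :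
    ∃ C : ℝ, 0 ≤ C ∧ ∀ x y, ‖k (x - y)‖ ≤ C * (1 + ‖x‖) ^ N * ((1 + ‖y‖) ^ N)⁻¹ := by
  obtain ⟨-, C, b, hb, h⟩ := hk
  have hC : 0 ≤ C := by
    have := (norm_nonneg _).trans (h 0)
    simpa using this
  refine ⟨C * (N.factorial * Real.exp (1 + 1 / (4 * b))), by positivity, fun x y => ?_⟩
  refine (h (x - y)).trans ?_
  rw [← div_eq_mul_inv, le_div_iff₀ (by positivity), mul_assoc, mul_assoc C]
  refine mul_le_mul_of_nonneg_left ?_ hC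
  exact exp_mul_weight_le N hb x y

lemma GaussDecay.integrable_conv {k F : E n → ℂ} (hk : GaussDecay k) (hF : PolyInt F) (x : E n) :
    Integrable (fun y => k (x - y) * F y) volume := by
  have hm := hF.aesm
  obtain ⟨N, hN⟩ := hF
  obtain ⟨C, hC, h⟩ := hk.exists_bound N
  refine (hN.norm.const_mul (C * (1 + ‖x‖) ^ N)).mono' ?_ (ae_of_all _ fun y => ?_)
  · exact ((hk.1.comp (by fun_prop)).aestronglyMeasurable).mul hm
  · rw [norm_mul, norm_smul, Real.norm_of_nonneg (by positivity), ← mul_assoc]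
    gcongr
    exact h x y

lemma GaussDecay.norm_conv_le {k F : E n → ℂ} (hk : GaussDecay k) (hF : PolyInt F) :
    ∃ (C : ℝ) (N : ℕ), 0 ≤ C ∧ ∀ x, ‖conv k F x‖ ≤ C * (1 + ‖x‖) ^ N := by
  obtain ⟨N, hN⟩ := hF
  obtain ⟨C, hC, h⟩ := hk.exists_bound N
  refine ⟨C * ∫ y, ‖((1 + ‖y‖) ^ N)⁻¹ • F y‖, N, by positivity, fun x => ?_⟩
  calc ‖conv k F x‖ ≤ ∫ y, C * (1 + ‖x‖) ^ N * ‖((1 + ‖y‖) ^ N)⁻¹ • F y‖ := by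
        refine norm_integral_le_of_norm_le (hN.norm.const_mul _) (ae_of_all _ fun y => ?_)
        rw [norm_mul, norm_smul, Real.norm_of_nonneg (by positivity), ← mul_assoc]
        gcongr
        exact h x y
    _ = _ := by rw [integral_const_mul]; ring

lemma conv_aesm {k F : E n → ℂ} (hk : Continuous k) (hF : AEStronglyMeasurable F volume) :
    AEStronglyMeasurable (conv k F) volume := by
  have : AEStronglyMeasurable (fun p : E n × E n => k (p.1 - p.2) * F p.2)
      (volume.prod volume) :=
    ((hk.comp (by fun_prop)).aestronglyMeasurable).mul hF.comp_snd
  exact this.integral_prod_right'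

lemma PolyInt.conv {k F : E n → ℂ} (hk : GaussDecay k) (hF : PolyInt F) :
    PolyInt (conv k F) := by
  obtain ⟨C, N, -, h⟩ := hk.norm_conv_le hF
  exact polyInt_of_bound (conv_aesm hk.1 hF.aesm) C N h

lemma conv_add {k F G : E n → ℂ} (hk : GaussDecay k) (hF : PolyInt F) (hG : PolyInt G) (x : E n) :
    conv k (F + G) x = conv k F x + conv k G x := by
  rw [HeatBMO.conv, HeatBMO.conv, HeatBMO.conv,
    ← integral_add (hk.integrable_conv hF x) (hk.integrable_conv hG x)]
  simp [mul_add]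

lemma conv_sub {k F G : E n → ℂ} (hk : GaussDecay k) (hF : PolyInt F) (hG : PolyInt G) (x : E n) :
    conv k (F - G) x = conv k F x - conv k G x := by
  rw [HeatBMO.conv, HeatBMO.conv, HeatBMO.conv,
    ← integral_sub (hk.integrable_conv hF x) (hk.integrable_conv hG x)]
  simp [mul_sub]

lemma conv_const_mul (k F : E n → ℂ) (c : ℂ) (x : E n) :
    conv k (fun y => c * F y) x = c * conv k F x := by
  rw [HeatBMO.conv, HeatBMO.conv, ← integral_const_mul]
  congr 1 with y
  ring

lemma conv_congr {k F G : E n → ℂ} (h : F =ᵐ[volume] G) : conv k F = conv k G := by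
  ext x
  refine integral_congr_ae ?_
  filter_upwards [h] with y hy
  rw [hy]

lemma conv_comp_isometry {k : E n → ℂ} (F : E n → ℂ) (σ : E n ≃ₗᵢ[ℝ] E n)
    (hk : ∀ x, k (σ x) = k x) (x : E n) :
    conv k (fun y => F (σ y)) x = conv k F (σ x) := by
  have := σ.measurePreserving.integral_comp
    σ.toHomeomorph.toMeasurableEquiv.measurableEmbedding (fun y => k (σ x - y) * F y)
  rw [HeatBMO.conv, HeatBMO.conv, ← this]
  congr 1 with y
  rw [← map_sub, hk]

lemma conv_eq_integral_sub (k F : E n → ℂ) (x : E n) :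
    conv k F x = ∫ z, k z * F (x - z) := by
  rw [HeatBMO.conv, ← integral_sub_left_eq_self (fun z => k z * F (x - z)) volume x]
  simp

/-! ### The heat kernel -/

/-- The Gauss-Weierstrass kernel. -/
def gauss (t : ℝ) (x : E n) : ℝ :=
  ((4 * Real.pi * t) ^ ((n : ℝ) / 2))⁻¹ * Real.exp (-(1 / (4 * t)) * ‖x‖ ^ 2)

/-- The Gauss-Weierstrass kernel with values in `ℂ`. -/
def gaussC (t : ℝ) (x : E n) : ℂ := (gauss t x : ℝ)

lemma gauss_pos {t : ℝ} (ht : 0 < t) (x : E n) : 0 < gauss t x := by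
  unfold gauss; positivity

lemma continuous_gauss (t : ℝ) : Continuous (gauss t : E n → ℝ) := by
  unfold gauss; fun_prop

lemma gaussDecay_gaussC {t : ℝ} (ht : 0 < t) : GaussDecay (gaussC t : E n → ℂ) := by
  refine ⟨Complex.continuous_ofReal.comp (continuous_gauss t),
    ((4 * Real.pi * t) ^ ((n : ℝ) / 2))⁻¹, 1 / (4 * t), by positivity, fun w => ?_⟩
  rw [gaussC, Complex.norm_real, Real.norm_of_nonneg (gauss_pos ht w).le, gauss]

lemma integral_exp_neg {b : ℝ} (hb : 0 < b) :
    ∫ x : E n, Real.exp (-b * ‖x‖ ^ 2) = (Real.pi / b) ^ ((n : ℝ) / 2) := by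
  simpa using GaussianFourier.integral_rexp_neg_mul_sq_norm (V := E n) hb

lemma integrable_exp_neg {b : ℝ} (hb : 0 < b) :
    Integrable (fun x : E n => Real.exp (-b * ‖x‖ ^ 2)) volume := by
  -- The integral of a nonintegrable function is `0` by convention, whereas the known value is
  -- positive.
  by_contra h
  have := integral_undef h
  rw [integral_exp_neg hb] at this
  have h2 : 0 < (Real.pi / b) ^ ((n : ℝ) / 2) := by positivity
  linarith

lemma integrable_gauss {t : ℝ} (ht : 0 < t) : Integrable (gauss t : E n → ℝ) volume :=
  (integrable_exp_neg (b := 1 / (4 * t)) (by positivity)).const_mul _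

lemma integral_gauss {t : ℝ} (ht : 0 < t) : ∫ x : E n, gauss t x = 1 := by
  unfold gauss
  rw [integral_const_mul, integral_exp_neg (by positivity)]
  rw [show Real.pi / (1 / (4 * t)) = 4 * Real.pi * t by field_simp]
  exact inv_mul_cancel₀ (by positivity)

lemma gaussC_comp_isometry (t : ℝ) (σ : E n ≃ₗᵢ[ℝ] E n) (x : E n) :
    gaussC t (σ x) = gaussC t x := by simp [gaussC, gauss]

/-- Completing the square in `z`. The first factor on the right does not involve `z`, so integrating
in `z` gives the Chapman-Kolmogorov identity. -/
lemma gauss_mul_gauss {s t : ℝ} (hs : 0 < s) (ht : 0 < t) (x z : E n) :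
    gauss s (x - z) * gauss t z = gauss (s + t) x *
      gauss (s * t / (s + t)) (z - (t / (s + t)) • x) := by
  have hst : 0 < s + t := by positivity
  unfold gauss
  have h1 : (4 * Real.pi * s) ^ ((n : ℝ) / 2) * (4 * Real.pi * t) ^ ((n : ℝ) / 2) =
      (4 * Real.pi * (s + t)) ^ ((n : ℝ) / 2) *
        (4 * Real.pi * (s * t / (s + t))) ^ ((n : ℝ) / 2) := by
    rw [← Real.mul_rpow (by positivity) (by positivity),
      ← Real.mul_rpow (by positivity) (by positivity)]
    congr 1
    field_simp
  have h2 : -(1 / (4 * s)) * ‖x - z‖ ^ 2 + -(1 / (4 * t)) * ‖z‖ ^ 2 =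
      -(1 / (4 * (s + t))) * ‖x‖ ^ 2 +
        -(1 / (4 * (s * t / (s + t)))) * ‖z - (t / (s + t)) • x‖ ^ 2 := by
    rw [@norm_sub_sq_real _ _ _ x z, @norm_sub_sq_real _ _ _ z, norm_smul, inner_smul_right,
      real_inner_comm, Real.norm_of_nonneg (by positivity)]
    field_simp
    ring
  calc _ = ((4 * Real.pi * s) ^ ((n : ℝ) / 2) * (4 * Real.pi * t) ^ ((n : ℝ) / 2))⁻¹ *
        Real.exp (-(1 / (4 * s)) * ‖x - z‖ ^ 2 + -(1 / (4 * t)) * ‖z‖ ^ 2) := by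
        rw [Real.exp_add, mul_inv]; ring
    _ = _ := by
        rw [h1, h2, Real.exp_add, mul_inv]; ring

lemma integral_gauss_mul_gauss {s t : ℝ} (hs : 0 < s) (ht : 0 < t) (x y : E n) :
    ∫ z, gauss s (x - z) * gauss t (z - y) = gauss (s + t) (x - y) := by
  have hst : 0 < s + t := by positivity
  rw [← integral_add_right_eq_self _ y]
  have : ∀ z, gauss s (x - (z + y)) * gauss t (z + y - y) = gauss (s + t) (x - y) *
      gauss (s * t / (s + t)) (z - (t / (s + t)) • (x - y)) := fun z => by
    rw [← gauss_mul_gauss hs ht]; congr 2 <;> abel_nf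
  simp_rw [this]
  rw [integral_const_mul, integral_sub_right_eq_self (gauss (s * t / (s + t))),
    integral_gauss (by positivity), mul_one]

lemma integrable_gauss_mul_gauss {s t : ℝ} (hs : 0 < s) (ht : 0 < t) (x y : E n) :
    Integrable (fun z => gauss s (x - z) * gauss t (z - y)) volume := by
  by_contra h
  have := integral_undef h
  rw [integral_gauss_mul_gauss hs ht] at this
  have := gauss_pos (add_pos hs ht) (x - y)
  linarith

/-- `exp(tΔ)` on functions of polynomial growth. -/
abbrev euclHeat (t : ℝ) (F : E n → ℂ) : E n → ℂ := conv (gaussC t) F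

lemma euclHeat_semigroup {s t : ℝ} (hs : 0 < s) (ht : 0 < t) {F : E n → ℂ} (hF : PolyInt F) (x : E n) :
    euclHeat s (euclHeat t F) x = euclHeat (s + t) F x := by
  have hint : Integrable (fun p : E n × E n => gaussC s (x - p.1) * (gaussC t (p.1 - p.2) * F p.2))
      (volume.prod volume) := by
    -- Integrating the positive kernels over the middle variable first leaves `gauss (s + t)`, so
    -- absolute convergence reduces to that of a single convolution.
    rw [integrable_prod_iff']
    · constructor
      · refine ae_of_all _ fun y => ?_
        have := ((integrable_gauss_mul_gauss hs ht x y).ofReal (𝕜 := ℂ)).mul_const (F y)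
        refine this.congr (ae_of_all _ fun z => ?_)
        simp [gaussC]; ring
      · have := ((gaussDecay_gaussC (n := n) (add_pos hs ht)).integrable_conv hF x).norm
        refine this.congr (ae_of_all _ fun y => ?_)
        simp only [norm_mul, gaussC, Complex.norm_real, Real.norm_eq_abs,
          abs_of_pos (gauss_pos hs _), abs_of_pos (gauss_pos ht _),
          abs_of_pos (gauss_pos (add_pos hs ht) _)]
        simp_rw [← mul_assoc]
        rw [integral_mul_const, integral_gauss_mul_gauss hs ht]
    · refine AEStronglyMeasurable.mul (Continuous.aestronglyMeasurable ?_)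
        (AEStronglyMeasurable.mul (Continuous.aestronglyMeasurable ?_) hF.aesm.comp_snd)
      · exact (gaussDecay_gaussC hs).1.comp (by fun_prop)
      · exact (gaussDecay_gaussC ht).1.comp (by fun_prop)
  calc euclHeat s (euclHeat t F) x = ∫ z, ∫ y, gaussC s (x - z) * (gaussC t (z - y) * F y) := by
        simp only [HeatBMO.conv, integral_const_mul]
    _ = ∫ y, ∫ z, gaussC s (x - z) * (gaussC t (z - y) * F y) := integral_integral_swap hint
    _ = _ := by
        refine integral_congr_ae (ae_of_all _ fun y => ?_)
        simp_rw [← mul_assoc]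
        rw [integral_mul_const]
        congr 1
        simp only [gaussC, ← Complex.ofReal_mul]
        rw [integral_complex_ofReal, integral_gauss_mul_gauss hs ht]

lemma euclHeat_const {t : ℝ} (ht : 0 < t) (c : ℂ) (x : E n) : euclHeat t (fun _ => c) x = c := by
  rw [euclHeat, conv_eq_integral_sub, integral_mul_const]
  simp only [gaussC]
  rw [integral_complex_ofReal, integral_gauss ht]
  simp

/-! ### Cubes and the oscillation form of the BMO condition -/

lemma cube_eq_preimage (c : E n) (l : ℝ) : cube c l = ⋂ i, {x : E n | |x i - c i| ≤ l / 2} := by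
  ext x; simp [cube]

lemma isClosed_cube (c : E n) (l : ℝ) : IsClosed (cube c l) := by
  rw [cube_eq_preimage]
  refine isClosed_iInter fun i => isClosed_le ?_ continuous_const
  fun_prop

/-- The `ℓ²` norm is at most the `ℓ¹` norm, which is at most `n * l / 2`. The cruder radius makes
the inequality strict, as an open ball requires, and this is where `n ≥ 1` enters. -/
lemma cube_subset_ball [NeZero n] (c : E n) {l : ℝ} (hl : 0 < l) :
    cube c l ⊆ Metric.ball c (n * l) := by
  intro x hx
  have hn : (0 : ℝ) < n := by exact_mod_cast NeZero.pos n
  rw [Metric.mem_ball, dist_eq_norm, EuclideanSpace.norm_eq]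
  calc √(∑ i, ‖(x - c) i‖ ^ 2) ≤ √((∑ i, ‖(x - c) i‖) ^ 2) :=
        Real.sqrt_le_sqrt (Finset.sum_sq_le_sq_sum_of_nonneg fun i _ => norm_nonneg _)
    _ = ∑ i, ‖(x - c) i‖ := Real.sqrt_sq (Finset.sum_nonneg fun i _ => norm_nonneg _)
    _ ≤ ∑ _i : Fin n, l / 2 := Finset.sum_le_sum fun i _ => hx i
    _ = n * l / 2 := by simp; ring
    _ < n * l := by nlinarith

lemma ball_subset_cube (c : E n) (r : ℝ) : Metric.ball c r ⊆ cube c (2 * r) := by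
  intro x hx i
  rw [Metric.mem_ball, dist_eq_norm] at hx
  have := PiLp.norm_apply_le (x - c) i
  rw [Real.norm_eq_abs] at this
  simp only [PiLp.sub_apply] at this
  linarith

/-- Scaling and translation. The measure of the unit cube is never computed, since only ratios
matter. -/
lemma volume_cube (c : E n) {l : ℝ} (hl : 0 < l) :
    volume (cube c l) = ENNReal.ofReal l ^ n * volume (cube (0 : E n) 1) := by
  have h : cube c l = (fun x => x + -c) ⁻¹' (l • cube (0 : E n) 1) := by
    ext x
    rw [Set.mem_preimage, Set.mem_smul_set_iff_inv_smul_mem₀ hl.ne']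
    simp only [cube, Set.mem_ofPred_eq]
    refine forall_congr' fun i => ?_
    have : (l⁻¹ • (x + -c)) i - (0 : E n) i = l⁻¹ * (x i - c i) := by
      simp [sub_eq_add_neg, mul_add]
    rw [this, abs_mul, abs_inv, abs_of_pos hl, inv_mul_le_iff₀ hl]
    constructor <;> intro h <;> linarith
  rw [h, measure_preimage_add_right, Measure.addHaar_smul]
  simp [abs_of_pos hl, ENNReal.ofReal_pow hl.le]

lemma volume_cube_lt_top (c : E n) (l : ℝ) : volume (cube c l) < ⊤ := by
  rcases Nat.eq_zero_or_pos n with rfl | hn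
  · have : (cube c l).Finite := Set.toFinite _
    exact (this.isCompact).measure_lt_top
  have : NeZero n := ⟨hn.ne'⟩
  -- The side `l` is not assumed positive, so it is first enlarged to a positive one.
  have h1 : cube c l ⊆ cube c (|l| + 1) := fun x hx i => (hx i).trans (by
    have := le_abs_self l; linarith)
  exact (measure_mono (h1.trans (cube_subset_ball c (by positivity)))).trans_lt
    measure_ball_lt_top

lemma volume_cube_pos (c : E n) {l : ℝ} (hl : 0 < l) : 0 < volume (cube c l) := by
  refine (Metric.measure_ball_pos volume c (half_pos hl)).trans_le (measure_mono ?_)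
  have := ball_subset_cube c (l / 2)
  rwa [mul_div_cancel₀ l two_ne_zero] at this

/-- The oscillation form of the BMO condition. -/
lemma mem_BMO_iff {f : E n → ℂ} : f ∈ BMO n ↔ LocallyIntegrable f volume ∧
    ∃ C : ℝ≥0, ∀ (c : E n) (l : ℝ), 0 < l →
      ∃ a : ℂ, ∫⁻ x in cube c l, ‖f x - a‖ₑ ≤ C * volume (cube c l) := by
  rw [BMO, Set.mem_ofPred_eq]
  refine and_congr_right fun hf => ⟨fun h => ?_, fun ⟨C, hC⟩ => ?_⟩
  · refine ⟨(bmoNorm f).toNNReal, fun c l hl => ⟨⨍ z in cube c l, f z, ?_⟩⟩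
    rw [ENNReal.coe_toNNReal h.ne]
    have h0 := (volume_cube_pos c hl).ne'
    have hT := (volume_cube_lt_top c l).ne
    have : ⨍⁻ x in cube c l, ‖f x - ⨍ z in cube c l, f z ∂volume‖ₑ ∂volume ≤ bmoNorm f := by
      unfold bmoNorm
      exact le_iSup_of_le c (le_iSup_of_le l (le_iSup_of_le hl le_rfl))
    rw [setLAverage_eq, ENNReal.div_le_iff h0 hT] at this
    exact this
  · refine lt_of_le_of_lt ?_ (b := 2 * (C : ℝ≥0∞)) (by finiteness)
    unfold bmoNorm
    refine iSup_le fun c => iSup_le fun l => iSup_le fun hl => ?_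
    obtain ⟨a, ha⟩ := hC c l hl
    have h0 := (volume_cube_pos c hl).ne'
    have hT := (volume_cube_lt_top c l).ne
    have hI : IntegrableOn f (cube c l) := by
      rcases Nat.eq_zero_or_pos n with rfl | hn
      · exact hf.integrableOn_isCompact (Set.toFinite _).isCompact
      have : NeZero n := ⟨hn.ne'⟩
      exact hf.integrableOn_isCompact (Metric.isCompact_of_isClosed_isBounded (isClosed_cube c l)
        (Metric.isBounded_ball.subset (cube_subset_ball c hl)))
    -- Any constant `a` is as good as the average up to a factor `2`, because the average itself
    -- lies within the mean of `|f - a|` of `a`.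
    have havg : ‖a - ⨍ z in cube c l, f z‖ₑ ≤ C := by
      have h1 : (a - ⨍ z in cube c l, f z) = -⨍ z in cube c l, (f z - a) := by
        rw [setAverage_eq, setAverage_eq, integral_sub hI (integrableOn_const hT)]
        simp only [setIntegral_const, smul_sub, smul_smul]
        have : volume.real (cube c l) ≠ 0 := ENNReal.toReal_ne_zero.2 ⟨h0, hT⟩
        rw [inv_mul_cancel₀ this]
        simp
      rw [h1, enorm_neg]
      calc _ ≤ ⨍⁻ z in cube c l, ‖f z - a‖ₑ ∂volume := by
            rw [setLAverage_eq', average_eq', Measure.restrict_apply_univ]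
            exact enorm_integral_le_lintegral_enorm _
        _ ≤ C := by
            rw [setLAverage_eq, ENNReal.div_le_iff h0 hT]; exact ha
    rw [setLAverage_eq, ENNReal.div_le_iff h0 hT]
    calc ∫⁻ x in cube c l, ‖f x - ⨍ z in cube c l, f z‖ₑ
        ≤ ∫⁻ x in cube c l, (‖f x - a‖ₑ + C) := by
          refine lintegral_mono fun x => ?_
          have : f x - ⨍ z in cube c l, f z = (f x - a) + (a - ⨍ z in cube c l, f z) := by ring
          rw [this]
          exact (enorm_add_le _ _).trans (by gcongr)
      _ = (∫⁻ x in cube c l, ‖f x - a‖ₑ) + C * volume (cube c l) := by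
          rw [lintegral_add_right _ measurable_const]; simp
      _ ≤ 2 * C * volume (cube c l) := by
          rw [two_mul, add_mul]; gcongr

lemma BMO.add {f g : E n → ℂ} (hf : f ∈ BMO n) (hg : g ∈ BMO n) : f + g ∈ BMO n := by
  rw [mem_BMO_iff] at *
  obtain ⟨hf1, C, hC⟩ := hf
  obtain ⟨hg1, D, hD⟩ := hg
  refine ⟨hf1.add hg1, C + D, fun c l hl => ?_⟩
  obtain ⟨a, ha⟩ := hC c l hl
  obtain ⟨b, hb⟩ := hD c l hl
  refine ⟨a + b, ?_⟩
  calc ∫⁻ x in cube c l, ‖(f + g) x - (a + b)‖ₑ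
      ≤ ∫⁻ x in cube c l, (‖f x - a‖ₑ + ‖g x - b‖ₑ) := by
        refine lintegral_mono fun x => ?_
        have : (f + g) x - (a + b) = (f x - a) + (g x - b) := by simp; ring
        rw [this]; exact enorm_add_le _ _
    _ = _ := lintegral_add_left'
        ((hf1.aestronglyMeasurable.restrict).sub aestronglyMeasurable_const).enorm _
    _ ≤ _ := by push_cast; rw [add_mul]; exact add_le_add ha hb

lemma BMO.const_mul {f : E n → ℂ} (hf : f ∈ BMO n) (k : ℂ) : (fun x => k * f x) ∈ BMO n := by
  rw [mem_BMO_iff] at *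
  obtain ⟨hf1, C, hC⟩ := hf
  refine ⟨hf1.smul k, ‖k‖₊ * C, fun c l hl => ?_⟩
  obtain ⟨a, ha⟩ := hC c l hl
  refine ⟨k * a, ?_⟩
  simp_rw [← mul_sub, enorm_mul]
  rw [lintegral_const_mul' _ _ (by finiteness)]
  push_cast
  rw [mul_assoc]
  exact mul_le_mul' le_rfl ha

/-! ### Reflection in the hyperplane bounding the half-spaces -/

section Reflection

variable [NeZero n]

/-- The reflection `xₙ ↦ -xₙ`. -/
def refl (n : ℕ) [NeZero n] : E n ≃ₗᵢ[ℝ] E n :=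
  LinearIsometryEquiv.piLpCongrRight 2 fun i =>
    if i = lastIdx n then LinearIsometryEquiv.neg ℝ else LinearIsometryEquiv.refl ℝ ℝ

lemma refl_last (x : E n) : refl n x (lastIdx n) = -x (lastIdx n) := by
  simp [refl]

lemma refl_of_ne (x : E n) {i : Fin n} (hi : i ≠ lastIdx n) : refl n x i = x i := by
  simp [refl, hi]

lemma refl_refl (x : E n) : refl n (refl n x) = x := by
  ext i
  by_cases hi : i = lastIdx n
  · subst hi; simp [refl_last]
  · simp [refl_of_ne _ hi]

lemma measurableEmbedding_refl : MeasurableEmbedding (refl n) :=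
  (refl n).toHomeomorph.toMeasurableEquiv.measurableEmbedding

/-- The half-space on which `s xₙ > 0`, where `s = ±1`. -/
def half (n : ℕ) [NeZero n] (s : ℝ) : Set (E n) := {x | 0 < s * x (lastIdx n)}

lemma half_one : half n 1 = upper n := by ext; simp [half, upper]

lemma half_neg_one : half n (-1) = lower n := by ext; simp [half, lower]

lemma isOpen_half (s : ℝ) : IsOpen (half n s) :=
  isOpen_lt continuous_const (by fun_prop)

lemma measurableSet_half (s : ℝ) : MeasurableSet (half n s) := (isOpen_half s).measurableSet

lemma refl_mem_half {s : ℝ} {x : E n} : refl n x ∈ half n s ↔ x ∈ half n (-s) := by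
  simp [half, refl_last]

lemma disjoint_half (s : ℝ) : Disjoint (half n s) (half n (-s)) := by
  rw [Set.disjoint_left]
  intro x hx hx'
  simp only [half, Set.mem_ofPred_eq] at hx hx'
  linarith

lemma volume_hyperplane : volume {x : E n | x (lastIdx n) = 0} = 0 := by
  let φ : E n →ₗ[ℝ] ℝ := (EuclideanSpace.proj (𝕜 := ℝ) (lastIdx n)).toLinearMap
  have h := Measure.addHaar_submodule (volume : Measure (E n)) (LinearMap.ker φ) (fun h => by
    have : EuclideanSpace.single (lastIdx n) (1 : ℝ) ∈ LinearMap.ker φ := by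
      rw [h]; trivial
    simp [φ] at this)
  rw [← h]
  congr 1

lemma ae_mem_half {s : ℝ} (hs : s ≠ 0) :
    ∀ᵐ x : E n, x ∈ half n s ∨ x ∈ half n (-s) := by
  have h := volume_hyperplane (n := n)
  rw [measure_eq_zero_iff_ae_notMem] at h
  filter_upwards [h] with x hx
  simp only [half, Set.mem_ofPred_eq] at hx ⊢
  rcases lt_or_gt_of_ne (mul_ne_zero hs hx) with h | h
  · right; linarith
  · left; exact h

/-! ### Even and odd extension from a half-space. -/

/-- The extension of `f` from the half-space with sign `s`, by reflection with parity `b`. -/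
def halfExt (s : ℝ) (b : ℂ) (f : E n → ℂ) (x : E n) : ℂ :=
  (half n s).indicator f x + b * (half n s).indicator f (refl n x)

lemma halfExt_of_mem {s : ℝ} (b : ℂ) (f : E n → ℂ) {x : E n} (hx : x ∈ half n s) :
    halfExt s b f x = f x := by
  have : refl n x ∉ half n s := fun h =>
    Set.disjoint_left.1 (disjoint_half s) hx (refl_mem_half.1 h)
  simp [halfExt, hx, this]

lemma halfExt_of_mem_neg {s : ℝ} (b : ℂ) (f : E n → ℂ) {x : E n} (hx : x ∈ half n (-s)) :
    halfExt s b f x = b * f (refl n x) := by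
  have : x ∉ half n s := fun h => Set.disjoint_left.1 (disjoint_half s) h hx
  simp [halfExt, this, refl_mem_half.2 hx]

lemma halfExt_refl (s : ℝ) {b : ℂ} (hb : b * b = 1) (f : E n → ℂ) (x : E n) :
    halfExt s b f (refl n x) = b * halfExt s b f x := by
  simp only [halfExt, refl_refl, mul_add, ← mul_assoc, hb]
  ring

lemma PolyInt.halfExt {f : E n → ℂ} (hf : PolyInt f) (s : ℝ) (b : ℂ) : PolyInt (halfExt s b f) :=
  (hf.indicator (measurableSet_half s)).add
    (((hf.indicator (measurableSet_half s)).comp_isometry (refl n)).const_mul b)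

lemma LocallyIntegrable.comp_refl {f : E n → ℂ} (hf : LocallyIntegrable f volume) :
    LocallyIntegrable (fun x => f (refl n x)) volume := by
  intro x
  obtain ⟨u, hu, hi⟩ := hf (refl n x)
  refine ⟨refl n ⁻¹' u, (refl n).continuous.continuousAt hu, ?_⟩
  exact ((refl n).measurePreserving.integrableOn_comp_preimage measurableEmbedding_refl).2 hi

lemma refl_preimage_cube (c : E n) (l : ℝ) : refl n ⁻¹' cube c l = cube (refl n c) l := by
  ext x
  simp only [cube, Set.mem_preimage, Set.mem_ofPred_eq]
  refine forall_congr' fun i => ?_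
  by_cases hi : i = lastIdx n
  · subst hi
    rw [refl_last, refl_last, ← abs_neg]; congr! 2; ring
  · rw [refl_of_ne _ hi, refl_of_ne _ hi]

lemma setLIntegral_comp_refl (f : E n → ℝ≥0∞) (s : Set (E n)) :
    ∫⁻ x in refl n ⁻¹' s, f (refl n x) = ∫⁻ x in s, f x :=
  (refl n).measurePreserving.setLIntegral_comp_preimage_emb measurableEmbedding_refl f s

lemma BMO.comp_refl {f : E n → ℂ} (hf : f ∈ BMO n) : (fun x => f (refl n x)) ∈ BMO n := by
  rw [mem_BMO_iff] at *
  obtain ⟨hf1, C, hC⟩ := hf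
  refine ⟨LocallyIntegrable.comp_refl hf1, C, fun c l hl => ?_⟩
  obtain ⟨a, ha⟩ := hC (refl n c) l hl
  refine ⟨a, ?_⟩
  have h1 : cube c l = refl n ⁻¹' cube (refl n c) l := by
    rw [refl_preimage_cube, refl_refl]
  rw [volume_cube _ hl] at ha ⊢
  rw [h1, setLIntegral_comp_refl (fun x => ‖f x - a‖ₑ)]
  exact ha

/-- Points on the same side satisfy `|xₙ - cₙ| ≤ |xₙ + cₙ|`: replacing a centre on the far side by
its mirror image only brings it closer. -/
lemma mem_cube_of_half {s : ℝ} (hs : s = 1 ∨ s = -1) {c x : E n} {l : ℝ}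
    (hc : 0 ≤ s * c (lastIdx n)) (hx : x ∈ half n s) (h : x ∈ cube (refl n c) l) :
    x ∈ cube c l := by
  intro i
  by_cases hi : i = lastIdx n
  · subst hi
    have := h (lastIdx n)
    rw [refl_last] at this
    simp only [half, Set.mem_ofPred_eq] at hx
    rw [abs_le] at this ⊢
    rcases hs with rfl | rfl <;> constructor <;> linarith
  · have := h i
    rwa [refl_of_ne _ hi] at this

lemma setLIntegral_split {s : ℝ} (hs : s ≠ 0) (f : E n → ℝ≥0∞) (t : Set (E n)) :
    ∫⁻ x in t, f x = (∫⁻ x in t ∩ half n s, f x) + ∫⁻ x in t ∩ half n (-s), f x := by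
  rw [← lintegral_inter_add_sdiff f t (measurableSet_half s)]
  congr 1
  refine setLIntegral_congr ?_
  filter_upwards [ae_mem_half hs] with x hx
  have h : x ∈ half n s → x ∉ half n (-s) := fun h => Set.disjoint_left.1 (disjoint_half s) h
  refine propext ?_
  change (x ∈ t \ half n s) ↔ (x ∈ t ∩ half n (-s))
  simp only [Set.mem_sdiff, Set.mem_inter_iff]
  tauto

/-- The even extension of a BMO function from a half-space is a BMO function. -/
lemma BMO.halfExt_even {s : ℝ} (hs : s = 1 ∨ s = -1) {f : E n → ℂ} (hf : f ∈ BMO n) :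
    halfExt s 1 f ∈ BMO n := by
  have hs0 : s ≠ 0 := by rcases hs with rfl | rfl <;> norm_num
  rw [mem_BMO_iff] at *
  obtain ⟨hf1, C, hC⟩ := hf
  have hi := hf1.indicator (measurableSet_half s)
  refine ⟨?_, 2 * C, fun c l hl => ?_⟩
  · have := hi.add (LocallyIntegrable.comp_refl hi)
    have he : halfExt s 1 f = (half n s).indicator f + fun x => (half n s).indicator f (refl n x) := by
      ext x
      simp [HeatBMO.halfExt]
    rwa [he]
  -- Let `c'` be whichever of `c` and its mirror image lies on the closed side `s`. The part of the
  -- cube on that side, and the reflection of its other part, both lie in the cube about `c'`. The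
  -- constant for that cube then serves both parts, at the cost of a factor `2`.
  obtain ⟨c', hc', hcc⟩ : ∃ c' : E n, 0 ≤ s * c' (lastIdx n) ∧ (c' = c ∨ c' = refl n c) := by
    by_cases h : 0 ≤ s * c (lastIdx n)
    · exact ⟨c, h, Or.inl rfl⟩
    · exact ⟨refl n c, by rw [refl_last]; linarith, Or.inr rfl⟩
  obtain ⟨a, ha⟩ := hC c' l hl
  refine ⟨a, ?_⟩
  have hsub : cube c l ∩ half n s ⊆ cube c' l := by
    rintro x ⟨hx, hx'⟩
    rcases hcc with rfl | rfl
    · exact hx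
    · exact mem_cube_of_half hs hc' hx' (by rwa [refl_refl])
  have hsub' : cube (refl n c) l ∩ half n s ⊆ cube c' l := by
    rintro x ⟨hx, hx'⟩
    rcases hcc with rfl | rfl
    · exact mem_cube_of_half hs hc' hx' hx
    · exact hx
  rw [setLIntegral_split hs0]
  have h1 : ∫⁻ x in cube c l ∩ half n s, ‖halfExt s 1 f x - a‖ₑ ≤ C * volume (cube c l) := by
    calc _ = ∫⁻ x in cube c l ∩ half n s, ‖f x - a‖ₑ :=
          setLIntegral_congr_fun ((isClosed_cube c l).measurableSet.inter (measurableSet_half s))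
            fun x hx => by simp only [halfExt_of_mem 1 f hx.2]
      _ ≤ _ := (lintegral_mono_set hsub).trans (by
            rw [volume_cube _ hl] at ha ⊢; exact ha)
  have h2 : ∫⁻ x in cube c l ∩ half n (-s), ‖halfExt s 1 f x - a‖ₑ ≤ C * volume (cube c l) := by
    calc _ = ∫⁻ x in cube c l ∩ half n (-s), ‖f (refl n x) - a‖ₑ :=
          setLIntegral_congr_fun ((isClosed_cube c l).measurableSet.inter (measurableSet_half _))
            fun x hx => by simp only [halfExt_of_mem_neg 1 f hx.2, one_mul]
      _ = ∫⁻ x in refl n ⁻¹' (cube (refl n c) l ∩ half n s), ‖f (refl n x) - a‖ₑ := by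
          congr 2
          ext x
          rw [Set.preimage_inter, refl_preimage_cube, refl_refl]
          simp [refl_mem_half]
      _ = ∫⁻ x in cube (refl n c) l ∩ half n s, ‖f x - a‖ₑ :=
          setLIntegral_comp_refl (fun x => ‖f x - a‖ₑ) _
      _ ≤ _ := (lintegral_mono_set hsub').trans (by
            rw [volume_cube _ hl] at ha ⊢; exact ha)
  calc _ ≤ C * volume (cube c l) + C * volume (cube c l) := add_le_add h1 h2
    _ = _ := by push_cast; ring

/-- The odd extension of a function whose extension by zero is in BMO. -/
lemma BMO.halfExt_odd {s : ℝ} {f : E n → ℂ} (hf : (half n s).indicator f ∈ BMO n) :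
    halfExt s (-1) f ∈ BMO n :=
  BMO.add hf (BMO.const_mul (BMO.comp_refl hf) (-1))

/-- The restriction of an odd BMO function to a half-space, extended by zero, is in BMO. -/
lemma BMO.indicator_of_odd {s : ℝ} (hs : s = 1 ∨ s = -1) {f : E n → ℂ} (hf : f ∈ BMO n)
    (hodd : ∀ x, f (refl n x) = -f x) : (half n s).indicator f ∈ BMO n := by
  -- Half the sum of `f` and the even extension of its restriction: the two agree on the half-space
  -- and, `f` being odd, cancel on the opposite one.
  have h := BMO.const_mul (BMO.add hf (BMO.halfExt_even hs hf)) (1 / 2)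
  convert h using 1
  ext x
  rcases lt_trichotomy (s * x (lastIdx n)) 0 with hx | hx | hx
  · have hm : x ∈ half n (-s) := by simp only [half, Set.mem_ofPred_eq]; linarith
    have hm' : x ∉ half n s := fun h => Set.disjoint_left.1 (disjoint_half s) h hm
    simp [halfExt_of_mem_neg 1 f hm, hm', hodd]
  · have hx0 : x (lastIdx n) = 0 := by rcases hs with rfl | rfl <;> linarith
    have hr : refl n x = x := by
      ext i
      by_cases hi : i = lastIdx n
      · subst hi; rw [refl_last, hx0, neg_zero]
      · rw [refl_of_ne _ hi]
    have hm' : x ∉ half n s := by simp [half, hx0]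
    -- The identity is needed at every point, so the hyperplane is checked as well: oddness at a
    -- fixed point of the reflection forces the value `0`.
    have : f x = 0 := by
      have := hodd x
      rw [hr] at this
      exact self_eq_neg.1 this
    simp [HeatBMO.halfExt, hr, hm', this]
  · have hm : x ∈ half n s := hx
    simp only [hm, Set.indicator_of_mem, Pi.add_apply, halfExt_of_mem 1 f hm]
    ring

end Reflection

/-! ### Gaussian averages -/

lemma two_rpow_mul (t : ℝ) (ht : 0 < t) : ((4 * Real.pi * t) ^ ((n : ℝ) / 2))⁻¹ =
    2 ^ ((n : ℝ) / 2) * ((4 * Real.pi * (2 * t)) ^ ((n : ℝ) / 2))⁻¹ := by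
  rw [show 4 * Real.pi * (2 * t) = 2 * (4 * Real.pi * t) by ring,
    Real.mul_rpow (x := 2) zero_le_two (by positivity), mul_inv, ← mul_assoc,
    mul_inv_cancel₀ (by positivity), one_mul]

lemma gauss_eq_two_mul {t : ℝ} (ht : 0 < t) (x : E n) : gauss t x =
    2 ^ ((n : ℝ) / 2) * Real.exp (-(1 / (8 * t)) * ‖x‖ ^ 2) * gauss (2 * t) x := by
  unfold gauss
  rw [two_rpow_mul t ht]
  have : -(1 / (4 * t)) * ‖x‖ ^ 2 = -(1 / (8 * t)) * ‖x‖ ^ 2 + -(1 / (4 * (2 * t))) * ‖x‖ ^ 2 := by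
    field_simp; ring
  rw [this, Real.exp_add]
  ring

/-- Since `|x - z|² ≤ 2|x - y|² + 2|y - z|²` and `|y - z|² ≤ t`, moving the point by less than `√t`
costs a fixed factor and a doubling of the time. -/
lemma gauss_le_of_dist_lt {t r : ℝ} (ht : 0 < t) (hr : r ^ 2 ≤ t) {x y z : E n}
    (h : ‖y - z‖ < r) :
    gauss t (x - y) ≤ 2 ^ ((n : ℝ) / 2) * Real.exp (1 / 4) * gauss (2 * t) (x - z) := by
  unfold gauss
  rw [two_rpow_mul t ht]
  suffices h0 : Real.exp (-(1 / (4 * t)) * ‖x - y‖ ^ 2) ≤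
      Real.exp (1 / 4 + -(1 / (4 * (2 * t))) * ‖x - z‖ ^ 2) by
    rw [Real.exp_add] at h0
    calc _ ≤ 2 ^ ((n : ℝ) / 2) * ((4 * Real.pi * (2 * t)) ^ ((n : ℝ) / 2))⁻¹ *
          (Real.exp (1 / 4) * Real.exp (-(1 / (4 * (2 * t))) * ‖x - z‖ ^ 2)) := by gcongr
      _ = _ := by ring
  refine Real.exp_le_exp.2 ?_
  have h1 : ‖x - z‖ ^ 2 ≤ 2 * ‖x - y‖ ^ 2 + 2 * ‖y - z‖ ^ 2 := by
    have h2 : ‖x - z‖ ≤ ‖x - y‖ + ‖y - z‖ := norm_sub_le_norm_sub_add_norm_sub x y z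
    have := norm_nonneg (x - z)
    nlinarith [sq_nonneg (‖x - y‖ - ‖y - z‖)]
  have h2 : ‖y - z‖ ^ 2 ≤ t := by
    have := norm_nonneg (y - z)
    nlinarith
  have h3 : ‖x - z‖ ^ 2 / (8 * t) ≤ (2 * ‖x - y‖ ^ 2 + 2 * t) / (8 * t) := by gcongr; linarith
  have h4 : (2 * ‖x - y‖ ^ 2 + 2 * t) / (8 * t) = ‖x - y‖ ^ 2 / (4 * t) + 1 / 4 := by
    field_simp; ring
  have h5 : 1 / 4 + -(1 / (4 * (2 * t))) * ‖x - z‖ ^ 2 = 1 / 4 - ‖x - z‖ ^ 2 / (8 * t) := by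
    field_simp; ring
  rw [h5]
  have h6 : -(1 / (4 * t)) * ‖x - y‖ ^ 2 = - (‖x - y‖ ^ 2 / (4 * t)) := by ring
  rw [h6]
  linarith

lemma lintegral_gauss_sub {t : ℝ} (ht : 0 < t) (x : E n) :
    ∫⁻ z, ENNReal.ofReal (gauss t (x - z)) = 1 := by
  rw [← ofReal_integral_eq_lintegral_ofReal ((integrable_gauss ht).comp_sub_left x)
    (ae_of_all _ fun z => (gauss_pos ht _).le), integral_sub_left_eq_self (gauss t) volume x,
    integral_gauss ht, ENNReal.ofReal_one]

lemma measurable_gauss (t : ℝ) : Measurable (gauss t : E n → ℝ) := (continuous_gauss t).measurable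

/-- Bounded averages at a scale `r ≤ √t` control the Gaussian average at time `t`. Insert an average
over `z` in the ball about `y`, replace `y` by `z` in the kernel at the cost of doubling the time,
and exchange the integrals: the inner one becomes a local average of `|f|`, and the outer kernel has
mass one. -/
lemma lintegral_gauss_mul_le {f : E n → ℂ} (hf : AEStronglyMeasurable f volume) {t r : ℝ}
    (hr0 : 0 < r) (hr : r ^ 2 ≤ t) {A : ℝ≥0}
    (h : ∀ z, ∫⁻ y in Metric.ball z r, ‖f y‖ₑ ≤ A * volume (Metric.ball z r)) (x : E n) :
    ∫⁻ y, ENNReal.ofReal (gauss t (x - y)) * ‖f y‖ₑ ≤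
      ENNReal.ofReal (2 ^ ((n : ℝ) / 2) * Real.exp (1 / 4)) * A := by
  have ht : 0 < t := lt_of_lt_of_le (by positivity) hr
  set K := ENNReal.ofReal (2 ^ ((n : ℝ) / 2) * Real.exp (1 / 4)) with hK
  set V := volume (Metric.ball (0 : E n) r) with hV
  have hVz : ∀ z : E n, volume (Metric.ball z r) = V := fun z => by
    rw [hV, Measure.addHaar_ball_center]
  have hV0 : V ≠ 0 := (Metric.measure_ball_pos volume _ hr0).ne'
  have hVT : V ≠ ⊤ := measure_ball_lt_top.ne
  have hms : MeasurableSet {p : E n × E n | dist p.1 p.2 < r} :=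
    (isOpen_lt (by fun_prop) continuous_const).measurableSet
  -- One jointly measurable indicator, read either as the ball about `y` or as the ball about `z`.
  set χ : E n → E n → ℝ≥0∞ := fun y z => {p : E n × E n | dist p.1 p.2 < r}.indicator 1 (y, z)
    with hχ
  have hχm : Measurable (Function.uncurry χ) := measurable_one.indicator hms
  have hχy : ∀ y z, χ y z = (Metric.ball y r).indicator 1 z := fun y z => by
    simp only [hχ, Set.indicator, Metric.mem_ball, Set.mem_ofPred_eq, dist_comm z y]
    rfl
  have hχz : ∀ y z, χ y z = (Metric.ball z r).indicator 1 y := fun y z => by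
    simp only [hχ, Set.indicator, Metric.mem_ball, Set.mem_ofPred_eq]
    rfl
  have key : (∫⁻ y, ENNReal.ofReal (gauss t (x - y)) * ‖f y‖ₑ) * V ≤ K * A * V := by
    calc (∫⁻ y, ENNReal.ofReal (gauss t (x - y)) * ‖f y‖ₑ) * V
        = ∫⁻ y, ∫⁻ z, χ y z * (ENNReal.ofReal (gauss t (x - y)) * ‖f y‖ₑ) := by
          rw [← lintegral_mul_const' _ _ hVT]
          congr 1 with y
          rw [lintegral_mul_const' _ _ (by finiteness)]
          simp_rw [hχy]
          rw [lintegral_indicator_one Metric.isOpen_ball.measurableSet, hVz, mul_comm]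
      _ ≤ ∫⁻ y, ∫⁻ z, χ y z * (K * ENNReal.ofReal (gauss (2 * t) (x - z)) * ‖f y‖ₑ) := by
          refine lintegral_mono fun y => lintegral_mono fun z => ?_
          by_cases hyz : dist y z < r
          · gcongr
            rw [hK, ← ENNReal.ofReal_mul (by positivity)]
            refine ENNReal.ofReal_le_ofReal (gauss_le_of_dist_lt ht hr ?_)
            rwa [← dist_eq_norm]
          · have : χ y z = 0 := by simp [hχ, hyz]
            simp [this]
      _ = ∫⁻ z, ∫⁻ y, χ y z * (K * ENNReal.ofReal (gauss (2 * t) (x - z)) * ‖f y‖ₑ) := by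
          refine lintegral_lintegral_swap ?_
          have m1 : Measurable fun p : E n × E n => K * ENNReal.ofReal (gauss (2 * t) (x - p.2)) :=
            ((measurable_gauss (2 * t)).comp
              (measurable_const.sub measurable_snd)).ennreal_ofReal.const_mul K
          exact hχm.aemeasurable.mul (m1.aemeasurable.mul hf.comp_fst.enorm)
      _ = ∫⁻ z, K * ENNReal.ofReal (gauss (2 * t) (x - z)) *
            ∫⁻ y in Metric.ball z r, ‖f y‖ₑ := by
          congr 1 with z
          rw [← lintegral_const_mul' _ _ (by finiteness),
            ← lintegral_indicator Metric.isOpen_ball.measurableSet]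
          congr 1 with y
          rw [hχz]
          by_cases hy : y ∈ Metric.ball z r
          · simp only [hy, Set.indicator_of_mem, Pi.one_apply, one_mul]
          · simp only [hy, not_false_eq_true, Set.indicator_of_notMem, zero_mul]
      _ ≤ ∫⁻ z, K * ENNReal.ofReal (gauss (2 * t) (x - z)) * (A * V) := by
          refine lintegral_mono fun z => ?_
          gcongr
          rw [← hVz z]; exact h z
      _ = K * A * V := by
          rw [lintegral_mul_const' _ _ (by finiteness), lintegral_const_mul' _ _ (by finiteness),
            lintegral_gauss_sub (by positivity)]
          ring
  exact (ENNReal.mul_le_mul_iff_left hV0 hVT).1 key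

/-- A Lipschitz bound that keeps half of the decay. If `b ≤ a + 1`, the factor `b + a ≤ 2a + 1` is
absorbed by the other half of the exponent; if `b ≥ a + 1`, the first exponential alone is already
below the bound. -/
lemma exp_neg_sq_sub_le {a b : ℝ} (ha : 0 ≤ a) (hab : a ≤ b) :
    |Real.exp (-a ^ 2) - Real.exp (-b ^ 2)| ≤ 3 * (b - a) * Real.exp (-a ^ 2 / 2) := by
  have hle : Real.exp (-b ^ 2) ≤ Real.exp (-a ^ 2) := Real.exp_le_exp.2 (by nlinarith)
  have hba : 0 ≤ b - a := by linarith
  rw [abs_of_nonneg (by linarith)]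
  have h1 : Real.exp (-a ^ 2) = Real.exp (-a ^ 2 / 2) * Real.exp (-a ^ 2 / 2) := by
    rw [← Real.exp_add]; congr 1; ring
  have he : 0 < Real.exp (-a ^ 2 / 2) := Real.exp_pos _
  have he1 : Real.exp (-a ^ 2 / 2) ≤ 1 := Real.exp_le_one_iff.2 (by nlinarith)
  have h2 : (2 * a + 1) * Real.exp (-a ^ 2 / 2) ≤ 3 := by
    have h3 : 1 + a ^ 2 / 2 ≤ Real.exp (a ^ 2 / 2) := by
      linarith [Real.add_one_le_exp (a ^ 2 / 2)]
    have h4 : Real.exp (a ^ 2 / 2) * Real.exp (-a ^ 2 / 2) = 1 := by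
      rw [← Real.exp_add]; simp [neg_div]
    have h5 : 2 * a + 1 ≤ 3 * Real.exp (a ^ 2 / 2) := by nlinarith [sq_nonneg (a - 1)]
    nlinarith
  rcases le_total b (a + 1) with hb | hb
  · have h3 : Real.exp (-b ^ 2) = Real.exp (-a ^ 2) * Real.exp (a ^ 2 - b ^ 2) := by
      rw [← Real.exp_add]; congr 1; ring
    have h4 : 1 + (a ^ 2 - b ^ 2) ≤ Real.exp (a ^ 2 - b ^ 2) := by
      linarith [Real.add_one_le_exp (a ^ 2 - b ^ 2)]
    calc Real.exp (-a ^ 2) - Real.exp (-b ^ 2)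
        = Real.exp (-a ^ 2) * (1 - Real.exp (a ^ 2 - b ^ 2)) := by rw [h3]; ring
      _ ≤ Real.exp (-a ^ 2) * (b ^ 2 - a ^ 2) :=
          mul_le_mul_of_nonneg_left (by linarith) (Real.exp_pos _).le
      _ = ((b + a) * Real.exp (-a ^ 2 / 2)) * (b - a) * Real.exp (-a ^ 2 / 2) := by rw [h1]; ring
      _ ≤ 3 * (b - a) * Real.exp (-a ^ 2 / 2) := by
          have : (b + a) * Real.exp (-a ^ 2 / 2) ≤ 3 := 
            le_trans (mul_le_mul_of_nonneg_right (by linarith) he.le) h2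
          gcongr
  · have h6 : 0 ≤ Real.exp (-b ^ 2) := (Real.exp_pos _).le
    nlinarith

/-- The one-variable estimate at `|w| / (2√t)` and `|w'| / (2√t)`; the surviving half of the
exponent is the Gaussian at time `2t`. The sum on the right makes the bound symmetric, so one may
assume `|w| ≤ |w'|`. -/
lemma abs_gauss_sub_le {t : ℝ} (ht : 0 < t) (w w' : E n) :
    |gauss t w - gauss t w'| ≤ 3 * 2 ^ ((n : ℝ) / 2) * (‖w - w'‖ / √t) *
      (gauss (2 * t) w + gauss (2 * t) w') := by
  wlog hle : ‖w‖ ≤ ‖w'‖ generalizing w w'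
  · rw [abs_sub_comm, norm_sub_rev, add_comm]
    exact this w' w (le_of_not_ge hle)
  have hs : 0 < √t := Real.sqrt_pos.2 ht
  have hst : √t ^ 2 = t := Real.sq_sqrt ht.le
  have h := exp_neg_sq_sub_le (a := ‖w‖ / (2 * √t)) (b := ‖w'‖ / (2 * √t)) (by positivity)
    (by gcongr)
  have e1 : ∀ v : E n, -(1 / (4 * t)) * ‖v‖ ^ 2 = -(‖v‖ / (2 * √t)) ^ 2 := fun v => by
    rw [div_pow, mul_pow, hst]; field_simp; ring
  have e2 : -(1 / (4 * (2 * t))) * ‖w‖ ^ 2 = -(‖w‖ / (2 * √t)) ^ 2 / 2 := by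
    rw [div_pow, mul_pow, hst]; field_simp; norm_num
  have hd : ‖w'‖ / (2 * √t) - ‖w‖ / (2 * √t) ≤ ‖w - w'‖ / √t := by
    rw [← sub_div]
    have : ‖w'‖ - ‖w‖ ≤ ‖w - w'‖ := by rw [norm_sub_rev]; exact norm_sub_norm_le _ _
    have h0 := norm_nonneg (w - w')
    calc _ ≤ ‖w - w'‖ / (2 * √t) := by gcongr
      _ ≤ _ := by gcongr; linarith
  set c := ((4 * Real.pi * (2 * t)) ^ ((n : ℝ) / 2))⁻¹ with hc
  have hc0 : 0 < c := by positivity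
  have g1 : ∀ v : E n, gauss t v = 2 ^ ((n : ℝ) / 2) * c * Real.exp (-(‖v‖ / (2 * √t)) ^ 2) :=
    fun v => by rw [gauss, two_rpow_mul t ht, e1]
  have g2 : gauss (2 * t) w = c * Real.exp (-(‖w‖ / (2 * √t)) ^ 2 / 2) := by
    rw [gauss, e2]
  have g3 := gauss_pos (by positivity : 0 < 2 * t) w'
  have g4 := gauss_pos (by positivity : 0 < 2 * t) w
  rw [g1, g1, ← mul_sub, abs_mul, abs_of_pos (by positivity)]
  calc _ ≤ 2 ^ ((n : ℝ) / 2) * c * (3 * (‖w - w'‖ / √t) *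
        Real.exp (-(‖w‖ / (2 * √t)) ^ 2 / 2)) := by
        gcongr
        exact h.trans (by gcongr)
    _ = 3 * 2 ^ ((n : ℝ) / 2) * (‖w - w'‖ / √t) * gauss (2 * t) w := by rw [g2]; ring
    _ ≤ _ := by gcongr; linarith

/-- The Lipschitz constant in `norm_euclHeat_sub_le`. -/
def lipConst (n : ℕ) : ℝ :=
  3 * 2 ^ ((n : ℝ) / 2) * (2 * (2 ^ ((n : ℝ) / 2) * Real.exp (1 / 4)))

lemma lipConst_pos (n : ℕ) : 0 < lipConst n := by unfold lipConst; positivity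

/-- The central smoothing estimate: the kernel difference is dominated by Gaussians at time `2t`,
whose averages of `|f|` are controlled by the averages over balls of the smaller radius `r`. The
gain `1 / √t` later makes the dyadic series converge. -/
lemma norm_euclHeat_sub_le {f : E n → ℂ} (hf : PolyInt f) {t r : ℝ}
    (hr0 : 0 < r) (hr : r ^ 2 ≤ t) {A : ℝ≥0}
    (h : ∀ z, ∫⁻ y in Metric.ball z r, ‖f y‖ₑ ≤ A * volume (Metric.ball z r)) (x x' : E n) :
    ‖euclHeat t f x - euclHeat t f x'‖ ≤ lipConst n * A * (‖x - x'‖ / √t) := by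
  have ht : 0 < t := lt_of_lt_of_le (by positivity) hr
  set K := 2 ^ ((n : ℝ) / 2) * Real.exp (1 / 4) with hK
  set L := 3 * 2 ^ ((n : ℝ) / 2) * (‖x - x'‖ / √t) with hL
  have hL0 : 0 ≤ L := by positivity
  have hav := fun x => lintegral_gauss_mul_le hf.aesm hr0 (hr.trans (by linarith : t ≤ 2 * t)) h x
  have hk := gaussDecay_gaussC (n := n) ht
  have key : ‖euclHeat t f x - euclHeat t f x'‖ₑ ≤ ENNReal.ofReal (L * (2 * (K * A))) := by
    rw [euclHeat, conv, conv, ← integral_sub (hk.integrable_conv hf x) (hk.integrable_conv hf x')]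
    calc _ ≤ ∫⁻ y, ‖gaussC t (x - y) * f y - gaussC t (x' - y) * f y‖ₑ :=
          enorm_integral_le_lintegral_enorm _
      _ ≤ ∫⁻ y, ENNReal.ofReal L * (ENNReal.ofReal (gauss (2 * t) (x - y)) * ‖f y‖ₑ +
            ENNReal.ofReal (gauss (2 * t) (x' - y)) * ‖f y‖ₑ) := by
          refine lintegral_mono fun y => ?_
          rw [← sub_mul, enorm_mul, ← add_mul, ← mul_assoc,
            ← ENNReal.ofReal_add (gauss_pos (by positivity) _).le (gauss_pos (by positivity) _).le,
            ← ENNReal.ofReal_mul hL0]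
          gcongr
          rw [gaussC, gaussC, ← Complex.ofReal_sub, ← ofReal_norm, Complex.norm_real]
          refine ENNReal.ofReal_le_ofReal ?_
          have := abs_gauss_sub_le ht (x - y) (x' - y)
          rwa [sub_sub_sub_cancel_right] at this
      _ ≤ ENNReal.ofReal L * (ENNReal.ofReal K * A + ENNReal.ofReal K * A) := by
          rw [lintegral_const_mul' _ _ (by finiteness), lintegral_add_left']
          · gcongr
            · exact hav x
            · exact hav x'
          · refine AEMeasurable.mul (Measurable.aemeasurable ?_) hf.aesm.enorm
            exact ((measurable_gauss (2 * t)).comp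
              (measurable_const.sub measurable_id)).ennreal_ofReal
      _ = _ := by
          rw [ENNReal.ofReal_mul hL0, ENNReal.ofReal_mul zero_le_two,
            ENNReal.ofReal_mul (by positivity : 0 ≤ K), ENNReal.ofReal_coe_nnreal, ← two_mul,
            ENNReal.ofReal_ofNat]
  have h0 : 0 ≤ L * (2 * (K * A)) := by positivity
  rw [← ofReal_norm, ENNReal.ofReal_le_ofReal_iff h0] at key
  refine key.trans (le_of_eq ?_)
  rw [lipConst, hL, hK]; ring

/-! ### BMO functions have bounded heat oscillation -/

/-- The averages of `|f - exp(r²Δ) f|` over balls of radius `r` are bounded by `A`. -/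
def HeatOsc (A : ℝ≥0) (f : E n → ℂ) : Prop :=
  ∀ (y : E n) (r : ℝ), 0 < r → ∫⁻ x in Metric.ball y r, ‖f x - euclHeat (r ^ 2) f x‖ₑ ≤
    A * volume (Metric.ball y r)

/-- After factoring out `r ^ N`, the polynomial in `|z| / r` is absorbed by half of the Gaussian
exponent. The `3` is `1 + 1 / (4b)` with `b = 1/8`. -/
lemma gauss_mul_pow_le {r : ℝ} (hr : 0 < r) (N : ℕ) (z : E n) :
    gauss (r ^ 2) z * (r + ‖z‖) ^ N ≤
      2 ^ ((n : ℝ) / 2) * (N.factorial * Real.exp 3) * r ^ N * gauss (2 * r ^ 2) z := by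
  have h := exp_mul_pow_le N (b := 1 / 8) (by norm_num) (r := ‖z‖ / r) (by positivity)
  have e : -(1 / (8 * r ^ 2)) * ‖z‖ ^ 2 = -(1 / 8) * (‖z‖ / r) ^ 2 := by
    rw [div_pow]; field_simp
  have e2 : (r + ‖z‖) ^ N = r ^ N * (1 + ‖z‖ / r) ^ N := by
    rw [← mul_pow]; congr 1; field_simp
  have g := gauss_pos (by positivity : 0 < 2 * r ^ 2) z
  norm_num at h
  rw [gauss_eq_two_mul (by positivity), e, e2]
  calc _ = 2 ^ ((n : ℝ) / 2) * (Real.exp (-(1 / 8) * (‖z‖ / r) ^ 2) * (1 + ‖z‖ / r) ^ N) * r ^ N *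
        gauss (2 * r ^ 2) z := by ring
    _ ≤ _ := by
        rw [neg_mul]
        refine mul_le_mul_of_nonneg_right (mul_le_mul_of_nonneg_right
          (mul_le_mul_of_nonneg_left h (by positivity)) (by positivity)) g.le

lemma sub_euclHeat_eq {f : E n → ℂ} (hf : PolyInt f) {t : ℝ} (ht : 0 < t) (x : E n) :
    f x - euclHeat t f x = ∫ z, gaussC t z * (f x - f (x - z)) := by
  have h1 : Integrable (fun z : E n => gaussC t z * f x) volume :=
    ((integrable_gauss (n := n) ht).ofReal (𝕜 := ℂ)).mul_const (f x)
  have h2 : Integrable (fun z => gaussC t z * f (x - z)) volume := by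
    have := ((gaussDecay_gaussC ht).integrable_conv hf x).comp_sub_left x
    simpa using this
  simp_rw [mul_sub]
  rw [integral_sub h1 h2, euclHeat, conv_eq_integral_sub]
  congr 1
  rw [integral_mul_const]
  simp only [gaussC]
  rw [integral_complex_ofReal, integral_gauss ht]
  simp

/-- The difference `f(x) - exp(r²Δ)f(x)` is the Gaussian average of `f(x) - f(x - z)`. For fixed
`z`, a ball of radius `r` and its translate by `-z` lie in a common cube of side `2(r + |z|)`, on
which `f` is close to one constant in mean. The resulting factor `(r + |z|)^n` integrates to a
multiple of `r^n` against the Gaussian. -/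
lemma BMO.heatOsc {f : E n → ℂ} (hf : f ∈ BMO n) (hf' : PolyInt f) : ∃ A : ℝ≥0, HeatOsc A f := by
  rw [mem_BMO_iff] at hf
  obtain ⟨-, C, hC⟩ := hf
  have hm := hf'.aesm
  set κ := volume (cube (0 : E n) 1) with hκ
  have hκT : κ ≠ ⊤ := (volume_cube_lt_top _ _).ne
  set B := volume (Metric.ball (0 : E n) 1) with hB
  have hB0 : B ≠ 0 := (Metric.measure_ball_pos volume _ one_pos).ne'
  have hBT : B ≠ ⊤ := measure_ball_lt_top.ne
  set M : ℝ := 2 ^ ((n : ℝ) / 2) * (n.factorial * Real.exp 3) with hM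
  have hM0 : 0 ≤ M := by positivity
  set D : ℝ≥0∞ := 2 * C * (2 ^ n * ENNReal.ofReal M) * κ with hD
  have hDT : D ≠ ⊤ := by rw [hD]; finiteness
  refine ⟨(D / B).toNNReal, fun y r hr => ?_⟩
  rw [ENNReal.coe_toNNReal (ENNReal.div_ne_top hDT hB0)]
  have hball : volume (Metric.ball y r) = ENNReal.ofReal (r ^ n) * B := by
    rw [Measure.addHaar_ball_of_pos _ _ hr]; simp [hB]
  rw [hball, mul_left_comm, ENNReal.div_mul_cancel hB0 hBT]
  have hr2 : 0 < r ^ 2 := by positivity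
  -- Since `f` is only measurable up to null sets, joint measurability uses that subtraction pulls
  -- null sets back to null sets.
  have hjoint : AEStronglyMeasurable (fun p : E n × E n => f (p.1 - p.2))
      ((volume.restrict (Metric.ball y r)).prod volume) := by
    have := hm.comp_quasiMeasurePreserving
      (quasiMeasurePreserving_sub_of_right_invariant (volume : Measure (E n)) volume)
    refine this.mono_ac ?_
    exact Measure.AbsolutelyContinuous.prod Measure.restrict_le_self.absolutelyContinuous
      Measure.AbsolutelyContinuous.rfl
  have step : ∀ z : E n, ∫⁻ x in Metric.ball y r, ‖f x - f (x - z)‖ₑ ≤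
      2 * C * (ENNReal.ofReal (2 * (r + ‖z‖)) ^ n * κ) := fun z => by
    obtain ⟨a, ha⟩ := hC y (2 * (r + ‖z‖)) (by positivity)
    have s1 : Metric.ball y r ⊆ cube y (2 * (r + ‖z‖)) :=
      (Metric.ball_subset_ball (by linarith [norm_nonneg z])).trans (ball_subset_cube y _)
    have s2 : Metric.ball y r ⊆ (fun x => x - z) ⁻¹' cube y (2 * (r + ‖z‖)) := fun x hx => by
      refine ball_subset_cube y _ ?_
      rw [Metric.mem_ball, dist_eq_norm] at hx ⊢
      calc ‖x - z - y‖ = ‖(x - y) - z‖ := by congr 1; abel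
        _ ≤ ‖x - y‖ + ‖z‖ := norm_sub_le _ _
        _ < _ := by linarith
    rw [volume_cube _ (by positivity)] at ha
    calc ∫⁻ x in Metric.ball y r, ‖f x - f (x - z)‖ₑ
        ≤ ∫⁻ x in Metric.ball y r, (‖f x - a‖ₑ + ‖f (x - z) - a‖ₑ) := by
          refine lintegral_mono fun x => ?_
          have : f x - f (x - z) = (f x - a) - (f (x - z) - a) := by ring
          rw [this]; exact enorm_sub_le
      _ = (∫⁻ x in Metric.ball y r, ‖f x - a‖ₑ) + ∫⁻ x in Metric.ball y r, ‖f (x - z) - a‖ₑ :=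
          lintegral_add_left' (hm.restrict.sub aestronglyMeasurable_const).enorm _
      _ ≤ (∫⁻ x in cube y (2 * (r + ‖z‖)), ‖f x - a‖ₑ) +
            ∫⁻ x in (fun x => x - z) ⁻¹' cube y (2 * (r + ‖z‖)), ‖f (x - z) - a‖ₑ := by
          exact add_le_add (lintegral_mono_set s1) (lintegral_mono_set s2)
      _ = (∫⁻ x in cube y (2 * (r + ‖z‖)), ‖f x - a‖ₑ) +
            ∫⁻ x in cube y (2 * (r + ‖z‖)), ‖f x - a‖ₑ := by
          rw [(measurePreserving_sub_right volume z).setLIntegral_comp_preimage_emb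
            (Homeomorph.subRight z).measurableEmbedding (fun x => ‖f x - a‖ₑ)]
      _ ≤ _ := by rw [← two_mul, mul_assoc]; gcongr
  calc ∫⁻ x in Metric.ball y r, ‖f x - euclHeat (r ^ 2) f x‖ₑ
      ≤ ∫⁻ x in Metric.ball y r, ∫⁻ z, ENNReal.ofReal (gauss (r ^ 2) z) * ‖f x - f (x - z)‖ₑ := by
        refine lintegral_mono fun x => ?_
        rw [sub_euclHeat_eq hf' hr2]
        refine (enorm_integral_le_lintegral_enorm _).trans (le_of_eq ?_)
        congr 1 with z
        rw [enorm_mul, gaussC, ← ofReal_norm, Complex.norm_real,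
          Real.norm_of_nonneg (gauss_pos hr2 z).le]
    _ = ∫⁻ z, ∫⁻ x in Metric.ball y r, ENNReal.ofReal (gauss (r ^ 2) z) * ‖f x - f (x - z)‖ₑ := by
        have m1 : Measurable fun p : E n × E n => ENNReal.ofReal (gauss (r ^ 2) p.2) :=
          ((measurable_gauss (r ^ 2)).comp measurable_snd).ennreal_ofReal
        exact lintegral_lintegral_swap
          (m1.aemeasurable.mul (hm.restrict.comp_fst.sub hjoint).enorm)
    _ ≤ ∫⁻ z, 2 * C * (2 ^ n * ENNReal.ofReal M) * κ * ENNReal.ofReal (r ^ n) *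
          ENNReal.ofReal (gauss (2 * r ^ 2) z) := by
        refine lintegral_mono fun z => ?_
        rw [lintegral_const_mul' _ _ (by finiteness)]
        have hg := gauss_mul_pow_le hr n z
        calc _ ≤ ENNReal.ofReal (gauss (r ^ 2) z) *
              (2 * C * (ENNReal.ofReal (2 * (r + ‖z‖)) ^ n * κ)) := by gcongr; exact step z
          _ = 2 * C * 2 ^ n * κ * ENNReal.ofReal (gauss (r ^ 2) z * (r + ‖z‖) ^ n) := by
              rw [ENNReal.ofReal_mul (gauss_pos hr2 z).le, ENNReal.ofReal_mul (by norm_num),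
                ENNReal.ofReal_pow (by positivity), mul_pow]
              simp only [ENNReal.ofReal_ofNat]
              ring
          _ ≤ 2 * C * 2 ^ n * κ * ENNReal.ofReal (M * r ^ n * gauss (2 * r ^ 2) z) := by
              gcongr
          _ = _ := by
              rw [ENNReal.ofReal_mul (by positivity), ENNReal.ofReal_mul hM0]
              ring
    _ = ENNReal.ofReal (r ^ n) * D := by
        have hT : 2 * C * (2 ^ n * ENNReal.ofReal M) * κ * ENNReal.ofReal (r ^ n) ≠ ⊤ := by
          finiteness
        rw [lintegral_const_mul' _ _ hT]
        have h1 := lintegral_gauss_sub (n := n) (by positivity : 0 < 2 * r ^ 2) 0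
        simp only [zero_sub, gauss, norm_neg] at h1
        simp only [gauss]
        rw [h1, mul_one, mul_comm, hD]

/-! ### Splitting off a caloric part -/

lemma euclHeat_add {t : ℝ} (ht : 0 < t) {F G : E n → ℂ} (hF : PolyInt F) (hG : PolyInt G)
    (x : E n) : euclHeat t (F + G) x = euclHeat t F x + euclHeat t G x :=
  conv_add (gaussDecay_gaussC ht) hF hG x

lemma euclHeat_sub {t : ℝ} (ht : 0 < t) {F G : E n → ℂ} (hF : PolyInt F) (hG : PolyInt G)
    (x : E n) : euclHeat t (F - G) x = euclHeat t F x - euclHeat t G x :=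
  conv_sub (gaussDecay_gaussC ht) hF hG x

lemma HeatOsc.ball_le {A : ℝ≥0} {f : E n → ℂ} (hf : HeatOsc A f) {t : ℝ} (ht : 0 < t) (z : E n) :
    ∫⁻ y in Metric.ball z (√t), ‖(f - euclHeat t f) y‖ₑ ≤ A * volume (Metric.ball z (√t)) := by
  have := hf z (√t) (Real.sqrt_pos.2 ht)
  rwa [Real.sq_sqrt ht.le] at this

/-- The smoothing estimate applied to `f - exp(sΔ)f`, whose averages over balls of radius `√s ≤ √t`
are at most `A`; the semigroup law rewrites its evolution. -/
lemma norm_euclHeat_sub_add_le {A : ℝ≥0} {f : E n → ℂ} (hf' : PolyInt f) (hf : HeatOsc A f)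
    {s t : ℝ} (hs : 0 < s) (hst : s ≤ t) (x x' : E n) :
    ‖(euclHeat t f x - euclHeat t f x') - (euclHeat (t + s) f x - euclHeat (t + s) f x')‖ ≤
      lipConst n * A * (‖x - x'‖ / √t) := by
  have ht : 0 < t := hs.trans_le hst
  have hk : ∀ {t : ℝ}, 0 < t → GaussDecay (gaussC t : E n → ℂ) := gaussDecay_gaussC
  have hP : PolyInt (euclHeat s f) := hf'.conv (hk hs)
  have h := norm_euclHeat_sub_le (hf'.sub hP) (Real.sqrt_pos.2 hs)
    ((Real.sq_sqrt hs.le).trans_le hst) (hf.ball_le hs) x x'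
  have e : ∀ x, euclHeat t (f - euclHeat s f) x = euclHeat t f x - euclHeat (t + s) f x :=
    fun x => by rw [euclHeat_sub ht hf' hP, euclHeat_semigroup ht hs hf']
  rw [e, e] at h
  convert h using 2
  ring

/-- The ratio `2^{-1/2}`. -/
def ratio : ℝ := (√2)⁻¹

lemma ratio_pos : 0 < ratio := by unfold ratio; positivity

lemma ratio_lt_one : ratio < 1 := by
  unfold ratio
  exact inv_lt_one_of_one_lt₀ (by rw [Real.lt_sqrt] <;> norm_num)

lemma sqrt_two_zpow (j : ℤ) : √((2 : ℝ) ^ j) = (ratio ^ j)⁻¹ := by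
  rw [ratio, inv_zpow, inv_inv]
  have h : ((2 : ℝ) ^ j) = (√2 ^ j) ^ 2 := by
    rw [← zpow_natCast, zpow_comm, zpow_natCast, Real.sq_sqrt zero_le_two]
  rw [h, Real.sqrt_sq (by positivity)]

section Caloric

variable {A : ℝ≥0} {f : E n → ℂ}

/-- Differences of the dyadic heat evolution. -/
def dyadicDiff (f : E n → ℂ) (x x' : E n) (j : ℤ) : ℂ :=
  euclHeat ((2 : ℝ) ^ j) f x - euclHeat ((2 : ℝ) ^ j) f x'

lemma dist_dyadicDiff_succ_le (hf' : PolyInt f) (hf : HeatOsc A f) (x x' : E n) (j : ℤ) :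
    dist (dyadicDiff f x x' j) (dyadicDiff f x x' (j + 1)) ≤
      lipConst n * A * ‖x - x'‖ * ratio ^ j := by
  have h2 : (0 : ℝ) < 2 ^ j := by positivity
  have h := norm_euclHeat_sub_add_le hf' hf h2 le_rfl x x'
  rw [dist_eq_norm, dyadicDiff, dyadicDiff, zpow_add_one₀ two_ne_zero, mul_two]
  rw [sqrt_two_zpow, div_inv_eq_mul, ← mul_assoc] at h
  exact h

lemma dist_dyadicDiff_nat_le (hf' : PolyInt f) (hf : HeatOsc A f) (x x' : E n) (j : ℤ) (k : ℕ) :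
    dist (dyadicDiff f x x' (j + k)) (dyadicDiff f x x' (j + (k + 1 : ℕ))) ≤
      lipConst n * A * ‖x - x'‖ * ratio ^ j * ratio ^ k := by
  have h := dist_dyadicDiff_succ_le hf' hf x x' (j + k)
  rw [zpow_add₀ ratio_pos.ne', zpow_natCast, ← mul_assoc] at h
  push_cast
  rwa [← add_assoc]

lemma exists_tendsto_dyadicDiff (hf' : PolyInt f) (hf : HeatOsc A f) (x x' : E n) :
    ∃ a, Tendsto (fun k : ℕ => dyadicDiff f x x' k) atTop (𝓝 a) := by
  refine cauchySeq_tendsto_of_complete (cauchySeq_of_le_geometric ratio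
    (lipConst n * A * ‖x - x'‖) ratio_lt_one fun k => ?_)
  simpa using dist_dyadicDiff_nat_le hf' hf x x' 0 k

open Classical in
/-- The limit of the differences `exp(tΔ) f (x) - exp(tΔ) f (0)` as `t → ∞` along powers of `2`. -/
def caloric (f : E n → ℂ) (x : E n) : ℂ :=
  if h : ∃ a, Tendsto (fun k : ℕ => dyadicDiff f x 0 k) atTop (𝓝 a) then h.choose else 0

lemma tendsto_caloric (hf' : PolyInt f) (hf : HeatOsc A f) (x : E n) :
    Tendsto (fun k : ℕ => dyadicDiff f x 0 k) atTop (𝓝 (caloric f x)) := by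
  have h := exists_tendsto_dyadicDiff hf' hf x 0
  rw [caloric, dif_pos h]
  exact h.choose_spec

lemma tendsto_dyadicDiff (hf' : PolyInt f) (hf : HeatOsc A f) (x x' : E n) (j : ℤ) :
    Tendsto (fun k : ℕ => dyadicDiff f x x' (j + k)) atTop (𝓝 (caloric f x - caloric f x')) := by
  have h : Tendsto (fun k : ℕ => dyadicDiff f x x' k) atTop (𝓝 (caloric f x - caloric f x')) := by
    refine ((tendsto_caloric hf' hf x).sub (tendsto_caloric hf' hf x')).congr fun k => ?_
    simp [dyadicDiff]
  -- The integer `j` may be negative, so passing to natural indices is exact only eventually.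
  have hj : Tendsto (fun k : ℕ => (j + k).toNat) atTop atTop := by
    rw [tendsto_atTop]
    intro b
    filter_upwards [eventually_ge_atTop (b + j.natAbs)] with k hk
    omega
  refine (h.comp hj).congr' ?_
  filter_upwards [eventually_ge_atTop j.natAbs] with k hk
  have : (((j + k).toNat : ℕ) : ℤ) = j + k := by omega
  simp only [Function.comp_apply, this]

/-- The tail of the geometric series from time `2^j` on. As `ratio ^ j = 1 / √(2^j)`, the error is
bounded as long as `|x - x'|` is at most of order `√(2^j)`. -/
lemma norm_dyadicDiff_sub_caloric_le (hf' : PolyInt f) (hf : HeatOsc A f) (x x' : E n) (j : ℤ) :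
    ‖dyadicDiff f x x' j - (caloric f x - caloric f x')‖ ≤
      lipConst n * A * ‖x - x'‖ * ratio ^ j / (1 - ratio) := by
  have := dist_le_of_le_geometric_of_tendsto₀ ratio (lipConst n * A * ‖x - x'‖ * ratio ^ j)
    ratio_lt_one (dist_dyadicDiff_nat_le hf' hf x x' j) (tendsto_dyadicDiff hf' hf x x' j)
  rw [dist_eq_norm] at this
  simpa using this

lemma caloric_zero (hf' : PolyInt f) (hf : HeatOsc A f) : caloric f 0 = 0 := by
  refine tendsto_nhds_unique (tendsto_caloric hf' hf 0) ?_
  simp [dyadicDiff]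

lemma aestronglyMeasurable_caloric (hf' : PolyInt f) (hf : HeatOsc A f) :
    AEStronglyMeasurable (caloric f) volume := by
  refine aestronglyMeasurable_of_tendsto_ae atTop (f := fun (k : ℕ) x => dyadicDiff f x 0 k)
    (fun k => ?_) (ae_of_all _ (tendsto_caloric hf' hf))
  exact (conv_aesm (gaussDecay_gaussC (by positivity)).1 hf'.aesm).sub aestronglyMeasurable_const

/-- Compare with the evolution at time `1`, which has polynomial growth; by the tail estimate with
`j = 0` the error is at most linear. -/
lemma exists_norm_caloric_le (hf' : PolyInt f) (hf : HeatOsc A f) :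
    ∃ (C : ℝ) (N : ℕ), ∀ x, ‖caloric f x‖ ≤ C * (1 + ‖x‖) ^ N := by
  obtain ⟨C, N, hC, h⟩ := (gaussDecay_gaussC (n := n) one_pos).norm_conv_le hf'
  set D := lipConst n * A / (1 - ratio) with hD
  have hr : 0 < 1 - ratio := sub_pos.2 ratio_lt_one
  have hD0 : 0 ≤ D := by have := lipConst_pos n; positivity
  refine ⟨2 * C + D, N + 1, fun x => ?_⟩
  have h1 := norm_dyadicDiff_sub_caloric_le hf' hf x 0 0
  rw [caloric_zero hf' hf, sub_zero, sub_zero, zpow_zero, mul_one, mul_div_right_comm,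
    ← hD] at h1
  have hx : 1 ≤ 1 + ‖x‖ := by linarith [norm_nonneg x]
  have hp : (1 + ‖x‖) ^ N ≤ (1 + ‖x‖) ^ (N + 1) := pow_le_pow_right₀ hx (by omega)
  have hp1 : (1 : ℝ) ≤ (1 + ‖x‖) ^ (N + 1) := one_le_pow₀ hx
  have hp2 : ‖x‖ ≤ (1 + ‖x‖) ^ (N + 1) :=
    (by linarith : ‖x‖ ≤ 1 + ‖x‖).trans (le_self_pow₀ hx (by omega))
  have h2 : ‖dyadicDiff f x 0 0‖ ≤ C * (1 + ‖x‖) ^ N + C := by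
    have h3 := h 0
    simp only [norm_zero, add_zero, one_pow, mul_one] at h3
    rw [dyadicDiff, zpow_zero]
    exact (norm_sub_le _ _).trans (add_le_add (h x) h3)
  calc ‖caloric f x‖ ≤ ‖dyadicDiff f x 0 0‖ + ‖dyadicDiff f x 0 0 - caloric f x‖ := by
        have := norm_sub_le (dyadicDiff f x 0 0) (dyadicDiff f x 0 0 - caloric f x)
        simpa using this
    _ ≤ (C * (1 + ‖x‖) ^ (N + 1) + C * (1 + ‖x‖) ^ (N + 1)) + D * (1 + ‖x‖) ^ (N + 1) := by
        refine add_le_add (h2.trans (add_le_add ?_ ?_)) (h1.trans ?_)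
        · gcongr
        · nlinarith
        · gcongr
    _ = _ := by ring

lemma polyInt_caloric (hf' : PolyInt f) (hf : HeatOsc A f) : PolyInt (caloric f) := by
  obtain ⟨C, N, h⟩ := exists_norm_caloric_le hf' hf
  exact polyInt_of_bound (aestronglyMeasurable_caloric hf' hf) C N h

/-- The heat flow commutes with the reflection, and the base point `0` of the normalisation is fixed
by it, so each term of the defining sequence has the parity of `f`. -/
lemma caloric_refl [NeZero n] (hf' : PolyInt f) (hf : HeatOsc A f) {b : ℂ}
    (hb : ∀ x, f (refl n x) = b * f x) (x : E n) :
    caloric f (refl n x) = b * caloric f x := by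
  refine tendsto_nhds_unique (tendsto_caloric hf' hf _) ?_
  refine ((tendsto_caloric hf' hf x).const_mul b).congr fun k => ?_
  have h : ∀ x, euclHeat ((2 : ℝ) ^ (k : ℤ)) f (refl n x) =
      b * euclHeat ((2 : ℝ) ^ (k : ℤ)) f x := fun x => by
    rw [euclHeat, ← conv_comp_isometry f (refl n) (gaussC_comp_isometry _ _),
      ← conv_const_mul]
    simp_rw [hb]
  have h0 := h 0
  rw [map_zero] at h0
  rw [dyadicDiff, dyadicDiff, mul_sub, h]
  rw [← h0]

/-- With `h` the caloric part and `√t` comparable to the side of the cube, split `f - h = (f -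
exp(tΔ)f) + (exp(tΔ)f - h)`. The first term has bounded mean by `HeatOsc`; the second has bounded
oscillation by the tail estimate, because points of the ball are within `√t` of its centre. -/
lemma sub_caloric_mem_BMO [NeZero n] (hf' : PolyInt f) (hf : HeatOsc A f) :
    f - caloric f ∈ BMO n := by
  set D := lipConst n * A / (1 - ratio) with hD
  have hr : 0 < 1 - ratio := sub_pos.2 ratio_lt_one
  have hD0 : 0 ≤ D := by have := lipConst_pos n; positivity
  have hn : (0 : ℝ) < n := by exact_mod_cast NeZero.pos n
  have hcm := aestronglyMeasurable_caloric hf' hf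
  rw [mem_BMO_iff]
  refine ⟨(hf'.sub (polyInt_caloric hf' hf)).locallyIntegrable,
    (A + D.toNNReal) * (4 * n) ^ n, fun c l hl => ?_⟩
  -- Dyadic times are all that is available: `2^j < (nl)² ≤ 2^(j+1) = t` gives `nl ≤ √t ≤ 2nl`, so
  -- the cube lies in the ball of radius `√t` and the volumes are comparable.
  obtain ⟨j, hj1, hj2⟩ := exists_mem_Ioc_zpow (x := (n * l) ^ 2) (y := (2 : ℝ)) (by positivity)
    one_lt_two
  set t : ℝ := 2 ^ (j + 1) with ht
  have ht0 : 0 < t := by positivity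
  set r := √t with hrt
  have hrpos : 0 < r := Real.sqrt_pos.2 ht0
  have hr1 : n * l ≤ r := Real.le_sqrt_of_sq_le hj2
  have hr2 : r ≤ 2 * (n * l) := by
    rw [hrt, Real.sqrt_le_iff]
    refine ⟨by positivity, ?_⟩
    rw [ht, zpow_add_one₀ two_ne_zero]
    nlinarith [sq_nonneg (n * l)]
  refine ⟨euclHeat t f c - caloric f c, ?_⟩
  have hsub : cube c l ⊆ Metric.ball c r :=
    (cube_subset_ball c hl).trans (Metric.ball_subset_ball hr1)
  have hvol : volume (Metric.ball c r) ≤ (4 * n) ^ n * volume (cube c l) := by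
    calc volume (Metric.ball c r) ≤ volume (cube c (2 * r)) :=
          measure_mono (ball_subset_cube c r)
      _ ≤ volume (cube c (4 * n * l)) :=
          measure_mono fun x hx i => (hx i).trans (by linarith)
      _ = (4 * n) ^ n * volume (cube c l) := by
          rw [volume_cube _ (by positivity), volume_cube _ hl, ENNReal.ofReal_mul (by positivity),
            mul_pow, ENNReal.ofReal_mul (by norm_num), mul_assoc]
          simp
  have hpt : ∀ x ∈ Metric.ball c r, ‖(euclHeat t f x - caloric f x) -
      (euclHeat t f c - caloric f c)‖ₑ ≤ ENNReal.ofReal D := fun x hx => by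
    rw [← ofReal_norm]
    refine ENNReal.ofReal_le_ofReal ?_
    have h := norm_dyadicDiff_sub_caloric_le hf' hf x c (j + 1)
    have e : ratio ^ (j + 1) = r⁻¹ := by rw [hrt, ht, sqrt_two_zpow, inv_inv]
    rw [Metric.mem_ball, dist_eq_norm] at hx
    rw [dyadicDiff, e] at h
    calc _ = ‖euclHeat t f x - euclHeat t f c - (caloric f x - caloric f c)‖ := by
          congr 1; ring
      _ ≤ _ := h
      _ ≤ lipConst n * A * r * r⁻¹ / (1 - ratio) := by
          have := lipConst_pos n
          gcongr
      _ = D := by rw [mul_assoc, mul_inv_cancel₀ hrpos.ne', mul_one]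
  calc ∫⁻ x in cube c l, ‖(f - caloric f) x - (euclHeat t f c - caloric f c)‖ₑ
      ≤ ∫⁻ x in Metric.ball c r, ‖(f - caloric f) x - (euclHeat t f c - caloric f c)‖ₑ :=
        lintegral_mono_set hsub
    _ ≤ ∫⁻ x in Metric.ball c r, (‖(f - euclHeat t f) x‖ₑ + ENNReal.ofReal D) := by
        refine setLIntegral_mono' Metric.isOpen_ball.measurableSet fun x hx => ?_
        have : (f - caloric f) x - (euclHeat t f c - caloric f c) = (f - euclHeat t f) x +
            ((euclHeat t f x - caloric f x) - (euclHeat t f c - caloric f c)) := by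
          simp only [Pi.sub_apply]; ring
        rw [this]
        exact (enorm_add_le _ _).trans (add_le_add le_rfl (hpt x hx))
    _ = (∫⁻ x in Metric.ball c r, ‖(f - euclHeat t f) x‖ₑ) +
          ENNReal.ofReal D * volume (Metric.ball c r) := by
        rw [lintegral_add_right _ measurable_const]; simp
    _ ≤ A * volume (Metric.ball c r) + ENNReal.ofReal D * volume (Metric.ball c r) := by
        gcongr
        exact hf.ball_le ht0 c
    _ ≤ (A + ENNReal.ofReal D) * ((4 * n) ^ n * volume (cube c l)) := by
        rw [← add_mul]; gcongr
    _ = _ := by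
        push_cast
        rw [← mul_assoc]; rfl

/-- The limit defining `caloric f` passes through `exp(sΔ)`: the error at `y` is at most a multiple
of `|y| * ratio ^ k`, and `|y|` is integrable against the Gaussian. -/
lemma tendsto_euclHeat_shift (hf' : PolyInt f) (hf : HeatOsc A f) {s : ℝ} (hs : 0 < s) (x : E n) :
    Tendsto (fun k : ℕ => euclHeat (2 ^ k + s) f x - euclHeat (2 ^ k) f 0) atTop
      (𝓝 (euclHeat s (caloric f) x)) := by
  have hk : ∀ {t : ℝ}, 0 < t → GaussDecay (gaussC t : E n → ℂ) := gaussDecay_gaussC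
  set D := lipConst n * A / (1 - ratio) with hD
  have hnorm : PolyInt (fun y : E n => ((‖y‖ : ℝ) : ℂ)) :=
    polyInt_of_bound (by fun_prop) 1 1 (fun y => by simp)
  set M := ∫ y, ‖gaussC s (x - y) * ((‖y‖ : ℝ) : ℂ)‖ with hM
  have hbound : ∀ k : ℕ, ‖(euclHeat (2 ^ k + s) f x - euclHeat (2 ^ k) f 0) -
      euclHeat s (caloric f) x‖ ≤ D * M * ratio ^ k := fun k => by
    have h2k : (0 : ℝ) < 2 ^ k := by positivity
    have hP : PolyInt (euclHeat (2 ^ k) f) := hf'.conv (hk h2k)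
    have hc := polyInt_caloric hf' hf
    have e : (euclHeat (2 ^ k + s) f x - euclHeat (2 ^ k) f 0) - euclHeat s (caloric f) x =
        euclHeat s ((euclHeat (2 ^ k) f - fun _ => euclHeat (2 ^ k) f 0) - caloric f) x := by
      rw [euclHeat_sub hs (hP.sub (polyInt_const _)) hc,
        euclHeat_sub hs hP (polyInt_const _), euclHeat_const hs, euclHeat_semigroup hs h2k hf',
        add_comm s]
    rw [e, euclHeat, conv]
    calc _ ≤ ∫ y, D * ratio ^ k * ‖gaussC s (x - y) * ((‖y‖ : ℝ) : ℂ)‖ := by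
          refine norm_integral_le_of_norm_le
            (((hk hs).integrable_conv hnorm x).norm.const_mul _) (ae_of_all _ fun y => ?_)
          have h := norm_dyadicDiff_sub_caloric_le hf' hf y 0 k
          rw [caloric_zero hf' hf, sub_zero, sub_zero, dyadicDiff, zpow_natCast,
            zpow_natCast] at h
          rw [norm_mul, norm_mul, Complex.norm_real, norm_norm]
          calc _ ≤ ‖gaussC s (x - y)‖ * (lipConst n * A * ‖y‖ * ratio ^ k / (1 - ratio)) := by
                gcongr
                exact h
            _ = _ := by rw [hD]; ring
      _ = _ := by rw [integral_const_mul]; ring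
  rw [tendsto_iff_norm_sub_tendsto_zero]
  refine squeeze_zero (fun _ => norm_nonneg _) hbound ?_
  simpa using (tendsto_pow_atTop_nhds_zero_of_lt_one ratio_pos.le ratio_lt_one).const_mul (D * M)

/-- The differences between `x` and `0` at times `2^k` and `2^k + s` have the same limit, their
discrepancy being of order `2^(-k/2)`. Hence `exp(sΔ)` changes the caloric part by a constant only.
-/
lemma euclHeat_caloric_sub (hf' : PolyInt f) (hf : HeatOsc A f) {s : ℝ} (hs : 0 < s) (x : E n) :
    euclHeat s (caloric f) x = caloric f x + euclHeat s (caloric f) 0 := by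
  have h1 := tendsto_euclHeat_shift hf' hf hs x
  have h2 := tendsto_euclHeat_shift hf' hf hs 0
  have h3 := tendsto_caloric hf' hf x
  have h4 := (h1.sub h2).sub h3
  have h5 : Tendsto (fun k : ℕ => (euclHeat (2 ^ k + s) f x - euclHeat (2 ^ k) f 0) -
      (euclHeat (2 ^ k + s) f 0 - euclHeat (2 ^ k) f 0) - dyadicDiff f x 0 k) atTop (𝓝 0) := by
    have h6 : Tendsto (fun k : ℕ => lipConst n * A * ‖x - 0‖ * ratio ^ k) atTop (𝓝 0) := by
      simpa using (tendsto_pow_atTop_nhds_zero_of_lt_one ratio_pos.le ratio_lt_one).const_mul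
        (lipConst n * A * ‖x - 0‖)
    refine squeeze_zero_norm' ?_ h6
    have h7 : Tendsto (fun k : ℕ => (2 : ℝ) ^ k) atTop atTop :=
      tendsto_pow_atTop_atTop_of_one_lt one_lt_two
    filter_upwards [h7.eventually_ge_atTop s] with k hk
    have h8 := norm_euclHeat_sub_add_le hf' hf hs hk x 0
    have h9 := sqrt_two_zpow k
    rw [zpow_natCast, zpow_natCast] at h9
    rw [h9, div_inv_eq_mul, ← mul_assoc] at h8
    rw [← norm_neg, dyadicDiff, zpow_natCast]
    refine le_trans (le_of_eq ?_) h8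
    congr 1; ring
  have h6 := tendsto_nhds_unique h4 h5
  linear_combination h6

/-- The constant `c(s)` by which the flow shifts the caloric part satisfies `c(2s) = 2c(s)` by the
semigroup law, so `c(2^k s) = 2^k c(s)`. A uniform bound on `c` forces it to vanish. -/
lemma euclHeat_caloric [NeZero n] (hf' : PolyInt f) (hf : HeatOsc A f) {s : ℝ} (hs : 0 < s)
    (x : E n) : euclHeat s (caloric f) x = caloric f x := by
  have hk : ∀ {t : ℝ}, 0 < t → GaussDecay (gaussC t : E n → ℂ) := gaussDecay_gaussC
  have hc := polyInt_caloric hf' hf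
  set c : ℝ → ℂ := fun s => euclHeat s (caloric f) 0 with hcdef
  have hfun : ∀ s, 0 < s → euclHeat s (caloric f) = caloric f + fun _ => c s := fun s hs => by
    ext x; exact euclHeat_caloric_sub hf' hf hs x
  have hdouble : ∀ s, 0 < s → c (s + s) = 2 * c s := fun s hs => by
    have h := euclHeat_semigroup hs hs hc 0
    rw [hfun s hs, euclHeat_add hs hc (polyInt_const _), euclHeat_const hs] at h
    change c s + c s = c (s + s) at h
    rw [← h]; ring
  have hpow : ∀ k : ℕ, c (2 ^ k * s) = 2 ^ k * c s := fun k => by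
    induction k with
    | zero => simp
    | succ k ih =>
      rw [pow_succ, show (2 : ℝ) ^ k * 2 * s = 2 ^ k * s + 2 ^ k * s by ring,
        hdouble _ (by positivity), ih]
      ring
  obtain ⟨B, hB⟩ := BMO.heatOsc (sub_caloric_mem_BMO hf' hf) (hf'.sub hc)
  -- The constant `c t` is the difference of `g - exp(tΔ)g` for `g = f - caloric f`, which is in
  -- BMO, and for `g = f`. Both have bounded averages over a ball of radius `√t`.
  have hbd : ∀ t, 0 < t → ‖c t‖ ≤ A + B := fun t ht => by
    have hV0 : volume (Metric.ball (0 : E n) (√t)) ≠ 0 :=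
      (Metric.measure_ball_pos volume _ (Real.sqrt_pos.2 ht)).ne'
    have hVT : volume (Metric.ball (0 : E n) (√t)) ≠ ⊤ := measure_ball_lt_top.ne
    have hP : PolyInt (euclHeat t f) := hf'.conv (hk ht)
    have h : ‖c t‖ₑ * volume (Metric.ball (0 : E n) (√t)) ≤
        (A + B) * volume (Metric.ball (0 : E n) (√t)) := by
      calc ‖c t‖ₑ * volume (Metric.ball (0 : E n) (√t))
          = ∫⁻ x in Metric.ball (0 : E n) (√t), ‖c t‖ₑ := by simp
        _ ≤ ∫⁻ x in Metric.ball (0 : E n) (√t), (‖(f - euclHeat t f) x‖ₑ +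
              ‖((f - caloric f) - euclHeat t (f - caloric f)) x‖ₑ) := by
            refine lintegral_mono fun x => ?_
            have : c t = ((f - caloric f) - euclHeat t (f - caloric f)) x -
                (f - euclHeat t f) x := by
              have h1 := congrFun (hfun t ht) x
              simp only [Pi.sub_apply, Pi.add_apply] at h1 ⊢
              rw [euclHeat_sub ht hf' hc, h1]
              ring
            rw [this, add_comm]
            exact enorm_sub_le
        _ = (∫⁻ x in Metric.ball (0 : E n) (√t), ‖(f - euclHeat t f) x‖ₑ) +
              ∫⁻ x in Metric.ball (0 : E n) (√t),
                ‖((f - caloric f) - euclHeat t (f - caloric f)) x‖ₑ :=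
            lintegral_add_left' (hf'.sub hP).aesm.restrict.enorm _
        _ ≤ _ := by
            rw [add_mul]
            exact add_le_add (hf.ball_le ht 0) (hB.ball_le ht 0)
    have h2 := (ENNReal.mul_le_mul_iff_left hV0 hVT).1 h
    rw [← ofReal_norm, ← ENNReal.coe_add, ← ENNReal.ofReal_coe_nnreal,
      ENNReal.ofReal_le_ofReal_iff (by positivity)] at h2
    exact_mod_cast h2
  have hc0 : c s = 0 := by
    by_contra hne
    have hpos : 0 < ‖c s‖ := norm_pos_iff.2 hne
    obtain ⟨k, hk⟩ := pow_unbounded_of_one_lt ((A + B) / ‖c s‖) (one_lt_two (α := ℝ))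
    have h := hbd (2 ^ k * s) (by positivity)
    rw [hpow, norm_mul, norm_pow, Complex.norm_ofNat] at h
    rw [div_lt_iff₀ hpos] at hk
    linarith
  rw [euclHeat_caloric_sub hf' hf hs]
  change _ + c s = _
  rw [hc0, add_zero]

end Caloric

/-! ### The class `tempered` -/

lemma rpow_le_one_add_rpow {x a b : ℝ} (hx : 0 ≤ x) (ha : 0 ≤ a) (hab : a ≤ b) :
    x ^ a ≤ 1 + x ^ b := by
  rcases le_total x 1 with h | h
  · have := Real.rpow_le_one hx h ha
    have := Real.rpow_nonneg hx b
    linarith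
  · have := Real.rpow_le_rpow_of_exponent_le h hab
    linarith

lemma integrable_sq_weight_mono {f : E n → ℂ} (hf : AEStronglyMeasurable f volume) {N M : ℕ}
    (hNM : N ≤ M) (h : Integrable (fun x => ‖f x‖ ^ 2 / (1 + ‖x‖) ^ N) volume) :
    Integrable (fun x => ‖f x‖ ^ 2 / (1 + ‖x‖) ^ M) volume := by
  refine h.mono' ((hf.norm.pow 2).mul (continuous_weight_inv M).aestronglyMeasurable)
    (ae_of_all _ fun x => ?_)
  rw [Real.norm_of_nonneg (by positivity)]
  gcongr
  linarith [norm_nonneg x]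

lemma polyInt_of_integrable_sq {f : E n → ℂ} (hf : AEStronglyMeasurable f volume) {N : ℕ}
    (h : Integrable (fun x => ‖f x‖ ^ 2 / (1 + ‖x‖) ^ N) volume) : PolyInt f := by
  refine ⟨N + (n + 1), (h.add (integrable_weight n)).mono'
    ((continuous_weight_inv _).aestronglyMeasurable.smul hf) (ae_of_all _ fun x => ?_)⟩
  rw [norm_smul, Real.norm_of_nonneg (by positivity), Pi.add_apply, pow_add, mul_inv]
  have h1 : ‖f x‖ ≤ ‖f x‖ ^ 2 + 1 := by nlinarith [sq_nonneg (‖f x‖ - 1)]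
  have hx : 1 ≤ 1 + ‖x‖ := by linarith [norm_nonneg x]
  have h2 : ((1 + ‖x‖) ^ N)⁻¹ ≤ 1 := inv_le_one_of_one_le₀ (one_le_pow₀ hx)
  have h3 : ((1 + ‖x‖) ^ (n + 1))⁻¹ ≤ 1 := inv_le_one_of_one_le₀ (one_le_pow₀ hx)
  calc ((1 + ‖x‖) ^ N)⁻¹ * ((1 + ‖x‖) ^ (n + 1))⁻¹ * ‖f x‖
      ≤ ((1 + ‖x‖) ^ N)⁻¹ * ((1 + ‖x‖) ^ (n + 1))⁻¹ * (‖f x‖ ^ 2 + 1) := by gcongr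
    _ = ((1 + ‖x‖) ^ N)⁻¹ * ((1 + ‖x‖) ^ (n + 1))⁻¹ * ‖f x‖ ^ 2 +
          ((1 + ‖x‖) ^ N)⁻¹ * ((1 + ‖x‖) ^ (n + 1))⁻¹ := by ring
    _ ≤ ((1 + ‖x‖) ^ N)⁻¹ * 1 * ‖f x‖ ^ 2 + 1 * ((1 + ‖x‖) ^ (n + 1))⁻¹ := by gcongr
    _ = _ := by ring

/-- As `d > 0` is arbitrary, the exponent may be enlarged freely. Natural exponents and the weight
`1 + |x|` make closure under addition straightforward. -/
lemma mem_tempered_iff {f : E n → ℂ} : f ∈ tempered n ↔ AEStronglyMeasurable f volume ∧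
    ∃ N : ℕ, Integrable (fun x => ‖f x‖ ^ 2 / (1 + ‖x‖) ^ N) volume := by
  constructor
  · rintro ⟨hf, d, hd, h⟩
    have hm := hf.aestronglyMeasurable
    obtain ⟨N, hN⟩ := exists_nat_ge ((n : ℝ) + d)
    refine ⟨hm, N, (h.const_mul 2).mono'
      ((hm.norm.pow 2).mul (continuous_weight_inv N).aestronglyMeasurable)
      (ae_of_all _ fun x => ?_)⟩
    rw [Real.norm_of_nonneg (by positivity), ← mul_div_assoc,
      div_le_div_iff₀ (by positivity) (by positivity), mul_comm 2, mul_assoc]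
    gcongr
    have hx : 1 ≤ 1 + ‖x‖ := by linarith [norm_nonneg x]
    have h1 : ‖x‖ ^ ((n : ℝ) + d) ≤ (1 + ‖x‖) ^ ((n : ℝ) + d) :=
      Real.rpow_le_rpow (norm_nonneg x) (by linarith) (by positivity)
    have h2 : (1 + ‖x‖) ^ ((n : ℝ) + d) ≤ (1 + ‖x‖) ^ N := by
      rw [← Real.rpow_natCast]
      exact Real.rpow_le_rpow_of_exponent_le hx hN
    have h3 : 1 ≤ (1 + ‖x‖) ^ N := one_le_pow₀ hx
    linarith
  · rintro ⟨hm, N, h⟩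
    -- The choice `d = N + 1` is positive even for `N = 0` and makes `n + d` at least `N`.
    refine ⟨(polyInt_of_integrable_sq hm h).locallyIntegrable, (N + 1 : ℕ), by positivity,
      (h.const_mul (2 ^ N * 2)).mono' ?_ (ae_of_all _ fun x => ?_)⟩
    · refine (hm.norm.pow 2).mul (Continuous.aestronglyMeasurable (Continuous.inv₀ ?_ ?_))
      · exact continuous_const.add (continuous_norm.rpow_const fun x => Or.inr (by positivity))
      · intro x
        positivity
    · rw [Real.norm_of_nonneg (by positivity), ← mul_div_assoc,
        div_le_div_iff₀ (by positivity) (by positivity), mul_comm _ (‖f x‖ ^ 2), mul_assoc]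
      gcongr
      have h1 : (1 + ‖x‖) ^ N ≤ 2 ^ N * (1 + ‖x‖ ^ N) := by
        rcases le_total ‖x‖ 1 with hx | hx
        · calc (1 + ‖x‖) ^ N ≤ 2 ^ N := by gcongr; linarith
            _ ≤ _ := le_mul_of_one_le_right (by positivity)
                  (by linarith [pow_nonneg (norm_nonneg x) N])
        · calc (1 + ‖x‖) ^ N ≤ (2 * ‖x‖) ^ N := by gcongr; linarith
            _ = 2 ^ N * ‖x‖ ^ N := mul_pow _ _ _
            _ ≤ _ := by gcongr; linarith
      have h2 : ‖x‖ ^ N ≤ 1 + ‖x‖ ^ ((n : ℝ) + (N + 1 : ℕ)) := by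
        have := rpow_le_one_add_rpow (norm_nonneg x) (by positivity : (0 : ℝ) ≤ (N : ℝ))
          (by push_cast; linarith [Nat.cast_nonneg (α := ℝ) n] :
            (N : ℝ) ≤ (n : ℝ) + (N + 1 : ℕ))
        rwa [Real.rpow_natCast] at this
      have h3 : 0 ≤ ‖x‖ ^ ((n : ℝ) + (N + 1 : ℕ)) := by positivity
      rw [mul_assoc]
      refine h1.trans (mul_le_mul_of_nonneg_left ?_ (by positivity))
      linarith

lemma tempered.polyInt {f : E n → ℂ} (hf : f ∈ tempered n) : PolyInt f := by
  obtain ⟨hm, N, h⟩ := mem_tempered_iff.1 hf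
  exact polyInt_of_integrable_sq hm h

lemma tempered.add {f g : E n → ℂ} (hf : f ∈ tempered n) (hg : g ∈ tempered n) :
    f + g ∈ tempered n := by
  rw [mem_tempered_iff] at *
  obtain ⟨hfm, N, hN⟩ := hf
  obtain ⟨hgm, M, hM⟩ := hg
  have h1 := integrable_sq_weight_mono hfm (le_max_left N M) hN
  have h2 := integrable_sq_weight_mono hgm (le_max_right N M) hM
  refine ⟨hfm.add hgm, max N M, ((h1.add h2).const_mul 2).mono'
    (((hfm.add hgm).norm.pow 2).mul (continuous_weight_inv _).aestronglyMeasurable)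
    (ae_of_all _ fun x => ?_)⟩
  rw [Real.norm_of_nonneg (by positivity)]
  simp only [Pi.add_apply]
  rw [← add_div, ← mul_div_assoc]
  gcongr
  have := norm_add_le (f x) (g x)
  nlinarith [norm_nonneg (f x + g x), sq_nonneg (‖f x‖ - ‖g x‖)]

lemma tempered.neg {f : E n → ℂ} (hf : f ∈ tempered n) : -f ∈ tempered n := by
  rw [mem_tempered_iff] at *
  obtain ⟨hfm, N, hN⟩ := hf
  exact ⟨hfm.neg, N, by simpa using hN⟩

lemma tempered_of_bound {f : E n → ℂ} (hm : AEStronglyMeasurable f volume) (C : ℝ) (N : ℕ)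
    (h : ∀ x, ‖f x‖ ≤ C * (1 + ‖x‖) ^ N) : f ∈ tempered n := by
  rw [mem_tempered_iff]
  refine ⟨hm, 2 * N + (n + 1), ((integrable_weight n).const_mul (C ^ 2)).mono'
    ((hm.norm.pow 2).mul (continuous_weight_inv _).aestronglyMeasurable)
    (ae_of_all _ fun x => ?_)⟩
  rw [Real.norm_of_nonneg (by positivity), div_le_iff₀ (by positivity), pow_add]
  have hp : 0 < (1 + ‖x‖) ^ (n + 1) := by positivity
  calc ‖f x‖ ^ 2 ≤ (C * (1 + ‖x‖) ^ N) ^ 2 := by gcongr; exact h x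
    _ = _ := by field_simp; ring

/-! ### BMO associated with an operator acting by reflection -/

section Main

variable [NeZero n]

lemma bmoNormOp_lt_top_iff {L : (E n → ℂ) → (E n → ℂ) → Prop} {f : E n → ℂ} :
    bmoNormOp L f < ⊤ ↔ ∃ A : ℝ≥0, ∀ (y : E n) (r : ℝ), 0 < r →
      ∫⁻ x in Metric.ball y r, ‖f x - heat L (r ^ 2) f x‖ₑ ≤ A * volume (Metric.ball y r) := by
  have hV0 : ∀ (y : E n) {r : ℝ}, 0 < r → volume (Metric.ball y r) ≠ 0 := fun y r hr =>
    (Metric.measure_ball_pos volume _ hr).ne'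
  have hVT : ∀ (y : E n) (r : ℝ), volume (Metric.ball y r) ≠ ⊤ := fun y r => measure_ball_lt_top.ne
  constructor
  · intro h
    refine ⟨(bmoNormOp L f).toNNReal, fun y r hr => ?_⟩
    rw [ENNReal.coe_toNNReal h.ne, ← ENNReal.div_le_iff (hV0 y hr) (hVT y r), ← setLAverage_eq]
    unfold bmoNormOp
    exact le_iSup_of_le y (le_iSup_of_le r (le_iSup_of_le hr le_rfl))
  · rintro ⟨A, hA⟩
    unfold bmoNormOp
    refine lt_of_le_of_lt ?_ (ENNReal.coe_lt_top (r := A))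
    refine iSup_le fun y => iSup_le fun r => iSup_le fun hr => ?_
    rw [setLAverage_eq, ENNReal.div_le_iff (hV0 y hr) (hVT y r)]
    exact hA y r hr

lemma halfExt_add (s : ℝ) (b : ℂ) (f g : E n → ℂ) :
    halfExt s b (f + g) = halfExt s b f + halfExt s b g := by
  ext x
  simp only [halfExt, Set.indicator_add', Pi.add_apply]
  ring

lemma halfExt_congr (s : ℝ) (b : ℂ) {f g : E n → ℂ} (h : ∀ x ∈ half n s, f x = g x) :
    halfExt s b f = halfExt s b g := by
  have : (half n s).indicator f = (half n s).indicator g := Set.indicator_congr h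
  ext x
  simp only [halfExt, this]

lemma euclHeat_halfExt_refl (s t : ℝ) {b : ℂ} (hb : b * b = 1) (f : E n → ℂ) (x : E n) :
    euclHeat t (halfExt s b f) (refl n x) = b * euclHeat t (halfExt s b f) x := by
  rw [euclHeat, ← conv_comp_isometry _ (refl n) (gaussC_comp_isometry _ _), ← conv_const_mul]
  simp_rw [halfExt_refl s hb]

/-- The semigroup of `L` acts on the half-spaces with signs `1` and `-1` as the heat semigroup on
extensions with parities `b 1` and `b (-1)`. -/
def ActsByReflection (L : (E n → ℂ) → (E n → ℂ) → Prop) (b : ℝ → ℂ) : Prop :=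
  ∀ t : ℝ, 0 < t → ∀ f, PolyInt f → ∀ s : ℝ, (s = 1 ∨ s = -1) →
    ∀ᵐ x, x ∈ half n s → heat L t f x = euclHeat t (halfExt s (b s) f) x

variable {L : (E n → ℂ) → (E n → ℂ) → Prop} {b : ℝ → ℂ}

lemma setLIntegral_heat_eq (hL : ActsByReflection L b) {f : E n → ℂ} (hf : PolyInt f) {s t : ℝ}
    (hs : s = 1 ∨ s = -1) (ht : 0 < t) {S : Set (E n)} (hS : MeasurableSet S) :
    ∫⁻ x in S ∩ half n s, ‖f x - heat L t f x‖ₑ =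
      ∫⁻ x in S ∩ half n s, ‖halfExt s (b s) f x - euclHeat t (halfExt s (b s) f) x‖ₑ := by
  refine setLIntegral_congr_fun_ae (hS.inter (measurableSet_half s)) ?_
  filter_upwards [hL t ht f hf s hs] with x hx hm
  rw [hx hm.2, halfExt_of_mem _ _ hm.2]

lemma refl_preimage_ball (c : E n) (r : ℝ) :
    refl n ⁻¹' Metric.ball c r = Metric.ball (refl n c) r := by
  ext x
  rw [Set.mem_preimage, Metric.mem_ball, Metric.mem_ball]
  nth_rewrite 1 [← refl_refl c]
  rw [LinearIsometryEquiv.dist_map]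

/-- On its own half-space the extension minus its evolution is `f - exp(-tL)f`. On the other side it
is the reflection of this up to sign, so the average over a ball is bounded through the mirrored
ball. -/
lemma heatOsc_halfExt (hL : ActsByReflection L b) (hb : ∀ s, b s = 1 ∨ b s = -1) {f : E n → ℂ}
    (hf : PolyInt f) (h : bmoNormOp L f < ⊤) {s : ℝ} (hs : s = 1 ∨ s = -1) :
    ∃ A : ℝ≥0, HeatOsc A (halfExt s (b s) f) := by
  obtain ⟨A, hA⟩ := bmoNormOp_lt_top_iff.1 h
  have hs0 : s ≠ 0 := by rcases hs with rfl | rfl <;> norm_num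
  have hbb : b s * b s = 1 := by rcases hb s with h | h <;> rw [h] <;> norm_num
  have hbn : ‖b s‖ₑ = 1 := by rcases hb s with h | h <;> rw [h] <;> simp
  have key : ∀ (y : E n) (r : ℝ), 0 < r → ∫⁻ x in Metric.ball y r ∩ half n s,
      ‖halfExt s (b s) f x - euclHeat (r ^ 2) (halfExt s (b s) f) x‖ₑ ≤
        A * volume (Metric.ball y r) := fun y r hr => by
    rw [← setLIntegral_heat_eq hL hf hs (by positivity) measurableSet_ball]
    exact (lintegral_mono_set Set.inter_subset_left).trans (hA y r hr)
  refine ⟨A + A, fun y r hr => ?_⟩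
  rw [setLIntegral_split hs0, ENNReal.coe_add, add_mul]
  refine add_le_add (key y r hr) ?_
  have h2 := key (refl n y) r hr
  rw [← refl_preimage_ball] at h2
  have hvol : volume (refl n ⁻¹' Metric.ball y r) = volume (Metric.ball y r) :=
    (refl n).measurePreserving.measure_preimage measurableSet_ball.nullMeasurableSet
  rw [hvol] at h2
  refine le_trans (le_of_eq ?_) h2
  have e : refl n ⁻¹' Metric.ball y r ∩ half n s =
      refl n ⁻¹' (Metric.ball y r ∩ half n (-s)) := by
    ext x
    simp [refl_mem_half]
  rw [e, ← setLIntegral_comp_refl]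
  congr 1 with x
  rw [halfExt_refl s hbb, euclHeat_halfExt_refl s _ hbb, ← mul_sub, enorm_mul, hbn, one_mul]

lemma bmoNormOp_lt_top (hL : ActsByReflection L b) {f : E n → ℂ} (hf : PolyInt f)
    (h : ∀ s : ℝ, s = 1 ∨ s = -1 → ∃ A : ℝ≥0, HeatOsc A (halfExt s (b s) f)) :
    bmoNormOp L f < ⊤ := by
  obtain ⟨A, hA⟩ := h 1 (Or.inl rfl)
  obtain ⟨B, hB⟩ := h (-1) (Or.inr rfl)
  refine bmoNormOp_lt_top_iff.2 ⟨A + B, fun y r hr => ?_⟩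
  rw [setLIntegral_split one_ne_zero, ENNReal.coe_add, add_mul,
    setLIntegral_heat_eq hL hf (Or.inl rfl) (by positivity) measurableSet_ball,
    setLIntegral_heat_eq hL hf (Or.inr rfl) (by positivity) measurableSet_ball]
  exact add_le_add ((lintegral_mono_set Set.inter_subset_left).trans (hA y r hr))
    ((lintegral_mono_set Set.inter_subset_left).trans (hB y r hr))

/-- The chosen kernel is known only through its action, so additivity on functions of polynomial
growth is taken over from the Euclidean flow of the extensions. -/
lemma heat_add_ae (hL : ActsByReflection L b) {f g : E n → ℂ} (hf : PolyInt f) (hg : PolyInt g)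
    {t : ℝ} (ht : 0 < t) : heat L t (f + g) =ᵐ[volume] heat L t f + heat L t g := by
  filter_upwards [ae_mem_half (n := n) one_ne_zero, hL t ht f hf 1 (Or.inl rfl),
    hL t ht g hg 1 (Or.inl rfl), hL t ht _ (hf.add hg) 1 (Or.inl rfl),
    hL t ht f hf (-1) (Or.inr rfl), hL t ht g hg (-1) (Or.inr rfl),
    hL t ht _ (hf.add hg) (-1) (Or.inr rfl)] with x hx h1 h2 h3 h4 h5 h6
  rw [Pi.add_apply]
  rcases hx with hx | hx
  · rw [h1 hx, h2 hx, h3 hx, halfExt_add, euclHeat_add ht (hf.halfExt _ _) (hg.halfExt _ _)]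
  · rw [h4 hx, h5 hx, h6 hx, halfExt_add, euclHeat_add ht (hf.halfExt _ _) (hg.halfExt _ _)]

/-! ### The half-space conditions and the decomposition modulo the kernel space. -/

/-- The condition on a half-space that corresponds to the parity `b`. -/
def HalfCond (b : ℂ) (s : ℝ) (g : E n → ℂ) : Prop :=
  (b = 1 → (half n s).domRestrict g ∈ BMOr (half n s)) ∧
    (b = -1 → (half n s).domRestrict g ∈ BMOz (half n s))

lemma extend_domRestrict (s : ℝ) (g : E n → ℂ) :
    Function.extend (Subtype.val : half n s → E n) ((half n s).domRestrict g) 0 =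
      (half n s).indicator g := by
  ext x
  by_cases hx : x ∈ half n s
  · have := (Subtype.val_injective (p := (· ∈ half n s))).extend_apply
      ((half n s).domRestrict g) 0 ⟨x, hx⟩
    simp only [Set.indicator_of_mem hx]
    exact this
  · rw [Function.extend_apply' _ _ _ (by rintro ⟨a, rfl⟩; exact hx a.2), Set.indicator_of_notMem hx]
    rfl

lemma HalfCond.heatOsc {g : E n → ℂ} (hg : PolyInt g) {s : ℝ} (hs : s = 1 ∨ s = -1) {b : ℂ}
    (hb : b = 1 ∨ b = -1) (h : HalfCond b s g) : ∃ A : ℝ≥0, HeatOsc A (halfExt s b g) := by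
  refine BMO.heatOsc ?_ (hg.halfExt s b)
  rcases hb with rfl | rfl
  · obtain ⟨F, hF, hFg⟩ := h.1 rfl
    -- The extension sees only the values on the half-space, so `g` may be replaced by the BMO
    -- function `F` that it restricts.
    have : halfExt s 1 g = halfExt s 1 F :=
      halfExt_congr s 1 fun x hx => (congrFun hFg ⟨x, hx⟩).symm
    rw [this]
    exact BMO.halfExt_even hs hF
  · have h2 := h.2 rfl
    rw [BMOz, Set.mem_ofPred_eq, extend_domRestrict] at h2
    exact BMO.halfExt_odd h2

/-- Let `k` be, on each half-space, the caloric part of the corresponding extension of `f`. Parity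
is preserved, so the extension of `k` is again that caloric part and `k` is invariant under the
semigroup of `L`. On each half-space `f - k` agrees with a BMO function of the right parity; when
this is odd, its extension by zero is in BMO. -/
lemma exists_caloric_part (hL : ActsByReflection L b) (hb : ∀ s, b s = 1 ∨ b s = -1)
    {f : E n → ℂ} (hf : f ∈ BMOop L) : ∃ g ∈ tempered n, HalfCond (b 1) 1 g ∧
      HalfCond (b (-1)) (-1) g ∧ f - g ∈ kernelSpace L := by
  obtain ⟨hft, hfL⟩ := hf
  have hfP := tempered.polyInt hft
  set F : ℝ → E n → ℂ := fun s => halfExt s (b s) f with hF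
  have hFP : ∀ s, PolyInt (F s) := fun s => hfP.halfExt s (b s)
  have hbb : ∀ s, b s * b s = 1 := fun s => by rcases hb s with h | h <;> rw [h] <;> norm_num
  set k : E n → ℂ := (half n 1).indicator (caloric (F 1)) +
    (half n (-1)).indicator (caloric (F (-1))) with hk
  have hks : ∀ s : ℝ, s = 1 ∨ s = -1 → ∀ x ∈ half n s, k x = caloric (F s) x := by
    rintro s (rfl | rfl) x hx
    · have : x ∉ half n (-1) := Set.disjoint_left.1 (disjoint_half 1) hx
      simp [hk, hx, this]
    · have : x ∉ half n 1 := fun h => Set.disjoint_left.1 (disjoint_half 1) h hx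
      simp [hk, hx, this]
  have hkt : k ∈ tempered n := by
    refine tempered.add ?_ ?_
    · obtain ⟨A, hA⟩ := heatOsc_halfExt hL hb hfP hfL (Or.inl rfl)
      obtain ⟨C, N, h⟩ := exists_norm_caloric_le (hFP 1) hA
      exact tempered_of_bound ((aestronglyMeasurable_caloric (hFP 1) hA).indicator
        (measurableSet_half _)) C N fun x => (norm_indicator_le_norm_self _ _).trans (h x)
    · obtain ⟨A, hA⟩ := heatOsc_halfExt hL hb hfP hfL (Or.inr rfl)
      obtain ⟨C, N, h⟩ := exists_norm_caloric_le (hFP (-1)) hA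
      exact tempered_of_bound ((aestronglyMeasurable_caloric (hFP (-1)) hA).indicator
        (measurableSet_half _)) C N fun x => (norm_indicator_le_norm_self _ _).trans (h x)
  -- Only almost everywhere: `k` is `0` on the hyperplane, where the caloric part need not vanish.
  have hext : ∀ s : ℝ, s = 1 ∨ s = -1 → halfExt s (b s) k =ᵐ[volume] caloric (F s) := by
    intro s hs
    obtain ⟨A, hA⟩ := heatOsc_halfExt hL hb hfP hfL hs
    have hs0 : s ≠ 0 := by rcases hs with rfl | rfl <;> norm_num
    filter_upwards [ae_mem_half (n := n) hs0] with x hx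
    rcases hx with hx | hx
    · rw [halfExt_of_mem _ _ hx, hks s hs x hx]
    · have hx' : refl n x ∈ half n s := refl_mem_half.2 hx
      rw [halfExt_of_mem_neg _ _ hx, hks s hs _ hx',
        caloric_refl (hFP s) hA (halfExt_refl s (hbb s) f), ← mul_assoc, hbb, one_mul]
  have hcond : ∀ s : ℝ, s = 1 ∨ s = -1 → HalfCond (b s) s (f - k) := by
    intro s hs
    obtain ⟨A, hA⟩ := heatOsc_halfExt hL hb hfP hfL hs
    have hB := sub_caloric_mem_BMO (hFP s) hA
    have heq : ∀ x ∈ half n s, (F s - caloric (F s)) x = (f - k) x := fun x hx => by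
      rw [Pi.sub_apply, Pi.sub_apply, hks s hs x hx, hF]
      simp only [halfExt_of_mem _ _ hx]
    refine ⟨fun _ => ⟨_, hB, ?_⟩, fun h => ?_⟩
    · ext x
      exact heq x x.2
    · rw [BMOz, Set.mem_ofPred_eq, extend_domRestrict, ← Set.indicator_congr heq]
      refine BMO.indicator_of_odd hs hB fun x => ?_
      have hr : F s (refl n x) = b s * F s x := halfExt_refl s (hbb s) f x
      rw [Pi.sub_apply, Pi.sub_apply, caloric_refl (hFP s) hA (halfExt_refl s (hbb s) f), hr, h]
      ring
  refine ⟨f - k, ?_, hcond 1 (Or.inl rfl), hcond (-1) (Or.inr rfl), ?_⟩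
  · rw [sub_eq_add_neg]; exact tempered.add hft (tempered.neg hkt)
  · rw [sub_sub_cancel]
    refine ⟨hkt, fun t ht => ?_⟩
    have hs : ∀ s : ℝ, s = 1 ∨ s = -1 → ∀ᵐ x, x ∈ half n s → heat L t k x = k x := by
      intro s hs
      obtain ⟨A, hA⟩ := heatOsc_halfExt hL hb hfP hfL hs
      filter_upwards [hL t ht k (tempered.polyInt hkt) s hs] with x hx hxs
      rw [hx hxs, euclHeat, conv_congr (hext s hs), hks s hs x hxs]
      exact euclHeat_caloric (hFP s) hA ht x
    filter_upwards [ae_mem_half (n := n) one_ne_zero, hs 1 (Or.inl rfl), hs (-1) (Or.inr rfl)]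
      with x hx h1 h2
    exact hx.elim h1 h2

theorem BMOop_eq (hL : ActsByReflection L b) (hb : ∀ s, b s = 1 ∨ b s = -1) :
    BMOop L = {f : E n → ℂ | ∃ g ∈ tempered n, HalfCond (b 1) 1 g ∧
      HalfCond (b (-1)) (-1) g ∧ f - g ∈ kernelSpace L} := by
  ext f
  refine ⟨exists_caloric_part hL hb, ?_⟩
  rintro ⟨g, hg, hp, hm, hk⟩
  have hgP := tempered.polyInt hg
  have hkP := tempered.polyInt hk.1
  have hfg : f = g + (f - g) := by abel
  have hfin : bmoNormOp L g < ⊤ := by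
    refine bmoNormOp_lt_top hL hgP ?_
    rintro s (rfl | rfl)
    · exact hp.heatOsc hgP (Or.inl rfl) (hb _)
    · exact hm.heatOsc hgP (Or.inr rfl) (hb _)
  refine ⟨hfg ▸ tempered.add hg hk.1, ?_⟩
  obtain ⟨A, hA⟩ := bmoNormOp_lt_top_iff.1 hfin
  refine bmoNormOp_lt_top_iff.2 ⟨A, fun y r hr => le_trans (le_of_eq ?_) (hA y r hr)⟩
  -- Adding an invariant function does not change `f - exp(-tL)f`, so `f` and `g` have the same
  -- averages.
  refine lintegral_congr_ae (ae_restrict_of_ae ?_)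
  have hr2 : 0 < r ^ 2 := by positivity
  have hadd := heat_add_ae hL hgP hkP hr2
  rw [← hfg] at hadd
  filter_upwards [hadd, hk.2 (r ^ 2) hr2] with x h1 h2
  rw [h1, Pi.add_apply, h2, Pi.sub_apply]
  congr 1
  ring

end Main

/-! ### Young's inequality on `L²` -/

lemma sq_lintegral_le {α : Type*} [MeasurableSpace α] (μ : Measure α) {φ : α → ℝ≥0∞}
    (hφ : AEMeasurable φ μ) : (∫⁻ x, φ x ∂μ) ^ 2 ≤ μ Set.univ * ∫⁻ x, φ x ^ 2 ∂μ := by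
  have h := ENNReal.lintegral_mul_le_Lp_mul_Lq μ Real.HolderConjugate.two_two
    (f := fun _ => 1) (g := φ) aemeasurable_const hφ
  simp only [Pi.mul_apply, one_mul, lintegral_const, ENNReal.rpow_two, one_pow] at h
  have e : ∀ a : ℝ≥0∞, (a ^ (1 / 2 : ℝ)) ^ 2 = a := fun a => by
    rw [← ENNReal.rpow_two, ← ENNReal.rpow_mul]; simp
  calc _ ≤ _ := pow_le_pow_left' h 2
    _ = _ := by rw [mul_pow, e, e]

/-- Cauchy-Schwarz for the measure with density `κ(x - y)` in `y`, whose total mass is independent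
of `x`, and then Tonelli. -/
lemma lintegral_sq_conv_le {κ φ : E n → ℝ≥0∞} (hκ : Measurable κ) (hφ : AEMeasurable φ volume) :
    ∫⁻ x, (∫⁻ y, κ (x - y) * φ y) ^ 2 ≤ (∫⁻ z, κ z) ^ 2 * ∫⁻ y, φ y ^ 2 := by
  have hm : ∀ x : E n, Measurable fun y => κ (x - y) := fun x =>
    hκ.comp (measurable_const.sub measurable_id)
  have h1 : ∀ x : E n, (∫⁻ y, κ (x - y) * φ y) ^ 2 ≤
      (∫⁻ z, κ z) * ∫⁻ y, κ (x - y) * φ y ^ 2 := fun x => by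
    have h := sq_lintegral_le (volume.withDensity fun y => κ (x - y))
      (hφ.mono_ac (withDensity_absolutelyContinuous _ _))
    rw [lintegral_withDensity_eq_lintegral_mul₀ (hm x).aemeasurable hφ,
      lintegral_withDensity_eq_lintegral_mul₀ (hm x).aemeasurable (hφ.pow_const 2),
      withDensity_apply _ MeasurableSet.univ, setLIntegral_univ,
      lintegral_sub_left_eq_self κ x] at h
    exact h
  calc ∫⁻ x, (∫⁻ y, κ (x - y) * φ y) ^ 2
      ≤ ∫⁻ x, (∫⁻ z, κ z) * ∫⁻ y, κ (x - y) * φ y ^ 2 := lintegral_mono h1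
    _ = (∫⁻ z, κ z) * ∫⁻ x, ∫⁻ y, κ (x - y) * φ y ^ 2 := by
        refine lintegral_const_mul'' _ ?_
        refine AEMeasurable.lintegral_prod_right' (f := fun p : E n × E n =>
          κ (p.1 - p.2) * φ p.2 ^ 2) ?_
        exact (hκ.comp (measurable_fst.sub measurable_snd)).aemeasurable.mul
          ((hφ.comp_quasiMeasurePreserving Measure.quasiMeasurePreserving_snd).pow_const 2)
    _ = (∫⁻ z, κ z) * ∫⁻ y, ∫⁻ x, κ (x - y) * φ y ^ 2 := by
        congr 1
        refine lintegral_lintegral_swap ?_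
        exact (hκ.comp (measurable_fst.sub measurable_snd)).aemeasurable.mul
          ((hφ.comp_quasiMeasurePreserving Measure.quasiMeasurePreserving_snd).pow_const 2)
    _ = (∫⁻ z, κ z) * ∫⁻ y, (∫⁻ z, κ z) * φ y ^ 2 := by
        congr 2 with y
        have hy : Measurable fun x => κ (x - y) := hκ.comp (measurable_id.sub measurable_const)
        rw [lintegral_mul_const _ hy]
        congr 1
        exact lintegral_sub_right_eq_self κ y
    _ = _ := by
        rw [lintegral_const_mul'' _ (hφ.pow_const 2)]; ring

lemma eLpNorm_two_eq {α : Type*} [MeasurableSpace α] (μ : Measure α) (f : α → ℂ) :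
    eLpNorm f 2 μ = (∫⁻ x, ‖f x‖ₑ ^ 2 ∂μ) ^ (1 / 2 : ℝ) := by
  rw [eLpNorm_eq_lintegral_rpow_enorm_toReal two_ne_zero (by norm_num)]
  simp

lemma GaussDecay.integrable {k : E n → ℂ} (hk : GaussDecay k) : Integrable k volume := by
  have := (hk.integrable_conv (polyInt_const 1) 0).comp_neg
  simpa using this

lemma eLpNorm_conv_le {k F : E n → ℂ} (hk : Continuous k) (hF : AEStronglyMeasurable F volume) :
    eLpNorm (conv k F) 2 volume ≤ (∫⁻ z, ‖k z‖ₑ) * eLpNorm F 2 volume := by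
  rw [eLpNorm_two_eq, eLpNorm_two_eq]
  calc (∫⁻ x, ‖conv k F x‖ₑ ^ 2) ^ (1 / 2 : ℝ)
      ≤ ((∫⁻ z, ‖k z‖ₑ) ^ 2 * ∫⁻ y, ‖F y‖ₑ ^ 2) ^ (1 / 2 : ℝ) := by
        refine ENNReal.rpow_le_rpow ?_ (by norm_num)
        refine le_trans (lintegral_mono fun x => pow_le_pow_left' ?_ 2)
          (lintegral_sq_conv_le hk.enorm.measurable hF.enorm)
        refine (enorm_integral_le_lintegral_enorm _).trans (le_of_eq ?_)
        simp_rw [enorm_mul]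
    _ = _ := by
        rw [ENNReal.mul_rpow_of_nonneg _ _ (by norm_num), ← ENNReal.rpow_two, ← ENNReal.rpow_mul]
        simp

lemma lintegral_enorm_ne_top {k : E n → ℂ} (hk : GaussDecay k) : ∫⁻ z, ‖k z‖ₑ ≠ ⊤ :=
  hk.integrable.2.ne

lemma memLp_conv {k F : E n → ℂ} (hk : GaussDecay k) (hF : MemLp F 2 volume) :
    MemLp (conv k F) 2 volume :=
  ⟨conv_aesm hk.1 hF.1, (eLpNorm_conv_le hk.1 hF.1).trans_lt
    (ENNReal.mul_lt_top (lintegral_enorm_ne_top hk).lt_top hF.2)⟩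

/-- The space `L²(ℝⁿ)`. -/
abbrev L2 (n : ℕ) : Type := Lp ℂ 2 (volume : Measure (E n))

lemma norm_toLp_conv_le {k : E n → ℂ} (hk : GaussDecay k) (f : L2 n) :
    ‖(memLp_conv hk (Lp.memLp f)).toLp‖ ≤ (∫ z, ‖k z‖) * ‖f‖ := by
  rw [integral_norm_eq_lintegral_enorm hk.integrable.1, Lp.norm_toLp, Lp.norm_def,
    ← ENNReal.toReal_mul]
  exact ENNReal.toReal_mono (ENNReal.mul_ne_top (lintegral_enorm_ne_top hk)
    (Lp.eLpNorm_ne_top f)) (eLpNorm_conv_le hk.1 (Lp.aestronglyMeasurable f))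

/-- Convolution with a kernel of Gaussian decay, on `L²`. -/
def convL (k : E n → ℂ) (hk : GaussDecay k) : L2 n →L[ℂ] L2 n :=
  LinearMap.mkContinuous
    { toFun := fun f => (memLp_conv hk (Lp.memLp f)).toLp
      map_add' := fun f g => by
        rw [← MemLp.toLp_add]
        refine MemLp.toLp_congr _ _ (ae_of_all _ fun x => ?_)
        rw [conv_congr (Lp.coeFn_add f g), conv_add hk (MemLp.polyInt (Lp.memLp f))
          (MemLp.polyInt (Lp.memLp g)), Pi.add_apply]
      map_smul' := fun c f => by
        rw [RingHom.id_apply, ← MemLp.toLp_const_smul]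
        refine MemLp.toLp_congr _ _ (ae_of_all _ fun x => ?_)
        rw [conv_congr (Lp.coeFn_smul c f), Pi.smul_apply, smul_eq_mul, ← conv_const_mul]
        rfl }
    (∫ z, ‖k z‖) fun f => norm_toLp_conv_le hk f

lemma convL_ae (k : E n → ℂ) (hk : GaussDecay k) (f : L2 n) :
    convL k hk f =ᵐ[volume] conv k f :=
  MemLp.coeFn_toLp (memLp_conv hk (Lp.memLp f))

lemma norm_convL_apply_le (k : E n → ℂ) (hk : GaussDecay k) (f : L2 n) :
    ‖convL k hk f‖ ≤ (∫ z, ‖k z‖) * ‖f‖ := by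
  exact norm_toLp_conv_le hk f

/-! ### Smoothing -/

/-- Polynomials times the Gaussian `exp(-a|x|²)`. -/
inductive PolyGauss (a : ℝ) : (E n → ℂ) → Prop
  | gauss : PolyGauss a fun x => ((Real.exp (-a * ‖x‖ ^ 2) : ℝ) : ℂ)
  | coord (i : Fin n) {k : E n → ℂ} : PolyGauss a k → PolyGauss a fun x => (x i : ℂ) * k x
  | smul (c : ℂ) {k : E n → ℂ} : PolyGauss a k → PolyGauss a fun x => c * k x
  | add {k l : E n → ℂ} : PolyGauss a k → PolyGauss a l → PolyGauss a fun x => k x + l x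

lemma partialD_add {f g : E n → ℂ} (hf : Differentiable ℝ f) (hg : Differentiable ℝ g)
    (i : Fin n) : partialD i (fun x => f x + g x) = fun x => partialD i f x + partialD i g x := by
  ext x
  simp only [partialD]
  rw [fderiv_fun_add (hf x) (hg x)]
  rfl

lemma partialD_const_mul {f : E n → ℂ} (hf : Differentiable ℝ f) (c : ℂ) (i : Fin n) :
    partialD i (fun x => c * f x) = fun x => c * partialD i f x := by
  ext x
  simp only [partialD]
  rw [fderiv_const_mul (hf x)]
  rfl

lemma partialD_mul {f g : E n → ℂ} (hf : Differentiable ℝ f) (hg : Differentiable ℝ g)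
    (i : Fin n) : partialD i (fun x => f x * g x) =
      fun x => f x * partialD i g x + partialD i f x * g x := by
  ext x
  simp only [partialD]
  rw [fderiv_fun_mul (hf x) (hg x)]
  simp [mul_comm]

lemma hasFDerivAt_coord (i : Fin n) (x : E n) : HasFDerivAt (fun x : E n => (x i : ℂ))
    (Complex.ofRealCLM.comp (EuclideanSpace.proj (𝕜 := ℝ) i)) x :=
  (Complex.ofRealCLM.comp (EuclideanSpace.proj (𝕜 := ℝ) i)).hasFDerivAt

lemma differentiable_coord (i : Fin n) : Differentiable ℝ (fun x : E n => (x i : ℂ)) :=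
  fun x => (hasFDerivAt_coord i x).differentiableAt

lemma partialD_coord (i j : Fin n) :
    partialD i (fun x : E n => (x j : ℂ)) = fun _ => if i = j then 1 else 0 := by
  ext x
  rw [partialD, (hasFDerivAt_coord j x).fderiv]
  by_cases h : i = j
  · subst h; simp
  · simp [h, Ne.symm h]

lemma hasFDerivAt_exp (a : ℝ) (x : E n) :
    HasFDerivAt (fun x : E n => ((Real.exp (-a * ‖x‖ ^ 2) : ℝ) : ℂ))
      (Complex.ofRealCLM.comp (Real.exp (-a * ‖x‖ ^ 2) • ((-a) • (2 • (innerSL ℝ x))))) x :=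
  Complex.ofRealCLM.hasFDerivAt.comp x
    (((hasStrictFDerivAt_norm_sq x).hasFDerivAt.const_mul (-a)).exp)

lemma partialD_exp (a : ℝ) (i : Fin n) :
    partialD i (fun x : E n => ((Real.exp (-a * ‖x‖ ^ 2) : ℝ) : ℂ)) =
      fun x => (-2 * a : ℂ) * ((x i : ℂ) * ((Real.exp (-a * ‖x‖ ^ 2) : ℝ) : ℂ)) := by
  ext x
  rw [partialD, (hasFDerivAt_exp a x).fderiv]
  have : inner ℝ x (EuclideanSpace.single i (1 : ℝ)) = x i := by
    rw [EuclideanSpace.inner_single_right]; simp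
  simp [this]
  ring

/-- The class is closed under partial derivatives, so differentiability of all orders follows by
induction. -/
lemma PolyGauss.differentiable_and {a : ℝ} {k : E n → ℂ} (hk : PolyGauss a k) :
    Differentiable ℝ k ∧ ∀ i, PolyGauss a (partialD i k) := by
  induction hk with
  | gauss =>
    refine ⟨fun x => (hasFDerivAt_exp a x).differentiableAt, fun i => ?_⟩
    rw [partialD_exp]
    exact PolyGauss.smul _ (PolyGauss.coord i PolyGauss.gauss)
  | @coord j k hk ih =>
    refine ⟨(differentiable_coord j).mul ih.1, fun i => ?_⟩
    rw [partialD_mul (differentiable_coord j) ih.1, partialD_coord]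
    exact PolyGauss.add (PolyGauss.coord j (ih.2 i)) (PolyGauss.smul _ hk)
  | smul c hk ih =>
    refine ⟨ih.1.const_mul c, fun i => ?_⟩
    rw [partialD_const_mul ih.1]
    exact PolyGauss.smul c (ih.2 i)
  | add hk hl ih ih' =>
    refine ⟨ih.1.add ih'.1, fun i => ?_⟩
    rw [partialD_add ih.1 ih'.1]
    exact PolyGauss.add (ih.2 i) (ih'.2 i)

lemma PolyGauss.exists_bound {a : ℝ} {k : E n → ℂ} (hk : PolyGauss a k) :
    ∀ b < a, ∃ C, 0 ≤ C ∧ ∀ x, ‖k x‖ ≤ C * Real.exp (-b * ‖x‖ ^ 2) := by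
  induction hk with
  | gauss =>
    refine fun b hb => ⟨1, zero_le_one, fun x => ?_⟩
    rw [Complex.norm_real, Real.norm_of_nonneg (Real.exp_pos _).le, one_mul]
    gcongr
  | @coord j k hk ih =>
    intro b hb
    -- Each coordinate factor spends half of the gap between `b` and `a` in the exponent.
    obtain ⟨C, hC, h⟩ := ih ((a + b) / 2) (by linarith)
    set d := (a - b) / 2 with hd
    have hd0 : 0 < d := by rw [hd]; linarith
    refine ⟨(Nat.factorial 1 * Real.exp (1 + 1 / (4 * d))) * C, by positivity, fun x => ?_⟩
    have h1 := exp_mul_pow_le 1 hd0 (norm_nonneg x)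
    have h2 : ‖x j‖ ≤ 1 + ‖x‖ := (PiLp.norm_apply_le x j).trans (by linarith)
    have h3 : Real.exp (-((a + b) / 2) * ‖x‖ ^ 2) =
        Real.exp (-d * ‖x‖ ^ 2) * Real.exp (-b * ‖x‖ ^ 2) := by
      rw [← Real.exp_add, hd]; congr 1; ring
    rw [norm_mul, Complex.norm_real]
    calc ‖x j‖ * ‖k x‖ ≤ (1 + ‖x‖) * (C * Real.exp (-((a + b) / 2) * ‖x‖ ^ 2)) := by
          gcongr; exact h x
      _ = (Real.exp (-d * ‖x‖ ^ 2) * (1 + ‖x‖) ^ 1) * C * Real.exp (-b * ‖x‖ ^ 2) := by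
          rw [h3]; ring
      _ ≤ _ := by
          refine mul_le_mul_of_nonneg_right (mul_le_mul_of_nonneg_right h1 hC) (Real.exp_pos _).le
  | smul c hk ih =>
    intro b hb
    obtain ⟨C, hC, h⟩ := ih b hb
    refine ⟨‖c‖ * C, by positivity, fun x => ?_⟩
    rw [norm_mul, mul_assoc]
    gcongr
    exact h x
  | add hk hl ih ih' =>
    intro b hb
    obtain ⟨C, hC, h⟩ := ih b hb
    obtain ⟨D, hD, h'⟩ := ih' b hb
    refine ⟨C + D, by positivity, fun x => ?_⟩
    rw [add_mul]
    exact (norm_add_le _ _).trans (add_le_add (h x) (h' x))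

lemma PolyGauss.gaussDecay {a : ℝ} (ha : 0 < a) {k : E n → ℂ} (hk : PolyGauss a k) :
    GaussDecay k := by
  obtain ⟨C, -, h⟩ := hk.exists_bound (a / 2) (by linarith)
  exact ⟨hk.differentiable_and.1.continuous, C, a / 2, by linarith, h⟩

lemma fderiv_eq_sum_partialD (k : E n → ℂ) (x v : E n) :
    fderiv ℝ k x v = ∑ i, (v i : ℂ) * partialD i k x := by
  have hv : v = ∑ i, v i • EuclideanSpace.single i (1 : ℝ) := by
    ext j
    simp [Finset.sum_apply, Pi.single_apply]
  conv_lhs => rw [hv]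
  rw [map_sum]
  refine Finset.sum_congr rfl fun i _ => ?_
  rw [map_smul, partialD, Complex.real_smul]

lemma norm_fderiv_le (k : E n → ℂ) (x : E n) : ‖fderiv ℝ k x‖ ≤ ∑ i, ‖partialD i k x‖ := by
  refine ContinuousLinearMap.opNorm_le_bound _ (Finset.sum_nonneg fun i _ => norm_nonneg _)
    fun v => ?_
  rw [fderiv_eq_sum_partialD, Finset.sum_mul]
  refine (norm_sum_le _ _).trans (Finset.sum_le_sum fun i _ => ?_)
  rw [norm_mul, Complex.norm_real, mul_comm]
  gcongr
  exact PiLp.norm_apply_le v i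

lemma continuous_fderiv_of_partialD {k : E n → ℂ} (hk : ∀ i, Continuous (partialD i k)) :
    Continuous (fderiv ℝ k) := by
  have : fderiv ℝ k = fun x => ∑ i, (EuclideanSpace.proj (𝕜 := ℝ) i : E n →L[ℝ] ℝ).smulRight
      (partialD i k x) := by
    ext x v
    rw [fderiv_eq_sum_partialD]
    simp
  rw [this]
  refine continuous_finsetSum _ fun i _ => ?_
  exact (ContinuousLinearMap.smulRightL ℝ (E n) ℂ (EuclideanSpace.proj i)).continuous.comp (hk i)

/-- Differentiation under the integral. For `x` within distance `1` of `x₀`, the weight `(1 +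
|x|)^N` is at most `(2 + |x₀|)^N`, which gives a dominating function independent of `x`. -/
lemma hasFDerivAt_conv {k F : E n → ℂ} (hk : Differentiable ℝ k) (hkg : GaussDecay k)
    (hkd : ∀ i, GaussDecay (partialD i k)) (hF : PolyInt F) (x₀ : E n) :
    HasFDerivAt (conv k F) (∫ y, F y • fderiv ℝ k (x₀ - y)) x₀ ∧
      Integrable (fun y => F y • fderiv ℝ k (x₀ - y)) volume := by
  have hm := hF.aesm
  obtain ⟨N, hN⟩ := hF
  choose C hC hCb using fun i => (hkd i).exists_bound N
  have hc : Continuous (fderiv ℝ k) := continuous_fderiv_of_partialD fun i => (hkd i).1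
  have hmeas : ∀ x, AEStronglyMeasurable (fun y => F y • fderiv ℝ k (x - y)) volume := fun x =>
    hm.smul (hc.comp (continuous_const.sub continuous_id)).aestronglyMeasurable
  have hbound : ∀ y, ∀ x ∈ Metric.ball x₀ 1, ‖F y • fderiv ℝ k (x - y)‖ ≤
      (∑ i, C i) * (2 + ‖x₀‖) ^ N * ‖((1 + ‖y‖) ^ N)⁻¹ • F y‖ := fun y x hx => by
    rw [Metric.mem_ball, dist_eq_norm] at hx
    have hx' : 1 + ‖x‖ ≤ 2 + ‖x₀‖ := by
      have := norm_add_le (x - x₀) x₀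
      rw [sub_add_cancel] at this
      linarith
    rw [norm_smul, norm_smul, Real.norm_of_nonneg (by positivity)]
    have h1 : ‖fderiv ℝ k (x - y)‖ ≤ (∑ i, C i) * (2 + ‖x₀‖) ^ N * ((1 + ‖y‖) ^ N)⁻¹ := by
      refine (norm_fderiv_le _ _).trans ?_
      rw [Finset.sum_mul, Finset.sum_mul]
      refine Finset.sum_le_sum fun i _ => (hCb i x y).trans ?_
      have := hC i
      gcongr
    calc _ ≤ ‖F y‖ * ((∑ i, C i) * (2 + ‖x₀‖) ^ N * ((1 + ‖y‖) ^ N)⁻¹) := by gcongr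
      _ = _ := by ring
  have hbi : Integrable (fun y => (∑ i, C i) * (2 + ‖x₀‖) ^ N * ‖((1 + ‖y‖) ^ N)⁻¹ • F y‖)
      volume := hN.norm.const_mul _
  refine ⟨hasFDerivAt_integral_of_dominated_of_fderiv_le (F := fun x y => k (x - y) * F y)
    (F' := fun x y => F y • fderiv ℝ k (x - y)) (Metric.ball_mem_nhds x₀ one_pos)
    (Eventually.of_forall fun x => ?_) (hkg.integrable_conv ⟨N, hN⟩ x₀) (hmeas x₀)
    (ae_of_all _ hbound) hbi (ae_of_all _ fun y x _ => ?_),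
    hbi.mono' (hmeas x₀) (ae_of_all _ fun y => hbound y x₀ (Metric.mem_ball_self one_pos))⟩
  · exact (hkg.1.comp (continuous_const.sub continuous_id)).aestronglyMeasurable.mul hm
  · have h1 : HasFDerivAt (fun x => k (x - y)) (fderiv ℝ k (x - y)) x := by
      have := HasFDerivAt.comp (g := k) (f := fun x => x - y) x (hk (x - y)).hasFDerivAt
        ((hasFDerivAt_id x).sub_const y)
      rwa [ContinuousLinearMap.comp_id] at this
    exact h1.mul_const (F y)

lemma partialD_conv {k F : E n → ℂ} (hk : Differentiable ℝ k) (hkg : GaussDecay k)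
    (hkd : ∀ i, GaussDecay (partialD i k)) (hF : PolyInt F) (i : Fin n) :
    partialD i (conv k F) = conv (partialD i k) F := by
  ext x
  obtain ⟨h1, h2⟩ := hasFDerivAt_conv hk hkg hkd hF x
  rw [partialD, h1.fderiv, ContinuousLinearMap.integral_apply h2, conv]
  refine integral_congr_ae (ae_of_all _ fun y => ?_)
  simp [partialD, mul_comm]

lemma PolyGauss.partialD_conv {a : ℝ} (ha : 0 < a) {k F : E n → ℂ} (hk : PolyGauss a k)
    (hF : PolyInt F) (i : Fin n) : partialD i (HeatBMO.conv k F) =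
      HeatBMO.conv (partialD i k) F :=
  HeatBMO.partialD_conv hk.differentiable_and.1 (hk.gaussDecay ha)
    (fun i => (hk.differentiable_and.2 i).gaussDecay ha) hF i

lemma PolyGauss.contDiff_conv {a : ℝ} (ha : 0 < a) {k F : E n → ℂ} (hk : PolyGauss a k)
    (hF : PolyInt F) : ContDiff ℝ ∞ (HeatBMO.conv k F) := by
  have hd : ∀ {k : E n → ℂ}, PolyGauss a k → Differentiable ℝ (HeatBMO.conv k F) :=
    fun hk x => (hasFDerivAt_conv hk.differentiable_and.1 (hk.gaussDecay ha)
      (fun i => (hk.differentiable_and.2 i).gaussDecay ha) hF x).1.differentiableAt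
  refine contDiff_infty.2 fun m => ?_
  induction m generalizing k with
  | zero => exact contDiff_zero.2 (hd hk).continuous
  | succ m ih =>
    rw [Nat.cast_add, Nat.cast_one, contDiff_succ_iff_fderiv_apply]
    refine ⟨hd hk, by simp, fun v => ?_⟩
    simp_rw [fderiv_eq_sum_partialD, hk.partialD_conv ha hF]
    exact ContDiff.sum fun i _ => contDiff_const.mul (ih (hk.differentiable_and.2 i))

/-! ### Cutoff functions on a half-space -/

lemma partialD_ofReal {f : E n → ℝ} (hf : Differentiable ℝ f) (i : Fin n) (x : E n) :
    partialD i (fun x => (f x : ℂ)) x = (fderiv ℝ f x (EuclideanSpace.single i 1) : ℝ) := by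
  have h : HasFDerivAt (fun x => (f x : ℂ)) (Complex.ofRealCLM.comp (fderiv ℝ f x)) x :=
    Complex.ofRealCLM.hasFDerivAt.comp x (hf x).hasFDerivAt
  rw [partialD, h.fderiv]
  rfl

section Cutoff

variable [NeZero n]

lemma exists_radial_cutoff (n : ℕ) : ∃ χ : E n → ℝ, ContDiff ℝ ∞ χ ∧ HasCompactSupport χ ∧
    (∀ x, 0 ≤ χ x ∧ χ x ≤ 1) ∧ (∀ x, ‖x‖ ≤ 1 → χ x = 1) ∧ (∀ x, 2 ≤ ‖x‖ → χ x = 0) ∧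
    ∃ C, 0 ≤ C ∧ ∀ x, ‖fderiv ℝ χ x‖ ≤ C := by
  let f : ContDiffBump (0 : E n) := ⟨1, 2, one_pos, one_lt_two⟩
  have hsm : ContDiff ℝ ∞ f := f.contDiff
  obtain ⟨C, hC⟩ := (f.hasCompactSupport.fderiv (𝕜 := ℝ)).exists_bound_of_continuous
    (hsm.continuous_fderiv (by simp))
  refine ⟨f, hsm, f.hasCompactSupport, fun x => ⟨f.nonneg, f.le_one⟩, fun x hx => ?_, fun x hx => ?_,
    C, (norm_nonneg _).trans (hC 0), hC⟩
  · exact f.one_of_mem_closedBall (by simpa [f] using hx)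
  · exact f.zero_of_le_dist (by simpa [f] using hx)

lemma exists_smoothTransition_bound : ∃ C, 0 ≤ C ∧ (∀ t, |deriv Real.smoothTransition t| ≤ C) ∧
    ∀ t, 1 < t → deriv Real.smoothTransition t = 0 := by
  have hsm : ContDiff ℝ ∞ Real.smoothTransition := Real.smoothTransition.contDiff
  have h1 : ∀ t, 1 < t → deriv Real.smoothTransition t = 0 := fun t ht => by
    have : Real.smoothTransition =ᶠ[𝓝 t] fun _ => 1 := by
      filter_upwards [lt_mem_nhds ht] with u hu
      exact Real.smoothTransition.one_of_one_le hu.le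
    rw [this.deriv_eq]; simp
  have h0 : ∀ t, t < 0 → deriv Real.smoothTransition t = 0 := fun t ht => by
    have : Real.smoothTransition =ᶠ[𝓝 t] fun _ => 0 := by
      filter_upwards [gt_mem_nhds ht] with u hu
      exact Real.smoothTransition.zero_of_nonpos hu.le
    rw [this.deriv_eq]; simp
  obtain ⟨C, hC⟩ := (isCompact_Icc (a := (0 : ℝ)) (b := 1)).exists_bound_of_continuousOn
    (hsm.continuous_deriv (by simp)).continuousOn
  refine ⟨C, (norm_nonneg _).trans (hC 0 (by simp)), fun t => ?_, h1⟩
  rcases lt_or_ge t 0 with ht | ht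
  · rw [h0 t ht, abs_zero]; exact (norm_nonneg _).trans (hC 0 (by simp))
  rcases lt_or_ge 1 t with ht1 | ht1
  · rw [h1 t ht1, abs_zero]; exact (norm_nonneg _).trans (hC 0 (by simp))
  · exact hC t ⟨ht, ht1⟩

/-- The cutoff function with outer scale `R` and distance `ε` from the hyperplane. -/
def cutoff (χ : E n → ℝ) (s R ε : ℝ) (x : E n) : ℝ :=
  χ (R⁻¹ • x) * Real.smoothTransition (s * x (lastIdx n) / ε - 1)

lemma hasFDerivAt_last (s ε : ℝ) (x : E n) :
    HasFDerivAt (fun x : E n => Real.smoothTransition (s * x (lastIdx n) / ε - 1))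
      (deriv Real.smoothTransition (s * x (lastIdx n) / ε - 1) •
        ((s / ε) • (EuclideanSpace.proj (𝕜 := ℝ) (lastIdx n) : E n →L[ℝ] ℝ))) x := by
  have hsm : ContDiff ℝ ∞ Real.smoothTransition := Real.smoothTransition.contDiff
  have hg : HasDerivAt Real.smoothTransition
      (deriv Real.smoothTransition (s * x (lastIdx n) / ε - 1)) (s * x (lastIdx n) / ε - 1) :=
    ((hsm.differentiable (by simp)) _).hasDerivAt
  have h1 : HasFDerivAt (fun x : E n => s * x (lastIdx n) / ε - 1)
      ((s / ε) • (EuclideanSpace.proj (𝕜 := ℝ) (lastIdx n) : E n →L[ℝ] ℝ)) x := by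
    have := ((EuclideanSpace.proj (𝕜 := ℝ) (lastIdx n) : E n →L[ℝ] ℝ).hasFDerivAt
      (x := x)).const_mul (s / ε) |>.sub_const 1
    refine this.congr_of_eventuallyEq (Eventually.of_forall fun y => ?_)
    simp; ring
  exact hg.comp_hasFDerivAt x h1

lemma contDiff_cutoff {χ : E n → ℝ} (hχ : ContDiff ℝ ∞ χ) (s R ε : ℝ) :
    ContDiff ℝ ∞ (cutoff χ s R ε) := by
  have hsm : ContDiff ℝ ∞ Real.smoothTransition := Real.smoothTransition.contDiff
  refine (hχ.comp (contDiff_const_smul R⁻¹)).mul (hsm.comp ?_)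
  have : ContDiff ℝ ∞ fun x : E n => x (lastIdx n) :=
    (EuclideanSpace.proj (𝕜 := ℝ) (lastIdx n) : E n →L[ℝ] ℝ).contDiff
  exact ((contDiff_const.mul this).div_const ε).sub contDiff_const

lemma isTest_cutoff {χ : E n → ℝ} (hχ : ContDiff ℝ ∞ χ) (hc : HasCompactSupport χ) (s : ℝ)
    {R ε : ℝ} (hR : 0 < R) (hε : 0 < ε) :
    IsTest (half n s) (fun x => (cutoff χ s R ε x : ℂ)) := by
  refine ⟨Complex.ofRealCLM.contDiff.comp (contDiff_cutoff hχ s R ε), ?_, ?_⟩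
  · have h1 : HasCompactSupport (cutoff χ s R ε) :=
      (hc.comp_smul (inv_ne_zero hR.ne')).mul_right
    exact h1.comp_left (g := fun r : ℝ => (r : ℂ)) (by simp)
  · have hcl : IsClosed {x : E n | ε ≤ s * x (lastIdx n)} :=
      isClosed_le continuous_const (by fun_prop)
    have hsub : tsupport (fun x => (cutoff χ s R ε x : ℂ)) ⊆ {x : E n | ε ≤ s * x (lastIdx n)} := by
      refine closure_minimal (fun x hx => ?_) hcl
      by_contra h
      simp only [Set.mem_ofPred_eq, not_le] at h
      refine hx ?_
      have : s * x (lastIdx n) / ε - 1 ≤ 0 := by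
        rw [sub_nonpos, div_le_one hε]; exact h.le
      simp [cutoff, Real.smoothTransition.zero_of_nonpos this]
    exact hsub.trans fun x hx => hε.trans_le hx

/-- The radial factor contributes `C₁ / R` in every direction. The factor in `xₙ` contributes only
to the normal derivative, and only where it is not yet constant, that is for `s * xₙ ≤ 2ε`. -/
lemma norm_partialD_cutoff_le {χ : E n → ℝ} (hχ : ContDiff ℝ ∞ χ)
    (h01 : ∀ x, 0 ≤ χ x ∧ χ x ≤ 1) (hz : ∀ x, 2 ≤ ‖x‖ → χ x = 0) {C₁ C₂ : ℝ}
    (hC₁ : ∀ x, ‖fderiv ℝ χ x‖ ≤ C₁) (hC₂ : ∀ t, |deriv Real.smoothTransition t| ≤ C₂)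
    (hC₂' : ∀ t, 1 < t → deriv Real.smoothTransition t = 0) {s : ℝ} (hs : s = 1 ∨ s = -1)
    {R ε : ℝ} (hR : 0 < R) (hε : 0 < ε) (i : Fin n) (x : E n) :
    ‖partialD i (fun x => (cutoff χ s R ε x : ℂ)) x‖ ≤ C₁ / R +
      if i = lastIdx n ∧ ‖x‖ ≤ 2 * R ∧ s * x (lastIdx n) ≤ 2 * ε then C₂ / ε else 0 := by
  have hd : Differentiable ℝ (cutoff χ s R ε) := (contDiff_cutoff hχ s R ε).differentiable (by simp)
  have h1 : HasFDerivAt (fun x : E n => χ (R⁻¹ • x)) (R⁻¹ • fderiv ℝ χ (R⁻¹ • x)) x := by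
    have := HasFDerivAt.comp (g := χ) (f := fun x : E n => R⁻¹ • x) x
      ((hχ.differentiable (by simp)) (R⁻¹ • x)).hasFDerivAt ((hasFDerivAt_id x).const_smul R⁻¹)
    refine this.congr_fderiv ?_
    ext v
    simp
  have h2 := hasFDerivAt_last s ε x
  have h3 := h1.mul h2
  have hC₁0 : 0 ≤ C₁ := (norm_nonneg _).trans (hC₁ 0)
  have hC₂0 : 0 ≤ C₂ := (abs_nonneg _).trans (hC₂ 0)
  have hs1 : |s| = 1 := by rcases hs with rfl | rfl <;> simp
  rw [partialD_ofReal hd, Complex.norm_real,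
    show fderiv ℝ (cutoff χ s R ε) x = _ from h3.fderiv]
  set g := Real.smoothTransition (s * x (lastIdx n) / ε - 1) with hg
  set g' := deriv Real.smoothTransition (s * x (lastIdx n) / ε - 1) with hg'
  set e : E n := EuclideanSpace.single i 1 with he
  have hg01 : |g| ≤ 1 := by
    rw [abs_of_nonneg (Real.smoothTransition.nonneg _)]; exact Real.smoothTransition.le_one _
  have hne : ‖e‖ = 1 := by simp [he]
  have hval : (χ (R⁻¹ • x) • (g' • ((s / ε) • (EuclideanSpace.proj (𝕜 := ℝ) (lastIdx n) :
      E n →L[ℝ] ℝ))) + g • (R⁻¹ • fderiv ℝ χ (R⁻¹ • x))) e =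
      χ (R⁻¹ • x) * (g' * ((s / ε) * e (lastIdx n))) + g * (R⁻¹ * fderiv ℝ χ (R⁻¹ • x) e) := by
    simp
  rw [hval, add_comm]
  refine (norm_add_le _ _).trans (add_le_add ?_ ?_)
  · rw [norm_mul, norm_mul, Real.norm_eq_abs, Real.norm_eq_abs, abs_of_pos (inv_pos.2 hR)]
    have h4 : ‖fderiv ℝ χ (R⁻¹ • x) e‖ ≤ C₁ := by
      refine (ContinuousLinearMap.le_opNorm _ _).trans ?_
      rw [hne, mul_one]; exact hC₁ _
    calc |g| * (R⁻¹ * ‖fderiv ℝ χ (R⁻¹ • x) e‖) ≤ 1 * (R⁻¹ * C₁) := by gcongr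
      _ = _ := by ring
  · split_ifs with h
    · obtain ⟨rfl, -, -⟩ := h
      rw [norm_mul, norm_mul, norm_mul, norm_div, Real.norm_eq_abs, Real.norm_eq_abs,
        Real.norm_eq_abs, hs1, Real.norm_of_nonneg hε.le, abs_of_nonneg (h01 _).1]
      have h5 : ‖e (lastIdx n)‖ = 1 := by simp [he]
      rw [h5, mul_one]
      calc _ ≤ 1 * (C₂ * (1 / ε)) := by
            gcongr
            · exact (h01 _).2
            · exact hC₂ _
        _ = _ := by ring
    · refine le_of_eq (norm_eq_zero.2 ?_)
      by_cases hi : i = lastIdx n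
      · have h' : ‖x‖ ≤ 2 * R → 2 * ε < s * x (lastIdx n) := fun h1 => by
          by_contra h2
          exact h ⟨hi, h1, not_lt.1 h2⟩
        by_cases hx : ‖x‖ ≤ 2 * R
        · have : g' = 0 := by
            refine hC₂' _ ?_
            rw [lt_sub_iff_add_lt, lt_div_iff₀ hε]
            linarith [h' hx]
          rw [this]; ring
        · have : χ (R⁻¹ • x) = 0 := by
            refine hz _ ?_
            rw [norm_smul, Real.norm_of_nonneg (inv_pos.2 hR).le, ← div_eq_inv_mul,
              le_div_iff₀ hR]
            linarith
          rw [this]; ring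
      · have : e (lastIdx n) = 0 := by simp [he, Ne.symm hi]
        rw [this]; ring

/-- The part of a ball within distance `δ` of the hyperplane, on one side. -/
def slab (n : ℕ) [NeZero n] (s R δ : ℝ) : Set (E n) :=
  {x | ‖x‖ ≤ R ∧ 0 < s * x (lastIdx n) ∧ s * x (lastIdx n) ≤ δ}

lemma measurableSet_slab (s R δ : ℝ) : MeasurableSet (slab n s R δ) := by
  have h : IsClosed {x : E n | s * x (lastIdx n) ≤ δ} :=
    isClosed_le (by fun_prop) continuous_const
  exact (isClosed_le continuous_norm continuous_const).measurableSet.inter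
    ((measurableSet_half s).inter h.measurableSet)

/-- The slabs exclude the hyperplane itself, so they decrease to the empty set; continuity of the
measure from above applies. -/
lemma exists_volume_slab_le (s R : ℝ) {η : ℝ≥0∞} (hη : 0 < η) :
    ∀ δ > 0, ∃ ε, 0 < ε ∧ ε ≤ δ ∧ volume (slab n s R (2 * ε)) ≤ η := by
  intro δ hδ
  have hlim := tendsto_measure_iInter_atTop (μ := (volume : Measure (E n)))
    (s := fun m : ℕ => slab n s R (2 * (δ / (m + 1))))
    (fun m => (measurableSet_slab _ _ _).nullMeasurableSet)
    (fun m k hmk x hx => ⟨hx.1, hx.2.1, hx.2.2.trans (by gcongr)⟩)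
    ⟨0, ((measure_mono (fun x hx => by simpa using hx.1)).trans_lt
      (measure_closedBall_lt_top (x := (0 : E n)) (r := R))).ne⟩
  have hempty : ⋂ m : ℕ, slab n s R (2 * (δ / (m + 1))) = ∅ := by
    rw [Set.eq_empty_iff_forall_notMem]
    intro x hx
    rw [Set.mem_iInter] at hx
    have h0 := (hx 0).2.1
    obtain ⟨m, hm⟩ := exists_nat_gt (2 * δ / (s * x (lastIdx n)))
    have h1 := (hx m).2.2
    rw [div_lt_iff₀ h0] at hm
    rw [← mul_div_assoc, le_div_iff₀ (by positivity)] at h1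
    nlinarith
  rw [hempty, measure_empty] at hlim
  obtain ⟨m, hm⟩ := (hlim.eventually (gt_mem_nhds hη)).exists
  exact ⟨δ / (m + 1), by positivity, div_le_self hδ.le (by linarith [Nat.cast_nonneg (α := ℝ) m]),
    hm.le⟩

lemma exists_norm_le_mul_last {w : E n → ℂ} (hw : ContDiff ℝ ∞ w)
    (h0 : ∀ x, x (lastIdx n) = 0 → w x = 0) (R : ℝ) :
    ∃ M, 0 ≤ M ∧ ∀ x, ‖x‖ ≤ R → ‖w x‖ ≤ M * |x (lastIdx n)| := by
  obtain ⟨M, hM⟩ := (isCompact_closedBall (0 : E n) R).exists_bound_of_continuousOn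
    (hw.continuous_fderiv (by simp)).continuousOn
  refine ⟨max M 0, le_max_right _ _, fun x hx => ?_⟩
  -- The midpoint of `x` and its mirror image is the projection onto the hyperplane, where `w`
  -- vanishes; the mean value inequality runs along the normal from there.
  set z : E n := (1 / 2 : ℝ) • (x + refl n x) with hz
  have hzx : x - z = x (lastIdx n) • EuclideanSpace.single (lastIdx n) (1 : ℝ) := by
    ext i
    by_cases hi : i = lastIdx n
    · subst hi; simp [hz, refl_last]
    · simp [hz, refl_of_ne _ hi, hi]; ring
  have hz0 : z (lastIdx n) = 0 := by simp [hz, refl_last]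
  have hzn : ‖z‖ ≤ R := by
    have := norm_add_le x (refl n x)
    rw [LinearIsometryEquiv.norm_map] at this
    rw [hz, norm_smul, Real.norm_of_nonneg (by norm_num)]
    linarith
  have h := (convex_closedBall (0 : E n) R).norm_image_sub_le_of_norm_fderiv_le (f := w) (𝕜 := ℝ)
    (fun y _ => (hw.differentiable (by simp)) y) hM (x := z) (y := x) (by simpa using hzn)
    (by simpa using hx)
  rw [h0 z hz0, sub_zero, hzx, norm_smul, Real.norm_eq_abs] at h
  simp only [PiLp.norm_single, norm_one, mul_one] at h
  refine h.trans ?_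
  gcongr
  exact le_max_left _ _

/-- Cutting off near the hyperplane costs a normal derivative of size `1 / ε`. If `w` vanishes
there, then `|w| ≤ M|xₙ| ≤ 2Mε` on the slab, so the product is bounded independently of `ε`, and it
is supported on a slab of small volume. Tangential derivatives cost only `C₁ / R`, so they need no
boundary condition. -/
lemma exists_cutoff {s : ℝ} (hs : s = 1 ∨ s = -1) {w : E n → ℂ} (hw : ContDiff ℝ ∞ w)
    (hL : MemLp w 2 volume) : ∃ ζ : ℕ → E n → ℂ, (∀ k, IsTest (half n s) (ζ k)) ∧
      (∀ k x, ‖ζ k x‖ ≤ 1) ∧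
      (∀ x ∈ half n s, Tendsto (fun k => ζ k x) atTop (𝓝 1)) ∧
      ∀ i, (i = lastIdx n → ∀ x, x (lastIdx n) = 0 → w x = 0) →
        Tendsto (fun k => eLpNorm (fun x => w x * partialD i (ζ k) x) 2
          (volume.restrict (half n s))) atTop (𝓝 0) := by
  obtain ⟨χ, hχ, hc, h01, h1, hz, C₁, hC₁0, hC₁⟩ := exists_radial_cutoff n
  obtain ⟨C₂, hC₂0, hC₂, hC₂'⟩ := exists_smoothTransition_bound
  have hs1 : |s| = 1 := by rcases hs with rfl | rfl <;> simp
  have hMex : ∀ k : ℕ, ∃ M, 0 ≤ M ∧ ((∀ x, x (lastIdx n) = 0 → w x = 0) →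
      ∀ x, ‖x‖ ≤ 2 * ((k : ℝ) + 1) → ‖w x‖ ≤ M * |x (lastIdx n)|) := fun k => by
    by_cases h : ∀ x, x (lastIdx n) = 0 → w x = 0
    · obtain ⟨M, hM0, hM⟩ := exists_norm_le_mul_last hw h (2 * ((k : ℝ) + 1))
      exact ⟨M, hM0, fun _ => hM⟩
    · exact ⟨0, le_rfl, fun h' => absurd h' h⟩
  choose M hM0 hM using hMex
  set K : ℕ → ℝ := fun k => M k * 2 * C₂ + 1 with hK
  have hKpos : ∀ k, 0 < K k := fun k => by have := hM0 k; positivity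
  -- `K k` depends on the outer radius but not on `ε`. Hence `ε` can be chosen afterwards so that `K
  -- k` times the indicator of the slab has `L²` norm at most `1 / (k + 1)`.
  have hεex := fun k : ℕ => exists_volume_slab_le (n := n) s (2 * ((k : ℝ) + 1))
    (η := ENNReal.ofReal (((k + 1 : ℝ) * K k)⁻¹ ^ 2))
    (by have := hKpos k; rw [ENNReal.ofReal_pos]; positivity) (1 / (k + 1 : ℝ)) (by positivity)
  choose ε hε hεle hεvol using hεex
  have hR : ∀ k : ℕ, (0 : ℝ) < k + 1 := fun k => by positivity
  refine ⟨fun k x => (cutoff χ s (k + 1) (ε k) x : ℂ), fun k => isTest_cutoff hχ hc s (hR k) (hε k),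
    fun k x => ?_, fun x hx => ?_, fun i hi => ?_⟩
  · rw [Complex.norm_real, cutoff, norm_mul, Real.norm_of_nonneg (h01 _).1,
      Real.norm_of_nonneg (Real.smoothTransition.nonneg _)]
    exact mul_le_one₀ (h01 _).2 (Real.smoothTransition.nonneg _) (Real.smoothTransition.le_one _)
  · refine tendsto_const_nhds.congr' ?_
    obtain ⟨m, hm⟩ := exists_nat_gt (max ‖x‖ (2 / (s * x (lastIdx n))))
    filter_upwards [eventually_ge_atTop m] with k hk
    have hk' : (m : ℝ) ≤ k := by exact_mod_cast hk
    have hx0 : 0 < s * x (lastIdx n) := hx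
    have e1 : χ (((k : ℝ) + 1)⁻¹ • x) = 1 := by
      refine h1 _ ?_
      rw [norm_smul, Real.norm_of_nonneg (by positivity), ← div_eq_inv_mul, div_le_one (hR k)]
      linarith [le_max_left ‖x‖ (2 / (s * x (lastIdx n)))]
    have e2 : 1 ≤ s * x (lastIdx n) / ε k - 1 := by
      have h2 : 2 / (s * x (lastIdx n)) < k + 1 := by
        linarith [le_max_right ‖x‖ (2 / (s * x (lastIdx n)))]
      rw [div_lt_iff₀ hx0] at h2
      have h3 := hεle k
      rw [le_div_iff₀ (hR k)] at h3
      rw [le_sub_iff_add_le, le_div_iff₀ (hε k)]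
      have := hε k
      by_contra hlt
      nlinarith [hR k]
    simp [cutoff, e1, Real.smoothTransition.one_of_one_le e2]
  · have hbound : ∀ k : ℕ, eLpNorm (fun x => w x *
        partialD i (fun x => (cutoff χ s (k + 1) (ε k) x : ℂ)) x) 2 (volume.restrict (half n s)) ≤
        ENNReal.ofReal (C₁ / (k + 1)) * eLpNorm w 2 volume + ENNReal.ofReal (1 / (k + 1)) := by
      intro k
      have hpt : ∀ x ∈ half n s, ‖w x * partialD i (fun x => (cutoff χ s (k + 1) (ε k) x : ℂ)) x‖ ≤
          C₁ / (k + 1) * ‖w x‖ +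
            (slab n s (2 * ((k : ℝ) + 1)) (2 * ε k)).indicator (fun _ => K k) x := fun x hx => by
        have hb := norm_partialD_cutoff_le hχ h01 hz hC₁ hC₂ hC₂' hs (hR k) (hε k) i x
        rw [norm_mul]
        refine (mul_le_mul_of_nonneg_left hb (norm_nonneg _)).trans ?_
        rw [mul_add, mul_comm ‖w x‖]
        gcongr
        split_ifs with h
        · obtain ⟨h2, h3, h4⟩ := h
          have hsl : x ∈ slab n s (2 * ((k : ℝ) + 1)) (2 * ε k) := ⟨h3, hx, h4⟩
          rw [Set.indicator_of_mem hsl]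
          have h5 := hM k (hi h2) x h3
          have h6 : |x (lastIdx n)| ≤ 2 * ε k := by
            have : |s * x (lastIdx n)| ≤ 2 * ε k := by rwa [abs_of_pos hx]
            rwa [abs_mul, hs1, one_mul] at this
          have := hM0 k
          have hεk := hε k
          calc ‖w x‖ * (C₂ / ε k) ≤ (M k * (2 * ε k)) * (C₂ / ε k) := by
                gcongr
                exact h5.trans (by gcongr)
            _ = M k * 2 * C₂ := by field_simp
            _ ≤ K k := by simp [hK]
        · rw [mul_zero]
          exact Set.indicator_nonneg (fun _ _ => (hKpos k).le) _
      have hind : eLpNorm ((slab n s (2 * ((k : ℝ) + 1)) (2 * ε k)).indicator (fun _ => K k)) 2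
          volume ≤ ENNReal.ofReal (1 / (k + 1)) := by
        rw [eLpNorm_indicator_const (measurableSet_slab _ _ _) two_ne_zero (by norm_num)]
        have hKk := hKpos k
        calc ‖K k‖ₑ * volume (slab n s (2 * ((k : ℝ) + 1)) (2 * ε k)) ^ (1 / (2 : ℝ≥0∞).toReal)
            ≤ ‖K k‖ₑ * ENNReal.ofReal (((k + 1 : ℝ) * K k)⁻¹ ^ 2) ^ (1 / (2 : ℝ≥0∞).toReal) := by
              gcongr; exact hεvol k
          _ = ENNReal.ofReal (K k) * ENNReal.ofReal ((k + 1 : ℝ) * K k)⁻¹ := by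
              rw [Real.enorm_of_nonneg hKk.le, ENNReal.ofReal_rpow_of_nonneg (by positivity)
                (by simp)]
              congr 2
              rw [← Real.rpow_natCast, ← Real.rpow_mul (by positivity)]
              simp
          _ = _ := by
              rw [← ENNReal.ofReal_mul hKk.le]
              congr 1
              field_simp
      calc _ ≤ eLpNorm (fun x => C₁ / (k + 1) * ‖w x‖ +
            (slab n s (2 * ((k : ℝ) + 1)) (2 * ε k)).indicator (fun _ => K k) x) 2
              (volume.restrict (half n s)) := by
            refine eLpNorm_mono_ae_real ?_
            filter_upwards [ae_restrict_mem (measurableSet_half s)] with x hx using hpt x hx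
        _ ≤ eLpNorm (fun x => C₁ / (k + 1) * ‖w x‖ +
            (slab n s (2 * ((k : ℝ) + 1)) (2 * ε k)).indicator (fun _ => K k) x) 2 volume :=
            eLpNorm_restrict_le _ _ _ _
        _ ≤ eLpNorm (fun x => C₁ / (k + 1) * ‖w x‖) 2 volume +
            eLpNorm ((slab n s (2 * ((k : ℝ) + 1)) (2 * ε k)).indicator (fun _ => K k)) 2
              volume := by
            refine eLpNorm_add_le (hL.1.norm.const_mul _)
              (aestronglyMeasurable_const.indicator (measurableSet_slab _ _ _)) (by norm_num)
        _ ≤ _ := by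
            refine add_le_add (le_of_eq ?_) hind
            have := eLpNorm_const_smul (C₁ / ((k : ℝ) + 1)) (fun x => ‖w x‖) 2
              (volume : Measure (E n))
            rw [eLpNorm_norm, Real.enorm_of_nonneg (by positivity)] at this
            exact this
    refine tendsto_of_tendsto_of_tendsto_of_le_of_le tendsto_const_nhds ?_
      (fun _ => zero_le) hbound
    have t1 : ∀ C : ℝ, Tendsto (fun k : ℕ => ENNReal.ofReal (C / (k + 1))) atTop (𝓝 0) := fun C => by
      have := ENNReal.tendsto_ofReal
        ((tendsto_one_div_add_atTop_nhds_zero_nat (𝕜 := ℝ)).const_mul C)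
      simpa [div_eq_mul_inv] using this
    have t2 := ENNReal.Tendsto.mul_const (t1 C₁) (b := eLpNorm w 2 volume) (Or.inr hL.2.ne)
    simpa using t2.add (t1 1)

end Cutoff

/-! ### Integration by parts on half-spaces -/

/-! ### Limits of products and pairings in `L²`. -/

section Limits

variable {α : Type*} [MeasurableSpace α] {μ : Measure α}

lemma integrable_mul_of_memLp {f g : α → ℂ} (hf : MemLp f 2 μ) (hg : MemLp g 2 μ) :
    Integrable (fun x => f x * g x) μ :=
  hf.integrable_mul hg

lemma enorm_integral_mul_le {f g : α → ℂ} (hf : AEStronglyMeasurable f μ)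
    (hg : AEStronglyMeasurable g μ) :
    ‖∫ x, f x * g x ∂μ‖ₑ ≤ eLpNorm f 2 μ * eLpNorm g 2 μ := by
  refine (enorm_integral_le_lintegral_enorm _).trans ?_
  rw [← eLpNorm_one_eq_lintegral_enorm (f := fun x => f x * g x)]
  have h := eLpNorm_smul_le_mul_eLpNorm (p := 2) (q := 2) (r := 1) hg hf
  exact h

lemma tendsto_integral_mul {f g : α → ℂ} {G : ℕ → α → ℂ} (hf : MemLp f 2 μ) (hg : MemLp g 2 μ)
    (hG : ∀ k, MemLp (G k) 2 μ) (h : Tendsto (fun k => eLpNorm (G k - g) 2 μ) atTop (𝓝 0)) :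
    Tendsto (fun k => ∫ x, f x * G k x ∂μ) atTop (𝓝 (∫ x, f x * g x ∂μ)) := by
  rw [tendsto_iff_edist_tendsto_0]
  have h2 : Tendsto (fun k => eLpNorm f 2 μ * eLpNorm (G k - g) 2 μ) atTop (𝓝 0) := by
    simpa using ENNReal.Tendsto.const_mul h (Or.inr hf.2.ne)
  refine tendsto_of_tendsto_of_tendsto_of_le_of_le tendsto_const_nhds h2 (fun _ => zero_le)
    fun k => ?_
  simp only
  rw [edist_eq_enorm_sub, ← integral_sub (integrable_mul_of_memLp hf (hG k)) (integrable_mul_of_memLp hf hg)]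
  have := enorm_integral_mul_le hf.1 ((hG k).sub hg).1
  simpa [mul_sub] using this

lemma tendsto_eLpNorm_mul_sub {f : α → ℂ} {ζ : ℕ → α → ℂ} (hf : MemLp f 2 μ)
    (hζ : ∀ k, AEStronglyMeasurable (ζ k) μ) (hb : ∀ k x, ‖ζ k x‖ ≤ 1)
    (h1 : ∀ᵐ x ∂μ, Tendsto (fun k => ζ k x) atTop (𝓝 1)) :
    Tendsto (fun k => eLpNorm (fun x => ζ k x * f x - f x) 2 μ) atTop (𝓝 0) := by
  simp_rw [eLpNorm_two_eq]
  have hfin : ∫⁻ x, (2 * ‖f x‖ₑ) ^ 2 ∂μ ≠ ⊤ := by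
    have := hf.2
    rw [eLpNorm_two_eq] at this
    have h2 := (ENNReal.rpow_lt_top_iff_of_pos (by norm_num : (0 : ℝ) < 1 / 2)).1 this
    simp_rw [mul_pow]
    rw [lintegral_const_mul'' _ (hf.1.enorm.pow_const 2)]
    exact (ENNReal.mul_lt_top (by norm_num) h2).ne
  have := tendsto_lintegral_of_dominated_convergence' (μ := μ)
    (F := fun k x => ‖ζ k x * f x - f x‖ₑ ^ 2) (f := fun _ => 0) (fun x => (2 * ‖f x‖ₑ) ^ 2)
    (fun k => ((((hζ k).mul hf.1).sub hf.1).enorm.pow_const 2))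
    (fun k => ae_of_all _ fun x => ?_) hfin ?_
  · have h2 := (ENNReal.continuous_rpow_const (y := 1 / 2)).continuousAt.tendsto.comp this
    simpa [Function.comp_def] using h2
  · refine pow_le_pow_left' ?_ 2
    refine enorm_sub_le.trans ?_
    rw [enorm_mul, two_mul]
    gcongr
    refine mul_le_of_le_one_left zero_le ?_
    rw [← ofReal_norm]
    exact ENNReal.ofReal_le_one.2 (hb k x)
  · filter_upwards [h1] with x hx
    have h2 : Tendsto (fun k => ‖ζ k x * f x - f x‖ₑ ^ 2) atTop (𝓝 (‖1 * f x - f x‖ₑ ^ 2)) := by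
      exact (ENNReal.continuous_pow 2).continuousAt.tendsto.comp
        (((hx.mul_const (f x)).sub_const (f x)).enorm)
    simpa using h2

end Limits

/-! ### Test functions and classical integration by parts. -/

lemma partialD_conj {f : E n → ℂ} (hf : Differentiable ℝ f) (i : Fin n) (x : E n) :
    partialD i (fun x => conj (f x)) x = conj (partialD i f x) := by
  have h : HasFDerivAt (fun x => conj (f x))
      ((Complex.conjCLE : ℂ →L[ℝ] ℂ).comp (fderiv ℝ f x)) x :=
    (Complex.conjCLE : ℂ →L[ℝ] ℂ).hasFDerivAt.comp x (hf x).hasFDerivAt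
  rw [partialD, h.fderiv]
  rfl

lemma IsTest.conj {Ω : Set (E n)} {φ : E n → ℂ} (h : IsTest Ω φ) :
    IsTest Ω (fun x => conj (φ x)) := by
  refine ⟨Complex.conjCLE.contDiff.comp h.1, h.2.1.comp_left (g := fun z => conj z) (by simp),
    (tsupport_comp_subset (g := fun z : ℂ => conj z) (by simp) φ).trans h.2.2⟩

lemma IsTest.mul_right {Ω : Set (E n)} {φ w : E n → ℂ} (h : IsTest Ω φ) (hw : ContDiff ℝ ∞ w) :
    IsTest Ω (fun x => φ x * w x) :=
  ⟨h.1.mul hw, h.2.1.mul_right, (tsupport_mul_subset_left (f := φ) (g := w)).trans h.2.2⟩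

lemma IsTest.differentiable {Ω : Set (E n)} {φ : E n → ℂ} (h : IsTest Ω φ) :
    Differentiable ℝ φ := h.1.differentiable (by simp)

lemma contDiff_partialD {u : E n → ℂ} (hu : ContDiff ℝ ∞ u) (i : Fin n) :
    ContDiff ℝ ∞ (partialD i u) := by
  have : ContDiff ℝ ∞ (fderiv ℝ u) := hu.fderiv_right (by simp)
  exact this.clm_apply contDiff_const

lemma IsTest.partialD {Ω : Set (E n)} {φ : E n → ℂ} (h : IsTest Ω φ) (i : Fin n) :
    IsTest Ω (partialD i φ) := by
  have hs : Function.support (HeatBMO.partialD i φ) ⊆ tsupport φ := fun x hx => by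
    by_contra hx'
    refine hx ?_
    rw [HeatBMO.partialD, image_eq_zero_of_notMem_tsupport
      (fun h => hx' (tsupport_fderiv_subset ℝ h))]
    rfl
  exact ⟨contDiff_partialD h.1 i, h.2.1.mono' hs,
    (closure_minimal hs (isClosed_tsupport φ)).trans h.2.2⟩

lemma IsTest.memLp {Ω : Set (E n)} {φ : E n → ℂ} (h : IsTest Ω φ) : MemLp φ 2 volume :=
  h.1.continuous.memLp_of_hasCompactSupport h.2.1

lemma setIntegral_mul_partialD_test {Ω : Set (E n)} {w φ : E n → ℂ} (hw : ContDiff ℝ ∞ w)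
    (hL : MemLp w 2 volume) {i : Fin n} (hL' : MemLp (partialD i w) 2 volume)
    (hφ : IsTest Ω φ) :
    ∫ x in Ω, w x * partialD i φ x = -∫ x in Ω, partialD i w x * φ x := by
  have h0 : ∀ x ∉ Ω, φ x = 0 := fun x hx =>
    image_eq_zero_of_notMem_tsupport fun h => hx (hφ.2.2 h)
  have h0' : ∀ x ∉ Ω, partialD i φ x = 0 := fun x hx =>
    image_eq_zero_of_notMem_tsupport fun h => hx ((hφ.partialD i).2.2 h)
  rw [setIntegral_eq_integral_of_forall_compl_eq_zero fun x hx => by rw [h0' x hx, mul_zero],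
    setIntegral_eq_integral_of_forall_compl_eq_zero fun x hx => by rw [h0 x hx, mul_zero]]
  exact integral_mul_fderiv_eq_neg_fderiv_mul_of_integrable
    (hL'.integrable_mul hφ.memLp) (hL.integrable_mul (hφ.partialD i).memLp)
    (hL.integrable_mul hφ.memLp) (fun x _ => hw.differentiable (by simp) x)
    (fun x _ => hφ.differentiable x)

lemma isW12_of_contDiff (Ω : Set (E n)) {u : E n → ℂ} (hu : ContDiff ℝ ∞ u)
    (hL : MemLp u 2 volume) (hL' : ∀ i, MemLp (partialD i u) 2 volume) :
    IsW12 Ω u (fun i => partialD i u) :=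
  ⟨hL.restrict _, fun i => (hL' i).restrict _,
    fun _ hφ i => setIntegral_mul_partialD_test hu hL (hL' i) hφ⟩

lemma memLp_neg_laplacian {u : E n → ℂ} (hL : ∀ i, MemLp (partialD i (partialD i u)) 2 volume) :
    MemLp (fun x => -∑ i, partialD i (partialD i u) x) 2 volume :=
  (memLp_finsetSum _ fun i _ => hL i).neg

lemma MemLp.conj {α : Type*} [MeasurableSpace α] {μ : Measure α} {f : α → ℂ} (hf : MemLp f 2 μ) :
    MemLp (fun x => conj (f x)) 2 μ :=
  hf.mono (Complex.continuous_conj.comp_aestronglyMeasurable hf.1)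
    (ae_of_all _ fun x => by simp)

lemma integral_sum_mul_conj {α : Type*} [MeasurableSpace α] {μ : Measure α}
    {v : α → ℂ} {U D H : Fin n → α → ℂ} (hU : ∀ i, MemLp (U i) 2 μ) (hD : ∀ i, MemLp (D i) 2 μ)
    (hv : MemLp v 2 μ) (hH : ∀ i, MemLp (H i) 2 μ)
    (h : ∀ i, ∫ x, U i x * conj (H i x) ∂μ = -∫ x, D i x * conj (v x) ∂μ) :
    ∫ x, ∑ i, U i x * conj (H i x) ∂μ = ∫ x, (-∑ i, D i x) * conj (v x) ∂μ := by
  rw [integral_finsetSum _ fun i _ => integrable_mul_of_memLp (hU i) (MemLp.conj (hH i))]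
  simp_rw [neg_mul, Finset.sum_mul]
  rw [integral_neg, integral_finsetSum _ fun i _ => integrable_mul_of_memLp (hD i) (MemLp.conj hv),
    ← Finset.sum_neg_distrib]
  exact Finset.sum_congr rfl fun i _ => h i

/-! ### Smooth functions satisfying the Neumann or Dirichlet boundary condition. -/

section Half

variable [NeZero n]

/-- Take `ζ k * w` with the cutoffs above. The derivative error is `(ζ k - 1) ∂w + w ∂(ζ k)`:
dominated convergence handles the first term, the cutoff estimate the second. -/
lemma exists_test_approx {s : ℝ} (hs : s = 1 ∨ s = -1) {w : E n → ℂ} (hw : ContDiff ℝ ∞ w)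
    (hL : MemLp w 2 volume) : ∃ φ : ℕ → E n → ℂ, (∀ k, IsTest (half n s) (φ k)) ∧
      Tendsto (fun k => eLpNorm (φ k - w) 2 (volume.restrict (half n s))) atTop (𝓝 0) ∧
      ∀ i, (i = lastIdx n → ∀ x, x (lastIdx n) = 0 → w x = 0) → MemLp (partialD i w) 2 volume →
        Tendsto (fun k => eLpNorm (partialD i (φ k) - partialD i w) 2
          (volume.restrict (half n s))) atTop (𝓝 0) := by
  obtain ⟨ζ, hζ, hb, h1, h2⟩ := exists_cutoff hs hw hL
  have h1' : ∀ᵐ x ∂volume.restrict (half n s), Tendsto (fun k => ζ k x) atTop (𝓝 1) := by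
    filter_upwards [ae_restrict_mem (measurableSet_half s)] with x hx using h1 x hx
  have hm : ∀ k, AEStronglyMeasurable (ζ k) (volume.restrict (half n s)) := fun k =>
    (hζ k).1.continuous.aestronglyMeasurable
  refine ⟨fun k x => ζ k x * w x, fun k => (hζ k).mul_right hw,
    tendsto_eLpNorm_mul_sub (hL.restrict _) hm hb h1', fun i hi hL' => ?_⟩
  have h3 := (tendsto_eLpNorm_mul_sub (hL'.restrict _) hm hb h1').add (h2 i hi)
  rw [add_zero] at h3
  refine tendsto_of_tendsto_of_tendsto_of_le_of_le tendsto_const_nhds h3 (fun _ => zero_le)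
    fun k => ?_
  have e : partialD i (fun x => ζ k x * w x) - partialD i w =
      (fun x => ζ k x * partialD i w x - partialD i w x) + fun x => w x * partialD i (ζ k) x := by
    rw [partialD_mul (hζ k).differentiable (hw.differentiable (by simp))]
    ext x
    simp only [Pi.sub_apply, Pi.add_apply]
    ring
  simp only
  rw [e]
  exact eLpNorm_add_le (((hm k).mul (hL'.restrict _).1).sub (hL'.restrict _).1)
    ((hL.restrict _).1.mul ((hζ k).partialD i).1.continuous.aestronglyMeasurable) (by norm_num)

/-- The definition of the weak derivative is extended from test functions to `w` by approximation.
Since `v` carries no boundary condition, `w` has to vanish on the hyperplane for the normal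
derivative. -/
lemma IsW12.setIntegral_mul_partialD {s : ℝ} (hs : s = 1 ∨ s = -1) {v w : E n → ℂ}
    {H : Fin n → E n → ℂ} (hv : IsW12 (half n s) v H) (hw : ContDiff ℝ ∞ w)
    (hL : MemLp w 2 volume) {i : Fin n} (hL' : MemLp (partialD i w) 2 volume)
    (h0 : i = lastIdx n → ∀ x, x (lastIdx n) = 0 → w x = 0) :
    ∫ x in half n s, v x * partialD i w x = -∫ x in half n s, H i x * w x := by
  obtain ⟨φ, hφ, h1, h2⟩ := exists_test_approx hs hw hL
  have t1 := tendsto_integral_mul hv.1 (hL'.restrict _)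
    (fun k => (((hφ k).partialD i).memLp).restrict _) (h2 i h0 hL')
  have t2 := (tendsto_integral_mul (hv.2.1 i) (hL.restrict _)
    (fun k => ((hφ k).memLp).restrict _) h1).neg
  refine tendsto_nhds_unique t1 (t2.congr fun k => ?_)
  rw [hv.2.2 _ (hφ k) i]

/-- Integrate by parts against the conjugate of `partialD i u`. In the normal direction this
vanishes on the hyperplane by the Neumann condition, so no boundary term arises. -/
lemma neumannOn_half {s : ℝ} (hs : s = 1 ∨ s = -1) {u : E n → ℂ} (hu : ContDiff ℝ ∞ u)
    (hL : MemLp u 2 volume) (hL' : ∀ i, MemLp (partialD i u) 2 volume)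
    (hL'' : ∀ i, MemLp (partialD i (partialD i u)) 2 volume)
    (h0 : ∀ x, x (lastIdx n) = 0 → partialD (lastIdx n) u x = 0) :
    neumannOn (half n s) u (fun x => -∑ i, partialD i (partialD i u) x) := by
  refine ⟨(memLp_neg_laplacian hL'').restrict _, _, isW12_of_contDiff _ hu hL hL',
    fun v H hv => integral_sum_mul_conj (fun i => (hL' i).restrict _)
      (fun i => (hL'' i).restrict _) hv.1 hv.2.1 fun i => ?_⟩
  have hd : Differentiable ℝ (partialD i u) := (contDiff_partialD hu i).differentiable (by simp)
  have hc : partialD i (fun x => conj (partialD i u x)) =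
      fun x => conj (partialD i (partialD i u) x) := funext (partialD_conj hd i)
  have := hv.setIntegral_mul_partialD hs (w := fun x => conj (partialD i u x)) (i := i)
    (Complex.conjCLE.contDiff.comp (contDiff_partialD hu i)) (MemLp.conj (hL' i))
    (by rw [hc]; exact MemLp.conj (hL'' i)) (fun hi x hx => by subst hi; rw [h0 x hx, map_zero])
  rw [hc] at this
  have h2 := congrArg conj this
  rw [map_neg, ← integral_conj, ← integral_conj] at h2
  simp only [map_mul, Complex.conj_conj] at h2
  simp_rw [mul_comm _ (conj _)]
  rw [h2, neg_neg]

/-- The boundary condition on `u` serves only to place it in the form domain. The form identity is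
obtained by integrating by parts against the test functions approximating `v`. -/
lemma dirichletOn_half {s : ℝ} (hs : s = 1 ∨ s = -1) {u : E n → ℂ} (hu : ContDiff ℝ ∞ u)
    (hL : MemLp u 2 volume) (hL' : ∀ i, MemLp (partialD i u) 2 volume)
    (hL'' : ∀ i, MemLp (partialD i (partialD i u)) 2 volume)
    (h0 : ∀ x, x (lastIdx n) = 0 → u x = 0) :
    dirichletOn (half n s) u (fun x => -∑ i, partialD i (partialD i u) x) := by
  obtain ⟨φ, hφ, h1, h2⟩ := exists_test_approx hs hu hL
  refine ⟨(memLp_neg_laplacian hL'').restrict _, _, ⟨isW12_of_contDiff _ hu hL hL', φ, hφ, h1,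
    fun i => h2 i (fun _ => h0) (hL' i)⟩, fun v H hv => integral_sum_mul_conj
      (fun i => (hL' i).restrict _) (fun i => (hL'' i).restrict _) hv.1.1 hv.1.2.1 fun i => ?_⟩
  obtain ⟨⟨hvL, hHL, -⟩, ψ, hψ, t1, t2⟩ := hv
  have hconj : ∀ f g : E n → ℂ, eLpNorm ((fun x => conj (f x)) - fun x => conj (g x)) 2
      (volume.restrict (half n s)) = eLpNorm (f - g) 2 (volume.restrict (half n s)) := fun f g => by
    refine eLpNorm_congr_norm_ae (ae_of_all _ fun x => ?_)
    rw [Pi.sub_apply, Pi.sub_apply, ← map_sub, Complex.norm_conj]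
  have s1 := tendsto_integral_mul ((hL' i).restrict (half n s)) (MemLp.conj (hHL i))
    (fun k => MemLp.conj (((hψ k).partialD i).memLp.restrict (half n s)))
    (by simpa only [hconj] using t2 i)
  have s2 := (tendsto_integral_mul ((hL'' i).restrict (half n s)) (MemLp.conj hvL)
    (fun k => MemLp.conj ((hψ k).memLp.restrict (half n s)))
    (by simpa only [hconj] using t1)).neg
  refine tendsto_nhds_unique s1 (s2.congr fun k => ?_)
  rw [← setIntegral_mul_partialD_test (contDiff_partialD hu i) (hL' i) (hL'' i) (hψ k).conj]
  simp_rw [partialD_conj (hψ k).differentiable]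

end Half

/-! ### Representatives -/

lemma IsW12.congr {Ω : Set (E n)} {u u' : E n → ℂ} {G : Fin n → E n → ℂ} (h : IsW12 Ω u G)
    (hu : u =ᵐ[volume.restrict Ω] u') : IsW12 Ω u' G := by
  refine ⟨h.1.ae_eq hu, h.2.1, fun φ hφ i => ?_⟩
  rw [← h.2.2 φ hφ i]
  refine integral_congr_ae ?_
  filter_upwards [hu] with x hx
  rw [hx]

lemma IsW012.congr {Ω : Set (E n)} {u u' : E n → ℂ} {G : Fin n → E n → ℂ} (h : IsW012 Ω u G)
    (hu : u =ᵐ[volume.restrict Ω] u') : IsW012 Ω u' G := by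
  obtain ⟨h1, φ, hφ, h2, h3⟩ := h
  refine ⟨h1.congr hu, φ, hφ, h2.congr fun k => eLpNorm_congr_ae ?_, h3⟩
  filter_upwards [hu] with x hx
  rw [Pi.sub_apply, Pi.sub_apply, hx]

lemma formOperator_congr {Ω : Set (E n)} {V : (E n → ℂ) → (Fin n → E n → ℂ) → Prop}
    (hV : ∀ u u' G, V u G → u =ᵐ[volume.restrict Ω] u' → V u' G) {u u' g g' : E n → ℂ}
    (h : formOperator Ω V u g) (hu : u =ᵐ[volume.restrict Ω] u')
    (hg : g =ᵐ[volume.restrict Ω] g') : formOperator Ω V u' g' := by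
  obtain ⟨h1, G, h2, h3⟩ := h
  refine ⟨h1.ae_eq hg, G, hV _ _ _ h2 hu, fun v H hv => ?_⟩
  rw [h3 v H hv]
  refine integral_congr_ae ?_
  filter_upwards [hg] with x hx
  rw [hx]

/-! ### The heat semigroup of `ℝⁿ` on `L²` -/

lemma GaussDecay.const_mul {k : E n → ℂ} (hk : GaussDecay k) (c : ℂ) :
    GaussDecay (fun x => c * k x) := by
  obtain ⟨h, C, b, hb, hC⟩ := hk
  refine ⟨continuous_const.mul h, ‖c‖ * C, b, hb, fun x => ?_⟩
  rw [norm_mul, mul_assoc]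
  gcongr
  exact hC x

lemma GaussDecay.sub {k l : E n → ℂ} (hk : GaussDecay k) (hl : GaussDecay l) :
    GaussDecay (fun x => k x - l x) := by
  obtain ⟨h, C, b, hb, hC⟩ := hk
  obtain ⟨h', C', b', hb', hC'⟩ := hl
  have hC0 : 0 ≤ C := by simpa using (norm_nonneg _).trans (hC 0)
  have hC0' : 0 ≤ C' := by simpa using (norm_nonneg _).trans (hC' 0)
  refine ⟨h.sub h', C + C', min b b', lt_min hb hb', fun x => ?_⟩
  rw [add_mul]
  refine (norm_sub_le _ _).trans (add_le_add ((hC x).trans ?_) ((hC' x).trans ?_))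
  · have := min_le_left b b'
    gcongr
  · have := min_le_right b b'
    gcongr

lemma convL_sub {k l : E n → ℂ} (hk : GaussDecay k) (hl : GaussDecay l) (f : L2 n) :
    convL _ (hk.sub hl) f = convL k hk f - convL l hl f := by
  refine Lp.ext ?_
  filter_upwards [convL_ae _ (hk.sub hl) f, convL_ae k hk f, convL_ae l hl f,
    Lp.coeFn_sub (convL k hk f) (convL l hl f)] with x h1 h2 h3 h4
  rw [h1, h4, Pi.sub_apply, h2, h3, conv, conv, conv,
    ← integral_sub (hk.integrable_conv (MemLp.polyInt (Lp.memLp f)) x)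
      (hl.integrable_conv (MemLp.polyInt (Lp.memLp f)) x)]
  simp_rw [sub_mul]

lemma convL_real_mul {k : E n → ℂ} (hk : GaussDecay k) (r : ℝ) (f : L2 n) :
    convL _ (hk.const_mul (r : ℂ)) f = r • convL k hk f := by
  refine Lp.ext ?_
  filter_upwards [convL_ae _ (hk.const_mul (r : ℂ)) f, convL_ae k hk f,
    Lp.coeFn_smul r (convL k hk f)] with x h1 h2 h4
  rw [h1, h4, Pi.smul_apply, h2, conv, conv, Complex.real_smul, ← integral_const_mul]
  simp_rw [mul_assoc]

/-- The time derivative of the Gauss-Weierstrass kernel. -/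
def dgauss (t : ℝ) (x : E n) : ℝ := (‖x‖ ^ 2 / (4 * t ^ 2) - n / (2 * t)) * gauss t x

/-- The time derivative of the Gauss-Weierstrass kernel, with values in `ℂ`. -/
def dgaussC (t : ℝ) (x : E n) : ℂ := (dgauss t x : ℝ)

lemma hasDerivAt_gauss {t : ℝ} (ht : 0 < t) (x : E n) :
    HasDerivAt (fun τ => gauss τ x) (dgauss t x) t := by
  have ha : 4 * Real.pi * t ≠ 0 := by positivity
  have h1 : HasDerivAt (fun τ : ℝ => 4 * Real.pi * τ) (4 * Real.pi) t := by
    simpa using (hasDerivAt_id t).const_mul (4 * Real.pi)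
  have h2 := (h1.rpow_const (p := (n : ℝ) / 2) (Or.inl ha)).fun_inv
    (Real.rpow_pos_of_pos (by positivity) _).ne'
  have h3 : HasDerivAt (fun τ : ℝ => -(1 / (4 * τ)) * ‖x‖ ^ 2) (‖x‖ ^ 2 / (4 * t ^ 2)) t := by
    have h4 : HasDerivAt (fun τ : ℝ => 4 * τ) 4 t := by
      simpa using (hasDerivAt_id t).const_mul 4
    have := ((h4.fun_inv (by positivity)).fun_neg).mul_const (‖x‖ ^ 2)
    simp_rw [one_div]
    refine this.congr_deriv ?_
    field_simp
  have h5 := h2.mul h3.exp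
  refine h5.congr_deriv ?_
  have hp : (4 * Real.pi * t) ^ ((n : ℝ) / 2) ≠ 0 :=
    (Real.rpow_pos_of_pos (by positivity) _).ne'
  rw [Real.rpow_sub_one ha, dgauss, gauss]
  field_simp
  ring

/-- A bound uniform for times near `t`, for dominated convergence of the difference quotients. Such
Gaussians decay at least at rate `1 / (8t)`: half of it absorbs the quadratic factor and half
remains. -/
lemma exists_dgauss_bound {t : ℝ} (ht : 0 < t) : ∃ C b : ℝ, 0 < b ∧
    ∀ τ ∈ Set.Ioo (t / 2) (2 * t), ∀ x : E n, |dgauss τ x| ≤ C * Real.exp (-b * ‖x‖ ^ 2) := by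
  refine ⟨(1 / t ^ 2 + n / t) * ((2 * Real.pi * t) ^ ((n : ℝ) / 2))⁻¹ *
    (Nat.factorial 2 * Real.exp (1 + 1 / (4 * (1 / (16 * t))))), 1 / (16 * t), by positivity,
    fun τ hτ x => ?_⟩
  obtain ⟨h1, h2⟩ := hτ
  have hτ0 : 0 < τ := by linarith
  have hg : gauss τ x ≤ ((2 * Real.pi * t) ^ ((n : ℝ) / 2))⁻¹ *
      Real.exp (-(1 / (8 * t)) * ‖x‖ ^ 2) := by
    unfold gauss
    refine mul_le_mul ?_ ?_ (Real.exp_pos _).le (by positivity)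
    · refine inv_anti₀ (by positivity) (Real.rpow_le_rpow (by positivity) ?_ (by positivity))
      nlinarith [Real.pi_pos]
    · refine Real.exp_le_exp.2 (mul_le_mul_of_nonneg_right (neg_le_neg ?_) (by positivity))
      exact one_div_le_one_div_of_le (by positivity) (by linarith)
  have hp : |‖x‖ ^ 2 / (4 * τ ^ 2) - n / (2 * τ)| ≤ (1 / t ^ 2 + n / t) * (1 + ‖x‖) ^ 2 := by
    have a1 : ‖x‖ ^ 2 / (4 * τ ^ 2) ≤ 1 / t ^ 2 * (1 + ‖x‖) ^ 2 := by
      rw [div_mul_eq_mul_div, one_mul]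
      refine div_le_div₀ (by positivity) ?_ (by positivity) (by nlinarith)
      exact pow_le_pow_left₀ (norm_nonneg _) (by linarith) 2
    have a2 : n / (2 * τ) ≤ n / t * (1 + ‖x‖) ^ 2 := by
      refine le_trans ?_ (le_mul_of_one_le_right (by positivity)
        (one_le_pow₀ (by linarith [norm_nonneg x])))
      exact div_le_div_of_nonneg_left (by positivity) ht (by linarith)
    have a3 : 0 ≤ ‖x‖ ^ 2 / (4 * τ ^ 2) := by positivity
    have a4 : 0 ≤ (n : ℝ) / (2 * τ) := by positivity
    rw [add_mul, abs_le]
    constructor <;> nlinarith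
  have he := exp_mul_pow_le 2 (b := 1 / (16 * t)) (by positivity) (norm_nonneg x)
  have hs : Real.exp (-(1 / (8 * t)) * ‖x‖ ^ 2) =
      Real.exp (-(1 / (16 * t)) * ‖x‖ ^ 2) * Real.exp (-(1 / (16 * t)) * ‖x‖ ^ 2) := by
    rw [← Real.exp_add]; congr 1; field_simp; ring
  rw [dgauss, abs_mul, abs_of_pos (gauss_pos hτ0 x)]
  calc _ ≤ ((1 / t ^ 2 + n / t) * (1 + ‖x‖) ^ 2) * (((2 * Real.pi * t) ^ ((n : ℝ) / 2))⁻¹ *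
        Real.exp (-(1 / (8 * t)) * ‖x‖ ^ 2)) :=
        mul_le_mul hp hg (gauss_pos hτ0 x).le (by positivity)
    _ = (1 / t ^ 2 + n / t) * ((2 * Real.pi * t) ^ ((n : ℝ) / 2))⁻¹ *
        (Real.exp (-(1 / (16 * t)) * ‖x‖ ^ 2) * (1 + ‖x‖) ^ 2) *
          Real.exp (-(1 / (16 * t)) * ‖x‖ ^ 2) := by rw [hs]; ring
    _ ≤ _ := mul_le_mul_of_nonneg_right (mul_le_mul_of_nonneg_left he (by positivity))
        (Real.exp_pos _).le

lemma gaussDecay_dgaussC {t : ℝ} (ht : 0 < t) : GaussDecay (dgaussC t : E n → ℂ) := by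
  obtain ⟨C, b, hb, h⟩ := exists_dgauss_bound (n := n) ht
  refine ⟨Complex.continuous_ofReal.comp ?_, C, b, hb, fun x => ?_⟩
  · exact (by fun_prop : Continuous fun x : E n => ‖x‖ ^ 2 / (4 * t ^ 2) - n / (2 * t)).mul
      (continuous_gauss t)
  · rw [dgaussC, Complex.norm_real]
    exact h t ⟨by linarith, by linarith⟩ x

lemma polyGauss_gaussC (t : ℝ) : PolyGauss (1 / (4 * t)) (gaussC t : E n → ℂ) := by
  have : (gaussC t : E n → ℂ) = fun x => (((4 * Real.pi * t) ^ ((n : ℝ) / 2))⁻¹ : ℝ) *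
      ((Real.exp (-(1 / (4 * t)) * ‖x‖ ^ 2) : ℝ) : ℂ) := by
    ext x
    rw [gaussC, gauss, Complex.ofReal_mul]
  rw [this]
  exact PolyGauss.smul _ PolyGauss.gauss

lemma partialD_gaussC (t : ℝ) (i : Fin n) : partialD i (gaussC t) =
    fun x : E n => (-(1 / (2 * t)) : ℂ) * ((x i : ℂ) * gaussC t x) := by
  have : (gaussC t : E n → ℂ) = fun x => (((4 * Real.pi * t) ^ ((n : ℝ) / 2))⁻¹ : ℝ) *
      ((Real.exp (-(1 / (4 * t)) * ‖x‖ ^ 2) : ℝ) : ℂ) := by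
    ext x
    rw [gaussC, gauss, Complex.ofReal_mul]
  rw [this, partialD_const_mul (fun x => (hasFDerivAt_exp _ x).differentiableAt), partialD_exp]
  ext x
  push_cast
  ring

lemma sum_partialD_gaussC {t : ℝ} (ht : 0 < t) (x : E n) :
    ∑ i, partialD i (partialD i (gaussC t)) x = dgaussC t x := by
  have hd : Differentiable ℝ (gaussC t : E n → ℂ) := (polyGauss_gaussC t).differentiable_and.1
  have h : ∀ i, partialD i (partialD i (gaussC t)) x =
      ((x i : ℂ) ^ 2 / (4 * t ^ 2) - 1 / (2 * t)) * gaussC t x := fun i => by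
    rw [partialD_gaussC, partialD_const_mul (f := fun x => (x i : ℂ) * gaussC t x)
      ((differentiable_coord i).mul hd), partialD_mul (differentiable_coord i) hd, partialD_coord, partialD_gaussC]
    have : (t : ℂ) ≠ 0 := by exact_mod_cast ht.ne'
    simp only [if_true]
    field_simp
    ring
  simp_rw [h]
  rw [← Finset.sum_mul, Finset.sum_sub_distrib, ← Finset.sum_div, dgaussC, dgauss,
    EuclideanSpace.norm_sq_eq]
  simp [gaussC]
  left
  ring

lemma sum_partialD_euclHeat {t : ℝ} (ht : 0 < t) {F : E n → ℂ} (hF : PolyInt F) (x : E n) :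
    ∑ i, partialD i (partialD i (euclHeat t F)) x = conv (dgaussC t) F x := by
  have ha : 0 < 1 / (4 * t) := by positivity
  have hp := polyGauss_gaussC (n := n) t
  have h : ∀ i, partialD i (partialD i (euclHeat t F)) =
      conv (partialD i (partialD i (gaussC t))) F := fun i => by
    rw [euclHeat, hp.partialD_conv ha hF, (hp.differentiable_and.2 i).partialD_conv ha hF]
  simp_rw [h, conv]
  rw [← integral_finsetSum]
  · simp_rw [← Finset.sum_mul, sum_partialD_gaussC ht]
  · intro i _
    have h2 := (hp.differentiable_and.2 i).differentiable_and.2 i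
    exact (h2.gaussDecay ha).integrable_conv hF x

/-- The difference quotients of the kernel converge in `L¹`. By Young's inequality this makes the
semigroup differentiable on `L²`. -/
lemma tendsto_integral_norm_slope_gaussC {t : ℝ} (ht : 0 < t) :
    Tendsto (fun τ : ℝ => ∫ x : E n, ‖((τ - t)⁻¹ : ℝ) * (gaussC τ x - gaussC t x) - dgaussC t x‖)
      (𝓝[≠] t) (𝓝 0) := by
  obtain ⟨C, b, hb, h⟩ := exists_dgauss_bound (n := n) ht
  have hI : Set.Ioo (t / 2) (2 * t) ∈ 𝓝 t := Ioo_mem_nhds (by linarith) (by linarith)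
  have htI : t ∈ Set.Ioo (t / 2) (2 * t) := ⟨by linarith, by linarith⟩
  have hI' : ∀ᶠ τ in 𝓝[≠] t, τ ∈ Set.Ioo (t / 2) (2 * t) := mem_nhdsWithin_of_mem_nhds hI
  have key := tendsto_integral_filter_of_dominated_convergence (μ := (volume : Measure (E n)))
    (l := 𝓝[≠] t) (f := fun _ => 0)
    (F := fun (τ : ℝ) x => ‖((τ - t)⁻¹ : ℝ) * (gaussC τ x - gaussC t x) - dgaussC t x‖)
    (fun x => 2 * (C * Real.exp (-b * ‖x‖ ^ 2))) ?_ ?_ ?_ ?_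
  · simpa using key
  · filter_upwards [hI'] with τ hτ
    have hτ0 : 0 < τ := by linarith [hτ.1]
    exact ((((gaussDecay_gaussC hτ0).sub (gaussDecay_gaussC ht)).const_mul _).sub
      (gaussDecay_dgaussC ht)).1.norm.aestronglyMeasurable
  · filter_upwards [hI', self_mem_nhdsWithin] with τ hτ hne
    refine ae_of_all _ fun x => ?_
    have hm := (convex_Ioo (t / 2) (2 * t)).norm_image_sub_le_of_norm_hasDerivWithin_le
      (f := fun τ => gauss τ x) (f' := fun τ => dgauss τ x)
      (fun σ hσ => (hasDerivAt_gauss (by linarith [hσ.1]) x).hasDerivWithinAt)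
      (fun σ hσ => h σ hσ x) htI hτ
    have hpos : 0 < ‖τ - t‖ := norm_pos_iff.2 (sub_ne_zero.2 hne)
    rw [norm_norm, two_mul]
    refine (norm_sub_le _ _).trans (add_le_add ?_ ?_)
    · rw [gaussC, gaussC, ← Complex.ofReal_sub, ← Complex.ofReal_mul, Complex.norm_real, norm_mul,
        norm_inv, inv_mul_le_iff₀ hpos, mul_comm]
      exact hm
    · rw [dgaussC, Complex.norm_real]
      exact h t htI x
  · exact ((integrable_exp_neg hb).const_mul C).const_mul 2
  · refine ae_of_all _ fun x => ?_
    have h1 := (hasDerivAt_iff_tendsto_slope.1 (hasDerivAt_gauss ht x))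
    have h2 := (h1.sub_const (dgauss t x)).norm
    rw [sub_self, norm_zero] at h2
    refine h2.congr fun τ => ?_
    rw [gaussC, gaussC, dgaussC, ← Complex.ofReal_sub, ← Complex.ofReal_mul, ← Complex.ofReal_sub,
      Complex.norm_real, slope_def_field, div_eq_inv_mul]

/-- The heat semigroup of `ℝⁿ` on `L²` (and `0` for `t ≤ 0`). -/
def heatL (n : ℕ) (t : ℝ) : L2 n →L[ℂ] L2 n :=
  if h : 0 < t then convL (gaussC t) (gaussDecay_gaussC h) else 0

lemma heatL_of_pos {t : ℝ} (ht : 0 < t) :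
    heatL n t = convL (gaussC t) (gaussDecay_gaussC ht) := dif_pos ht

lemma heatL_ae {t : ℝ} (ht : 0 < t) (f : L2 n) : heatL n t f =ᵐ[volume] euclHeat t f := by
  rw [heatL_of_pos ht]
  exact convL_ae _ _ f

lemma norm_heatL_apply_le {t : ℝ} (ht : 0 < t) (f : L2 n) : ‖heatL n t f‖ ≤ ‖f‖ := by
  rw [heatL_of_pos ht]
  refine (norm_convL_apply_le _ _ f).trans (le_of_eq ?_)
  have : ∀ z : E n, ‖gaussC t z‖ = gauss t z := fun z => by
    rw [gaussC, Complex.norm_real, Real.norm_of_nonneg (gauss_pos ht z).le]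
  simp_rw [this]
  rw [integral_gauss ht, one_mul]

lemma hasDerivAt_heatL {t : ℝ} (ht : 0 < t) (f : L2 n) :
    HasDerivAt (fun τ => heatL n τ f) (convL (dgaussC t) (gaussDecay_dgaussC ht) f) t := by
  rw [hasDerivAt_iff_tendsto_slope, tendsto_iff_norm_sub_tendsto_zero]
  have h1 := (tendsto_integral_norm_slope_gaussC (n := n) ht).mul_const ‖f‖
  rw [zero_mul] at h1
  refine squeeze_zero' (Eventually.of_forall fun _ => norm_nonneg _) ?_ h1
  have hI' : ∀ᶠ τ in 𝓝[≠] t, 0 < τ := mem_nhdsWithin_of_mem_nhds (lt_mem_nhds ht)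
  filter_upwards [hI'] with τ hτ
  rw [slope_def_module, heatL_of_pos hτ, heatL_of_pos ht, ← convL_sub, ← convL_real_mul,
    ← convL_sub]
  exact norm_convL_apply_le _ _ f

lemma tendsto_euclHeat {f : E n → ℂ} (hf : Integrable f) (hc : Continuous f) (x : E n) :
    Tendsto (fun t => euclHeat t f x) (𝓝[>] 0) (𝓝 (f x)) := by
  have h := Real.tendsto_integral_gaussian_smul' hf (hc.continuousAt (x := x))
  -- In `Real.tendsto_integral_gaussian_smul'` the Gaussian has exponent `-π² c |x - y|²`, so `c = 1
  -- / (4π² t)`.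
  have hlim : Tendsto (fun t : ℝ => (4 * Real.pi ^ 2)⁻¹ * t⁻¹) (𝓝[>] 0) atTop :=
    tendsto_inv_nhdsGT_zero.const_mul_atTop (by positivity)
  refine (h.comp hlim).congr' ?_
  filter_upwards [self_mem_nhdsWithin] with t ht
  have ht : 0 < t := ht
  rw [Function.comp_apply, euclHeat, conv]
  refine integral_congr_ae (ae_of_all _ fun y => ?_)
  simp only [smul_eq_mul]
  congr 1
  have e1 : (Real.pi * (((4 * Real.pi ^ 2)⁻¹ * t⁻¹ : ℝ) : ℂ)) = (((4 * Real.pi * t)⁻¹ : ℝ) : ℂ) := by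
    rw [← Complex.ofReal_mul]
    congr 1
    field_simp
  have e2 : ((Module.finrank ℝ (E n) : ℂ) / 2) = (((n : ℝ) / 2 : ℝ) : ℂ) := by simp
  have e3 : (-(Real.pi : ℂ) ^ 2 * (((4 * Real.pi ^ 2)⁻¹ * t⁻¹ : ℝ) : ℂ) * (‖x - y‖ : ℂ) ^ 2) =
      ((-(1 / (4 * t)) * ‖x - y‖ ^ 2 : ℝ) : ℂ) := by
    have hp : (Real.pi : ℂ) ≠ 0 := by exact_mod_cast Real.pi_ne_zero
    have : (t : ℂ) ≠ 0 := by exact_mod_cast ht.ne'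
    push_cast
    field_simp
  rw [e1, e2, e3, ← Complex.ofReal_cpow (by positivity), ← Complex.ofReal_exp,
    ← Complex.ofReal_mul, gaussC, gauss, Real.inv_rpow (by positivity)]

lemma norm_euclHeat_le {t : ℝ} (ht : 0 < t) {f : E n → ℂ} {K : ℝ} (hK : ∀ x, ‖f x‖ ≤ K)
    (x : E n) : ‖euclHeat t f x‖ ≤ K := by
  have hi : Integrable (fun y => gauss t (x - y) * K) volume :=
    ((integrable_gauss ht).comp_sub_left x).mul_const K
  refine (norm_integral_le_of_norm_le hi (ae_of_all _ fun y => ?_)).trans (le_of_eq ?_)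
  · rw [norm_mul, gaussC, Complex.norm_real, Real.norm_of_nonneg (gauss_pos ht _).le]
    exact mul_le_mul_of_nonneg_left (hK y) (gauss_pos ht _).le
  · rw [integral_mul_const, integral_sub_left_eq_self (fun y => gauss t y) volume x,
      integral_gauss ht, one_mul]

/-- For a contraction `T`, `‖Tf - f‖² ≤ 2(‖f‖² - Re⟨f, Tf⟩)`, so it suffices that the inner products
converge. This follows from pointwise convergence, dominated on the compact support of `f`. -/
lemma tendsto_heatL_of_continuous {f : E n → ℂ} (hc : Continuous f) (hs : HasCompactSupport f)
    (hf : MemLp f 2 volume) : Tendsto (fun t => heatL n t hf.toLp) (𝓝[>] 0) (𝓝 hf.toLp) := by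
  obtain ⟨K, hK⟩ := hs.exists_bound_of_continuous hc
  have hfi : Integrable f volume := hc.integrable_of_hasCompactSupport hs
  have hinner : Tendsto (fun t => inner ℂ hf.toLp (heatL n t hf.toLp)) (𝓝[>] 0)
      (𝓝 (inner ℂ hf.toLp hf.toLp)) := by
    simp_rw [L2.inner_def]
    have e : ∫ x, inner ℂ ((hf.toLp : L2 n) x) ((hf.toLp : L2 n) x) = ∫ x, inner ℂ (f x) (f x) := by
      refine integral_congr_ae ?_
      filter_upwards [hf.coeFn_toLp] with x hx
      rw [hx]
    have e' : ∀ᶠ t in 𝓝[>] (0 : ℝ), ∫ x, inner ℂ (f x) (euclHeat t f x) =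
        ∫ x, inner ℂ ((hf.toLp : L2 n) x) (heatL n t hf.toLp x) := by
      filter_upwards [self_mem_nhdsWithin] with t ht
      refine integral_congr_ae ?_
      filter_upwards [hf.coeFn_toLp, heatL_ae ht hf.toLp] with x hx h2
      rw [h2, hx]
      exact congrArg (inner ℂ (f x)) (congrFun (conv_congr hf.coeFn_toLp.symm) x)
    rw [e]
    refine Tendsto.congr' e' ?_
    refine tendsto_integral_filter_of_dominated_convergence (fun x => ‖f x‖ * K) ?_ ?_
      (hfi.norm.mul_const K) (ae_of_all _ fun x => ?_)
    · filter_upwards [self_mem_nhdsWithin] with t ht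
      exact hf.1.inner (conv_aesm (gaussDecay_gaussC ht).1 hf.1)
    · filter_upwards [self_mem_nhdsWithin] with t ht
      refine ae_of_all _ fun x => (norm_inner_le_norm _ _).trans ?_
      exact mul_le_mul_of_nonneg_left (norm_euclHeat_le ht hK x) (norm_nonneg _)
    · exact tendsto_const_nhds.inner (tendsto_euclHeat hfi hc x)
  rw [tendsto_iff_norm_sub_tendsto_zero]
  have h2 : Tendsto (fun t => √(2 * (‖hf.toLp‖ ^ 2 -
      RCLike.re (inner ℂ hf.toLp (heatL n t hf.toLp))))) (𝓝[>] 0) (𝓝 0) := by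
    have h3 := ((((RCLike.continuous_re (K := ℂ)).tendsto _).comp hinner).const_sub
      (‖hf.toLp‖ ^ 2)).const_mul 2
    rw [inner_self_eq_norm_sq, sub_self, mul_zero] at h3
    have h4 := (Real.continuous_sqrt.tendsto _).comp h3
    rw [Real.sqrt_zero] at h4
    exact h4
  refine squeeze_zero' (Eventually.of_forall fun _ => norm_nonneg _) ?_ h2
  filter_upwards [self_mem_nhdsWithin] with t ht
  refine Real.le_sqrt_of_sq_le ?_
  rw [@norm_sub_sq ℂ, inner_re_symm]
  have := pow_le_pow_left₀ (norm_nonneg _) (norm_heatL_apply_le ht hf.toLp) 2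
  linarith

lemma tendsto_heatL (f : L2 n) : Tendsto (fun t => heatL n t f) (𝓝[>] 0) (𝓝 f) := by
  rw [Metric.tendsto_nhds]
  intro ε hε
  obtain ⟨g, hgs, hfg, hgc, hgL⟩ := (Lp.memLp f).exists_hasCompactSupport_eLpNorm_sub_le
    (by norm_num) (ε := ENNReal.ofReal (ε / 4)) (by simp [hε])
  have hd : ‖f - hgL.toLp‖ ≤ ε / 4 := by
    rw [Lp.norm_def, eLpNorm_congr_ae (Lp.coeFn_sub _ _)]
    refine ENNReal.toReal_le_of_le_ofReal (by positivity) (le_trans (le_of_eq ?_) hfg)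
    refine eLpNorm_congr_ae ?_
    filter_upwards [hgL.coeFn_toLp] with x hx
    rw [Pi.sub_apply, Pi.sub_apply, hx]
  filter_upwards [(Metric.tendsto_nhds.1 (tendsto_heatL_of_continuous hgc hgs hgL)) (ε / 4)
    (by positivity), self_mem_nhdsWithin] with t h1 ht
  rw [dist_eq_norm] at h1 ⊢
  have h2 : heatL n t f - f = heatL n t (f - hgL.toLp) + (heatL n t hgL.toLp - hgL.toLp) -
      (f - hgL.toLp) := by rw [map_sub]; abel
  have h3 := norm_heatL_apply_le ht (f - hgL.toLp)
  rw [h2]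
  have h4 := norm_sub_le (heatL n t (f - hgL.toLp) + (heatL n t hgL.toLp - hgL.toLp))
    (f - hgL.toLp)
  have h5 := norm_add_le (heatL n t (f - hgL.toLp)) (heatL n t hgL.toLp - hgL.toLp)
  linarith

/-! ### The heat semigroup on half-spaces by reflection -/

lemma norm_toLp_indicator_le {S : Set (E n)} (hS : MeasurableSet S) (f : L2 n) :
    ‖((Lp.memLp f).indicator hS).toLp‖ ≤ 1 * ‖f‖ := by
  rw [one_mul, Lp.norm_toLp, Lp.norm_def]
  exact ENNReal.toReal_mono (Lp.eLpNorm_ne_top f) (eLpNorm_indicator_le _)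

/-- Restriction to a set, on `L²`. -/
def indL (S : Set (E n)) (hS : MeasurableSet S) : L2 n →L[ℂ] L2 n :=
  LinearMap.mkContinuous
    { toFun := fun f => ((Lp.memLp f).indicator hS).toLp
      map_add' := fun f g => by
        rw [← MemLp.toLp_add]
        refine MemLp.toLp_congr _ _ ?_
        filter_upwards [Lp.coeFn_add f g] with x hx
        by_cases hxS : x ∈ S
        · simp only [Set.indicator_of_mem hxS, Pi.add_apply, hx]
        · simp only [Set.indicator_of_notMem hxS, Pi.add_apply, add_zero]
      map_smul' := fun c f => by
        rw [RingHom.id_apply, ← MemLp.toLp_const_smul]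
        refine MemLp.toLp_congr _ _ ?_
        filter_upwards [Lp.coeFn_smul c f] with x hx
        by_cases hxS : x ∈ S
        · simp only [Set.indicator_of_mem hxS, Pi.smul_apply, hx]
        · simp only [Set.indicator_of_notMem hxS, Pi.smul_apply, smul_zero] }
    1 fun f => norm_toLp_indicator_le hS f

lemma indL_ae (S : Set (E n)) (hS : MeasurableSet S) (f : L2 n) :
    indL S hS f =ᵐ[volume] S.indicator f := by
  have h : indL S hS f = ((Lp.memLp f).indicator hS).toLp := rfl
  rw [h]
  exact MemLp.coeFn_toLp _

section

variable [NeZero n]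

/-- The extension `halfExt`, on `L²`. -/
def extL (s : ℝ) (b : ℂ) : L2 n →L[ℂ] L2 n :=
  indL (half n s) (measurableSet_half s) +
    b • ((Lp.compMeasurePreservingₗᵢ ℂ (refl n) (refl n).measurePreserving).toContinuousLinearMap ∘L
      indL (half n s) (measurableSet_half s))

lemma extL_ae (s : ℝ) (b : ℂ) (f : L2 n) : extL s b f =ᵐ[volume] halfExt s b f := by
  set g := indL (half n s) (measurableSet_half s) f with hg
  have h0 : extL s b f = g + b • Lp.compMeasurePreserving (refl n) (refl n).measurePreserving g :=
    rfl
  rw [h0]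
  have h1 := indL_ae (half n s) (measurableSet_half s) f
  filter_upwards [Lp.coeFn_add g
      (b • Lp.compMeasurePreserving (refl n) (refl n).measurePreserving g),
    Lp.coeFn_smul b (Lp.compMeasurePreserving (refl n) (refl n).measurePreserving g),
    Lp.coeFn_compMeasurePreserving g (refl n).measurePreserving, h1,
    (refl n).measurePreserving.quasiMeasurePreserving.ae h1] with x h2 h3 h4 h5 h6
  rw [h2, Pi.add_apply, h3, Pi.smul_apply, h4, Function.comp_apply, h5, h6, smul_eq_mul, halfExt]

lemma memLp_halfExt (s : ℝ) (b : ℂ) (f : L2 n) : MemLp (halfExt s b f) 2 volume :=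
  (Lp.memLp _).ae_eq (extL_ae s b f)

/-- The element of `L²` that is `w 1` on the upper and `w (-1)` on the lower half-space. -/
def glueL (w : ℝ → L2 n) : L2 n :=
  indL (half n 1) (measurableSet_half 1) (w 1) +
    indL (half n (-1)) (measurableSet_half (-1)) (w (-1))

lemma glueL_ae (w : ℝ → L2 n) {s : ℝ} (hs : s = 1 ∨ s = -1) :
    glueL w =ᵐ[volume.restrict (half n s)] w s := by
  refine (ae_restrict_iff' (measurableSet_half s)).2 ?_
  filter_upwards [Lp.coeFn_add (indL (half n 1) (measurableSet_half 1) (w 1))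
    (indL (half n (-1)) (measurableSet_half (-1)) (w (-1))),
    indL_ae (half n 1) (measurableSet_half 1) (w 1),
    indL_ae (half n (-1)) (measurableSet_half (-1)) (w (-1))] with x h1 h2 h3 hx
  have h4 := Set.disjoint_left.1 (disjoint_half (n := n) s) hx
  rw [glueL, h1, Pi.add_apply, h2, h3]
  rcases hs with rfl | rfl
  · rw [Set.indicator_of_mem hx, Set.indicator_of_notMem h4, add_zero]
  · rw [neg_neg] at h4
    rw [Set.indicator_of_mem hx, Set.indicator_of_notMem h4, zero_add]

lemma ae_of_ae_half {p : E n → Prop}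
    (h : ∀ s : ℝ, s = 1 ∨ s = -1 → ∀ᵐ x ∂volume.restrict (half n s), p x) : ∀ᵐ x, p x := by
  have h1 := (ae_restrict_iff' (measurableSet_half 1)).1 (h 1 (Or.inl rfl))
  have h2 := (ae_restrict_iff' (measurableSet_half (-1))).1 (h (-1) (Or.inr rfl))
  filter_upwards [h1, h2, ae_mem_half (n := n) one_ne_zero] with x hx hx' h3
  exact h3.elim hx hx'

lemma glueL_extL (b : ℝ → ℂ) (f : L2 n) : glueL (fun s => extL s (b s) f) = f := by
  refine Lp.ext (ae_of_ae_half fun s hs => ?_)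
  filter_upwards [glueL_ae (fun s => extL s (b s) f) hs, ae_restrict_of_ae (extL_ae s (b s) f),
    ae_restrict_mem (measurableSet_half s)] with x h1 h2 hx
  rw [h1, h2, halfExt_of_mem _ _ hx]

/-- The heat semigroup on the half-spaces, for the parities `b 1` and `b (-1)`. -/
def halfHeatL (b : ℝ → ℂ) (t : ℝ) : L2 n →L[ℂ] L2 n :=
  indL (half n 1) (measurableSet_half 1) ∘L heatL n t ∘L extL 1 (b 1) +
    indL (half n (-1)) (measurableSet_half (-1)) ∘L heatL n t ∘L extL (-1) (b (-1))

lemma halfHeatL_apply (b : ℝ → ℂ) (t : ℝ) (f : L2 n) :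
    halfHeatL b t f = glueL fun s => heatL n t (extL s (b s) f) := rfl

lemma halfHeatL_ae (b : ℝ → ℂ) {t : ℝ} (ht : 0 < t) (f : L2 n) {s : ℝ} (hs : s = 1 ∨ s = -1) :
    halfHeatL b t f =ᵐ[volume.restrict (half n s)] euclHeat t (halfExt s (b s) f) := by
  rw [halfHeatL_apply]
  refine (glueL_ae _ hs).trans (ae_restrict_of_ae ((heatL_ae ht _).trans ?_))
  rw [euclHeat, conv_congr (extL_ae s (b s) f)]

lemma tendsto_halfHeatL (b : ℝ → ℂ) (f : L2 n) :
    Tendsto (fun t => halfHeatL b t f) (𝓝[>] 0) (𝓝 f) := by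
  conv_rhs => rw [← glueL_extL b f]
  exact (((indL _ _).continuous.tendsto _).comp (tendsto_heatL _)).add
    (((indL _ _).continuous.tendsto _).comp (tendsto_heatL _))

lemma hasDerivAt_halfHeatL (b : ℝ → ℂ) {t : ℝ} (ht : 0 < t) (f : L2 n) :
    HasDerivAt (fun τ => halfHeatL b τ f)
      (glueL fun s => convL (dgaussC t) (gaussDecay_dgaussC ht) (extL s (b s) f)) t := by
  have h : ∀ (A : L2 n →L[ℂ] L2 n) (g : L2 n), HasDerivAt (fun τ => A (heatL n τ g))
      (A (convL (dgaussC t) (gaussDecay_dgaussC ht) g)) t := fun A g =>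
    (A.restrictScalars ℝ).hasFDerivAt.comp_hasDerivAt t (hasDerivAt_heatL ht g)
  exact (h (indL (half n 1) (measurableSet_half 1)) (extL 1 (b 1) f)).fun_add
    (h (indL (half n (-1)) (measurableSet_half (-1))) (extL (-1) (b (-1)) f))

/-- The operator that acts on the half-space with sign `s` as the Neumann Laplacian if `b s = 1`
and as the Dirichlet Laplacian if `b s = -1`. -/
def halfLaplace (b : ℝ → ℂ) (u g : E n → ℂ) : Prop :=
  ∀ s : ℝ, s = 1 ∨ s = -1 → (b s = 1 → neumannOn (half n s) u g) ∧
    (b s = -1 → dirichletOn (half n s) u g)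

lemma refl_single : refl n (EuclideanSpace.single (lastIdx n) (1 : ℝ)) =
    -EuclideanSpace.single (lastIdx n) (1 : ℝ) := by
  ext i
  by_cases hi : i = lastIdx n
  · subst hi; rw [refl_last]; simp
  · rw [refl_of_ne _ hi]; simp [hi]

lemma refl_eq_self {x : E n} (hx : x (lastIdx n) = 0) : refl n x = x := by
  ext i
  by_cases hi : i = lastIdx n
  · subst hi; rw [refl_last, hx, neg_zero]
  · exact refl_of_ne x hi

/-- The chain rule at a fixed point of the reflection, which reverses the normal vector: the normal
derivative of an even function equals its own negative. -/
lemma partialD_last_eq_zero {u : E n → ℂ} (hu : Differentiable ℝ u)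
    (h : ∀ x, u (refl n x) = u x) {x : E n} (hx : x (lastIdx n) = 0) :
    partialD (lastIdx n) u x = 0 := by
  have h1 : HasFDerivAt (fun x => u (refl n x))
      ((fderiv ℝ u x).comp ((refl n).toContinuousLinearEquiv : E n →L[ℝ] E n)) x := by
    have h2 : HasFDerivAt u (fderiv ℝ u x) (refl n x) := by
      rw [refl_eq_self hx]; exact (hu x).hasFDerivAt
    exact h2.comp x ((refl n).toContinuousLinearEquiv : E n →L[ℝ] E n).hasFDerivAt
  have h3 : (fun x => u (refl n x)) = u := funext h
  rw [h3] at h1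
  have h4 := congrArg (fun A => A (EuclideanSpace.single (lastIdx n) (1 : ℝ))) h1.fderiv
  have h5 : fderiv ℝ u x (EuclideanSpace.single (lastIdx n) (1 : ℝ)) =
      fderiv ℝ u x (refl n (EuclideanSpace.single (lastIdx n) (1 : ℝ))) := h4
  rw [refl_single, map_neg] at h5
  rw [partialD]
  exact self_eq_neg.1 h5

/-- On each half-space the flow agrees with a function smooth on all of `ℝⁿ` and of parity `b s`.
Evenness gives the Neumann condition and oddness the Dirichlet condition, while the heat equation
for the kernel identifies the Laplacian with the time derivative. -/
lemma halfLaplace_halfHeatL {b : ℝ → ℂ} (hb : ∀ s, b s = 1 ∨ b s = -1) {t : ℝ} (ht : 0 < t)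
    (f : L2 n) : halfLaplace b (halfHeatL b t f)
      ((-(glueL fun s => convL (dgaussC t) (gaussDecay_dgaussC ht) (extL s (b s) f)) : L2 n)) := by
  intro s hs
  have ha : 0 < 1 / (4 * t) := by positivity
  have hp := polyGauss_gaussC (n := n) t
  have hF := memLp_halfExt s (b s) f
  have hFp := MemLp.polyInt hF
  have hbb : b s * b s = 1 := by rcases hb s with h | h <;> rw [h] <;> norm_num
  have hu : ContDiff ℝ ∞ (euclHeat t (halfExt s (b s) f)) := hp.contDiff_conv ha hFp
  have hL := memLp_conv (hp.gaussDecay ha) hF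
  have hL' : ∀ i, MemLp (partialD i (euclHeat t (halfExt s (b s) f))) 2 volume := fun i => by
    rw [euclHeat, hp.partialD_conv ha hFp]
    exact memLp_conv ((hp.differentiable_and.2 i).gaussDecay ha) hF
  have hL'' : ∀ i, MemLp (partialD i (partialD i (euclHeat t (halfExt s (b s) f)))) 2 volume :=
    fun i => by
      rw [euclHeat, hp.partialD_conv ha hFp, (hp.differentiable_and.2 i).partialD_conv ha hFp]
      exact memLp_conv (((hp.differentiable_and.2 i).differentiable_and.2 i).gaussDecay ha) hF
  have hpar := euclHeat_halfExt_refl (n := n) s (t := t) (f := f) hbb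
  have e1 := (halfHeatL_ae b ht f hs).symm
  have e2 : (fun x => -∑ i, partialD i (partialD i (euclHeat t (halfExt s (b s) f))) x)
      =ᵐ[volume.restrict (half n s)]
      (-(glueL fun s => convL (dgaussC t) (gaussDecay_dgaussC ht) (extL s (b s) f)) : L2 n) := by
    filter_upwards [ae_restrict_of_ae (Lp.coeFn_neg (glueL fun s =>
        convL (dgaussC t) (gaussDecay_dgaussC ht) (extL s (b s) f))),
      glueL_ae (fun s => convL (dgaussC t) (gaussDecay_dgaussC ht) (extL s (b s) f)) hs,
      ae_restrict_of_ae (convL_ae (dgaussC t) (gaussDecay_dgaussC ht) (extL s (b s) f))]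
      with x h1 h2 h3
    rw [h1, Pi.neg_apply, h2, h3, sum_partialD_euclHeat ht hFp, conv_congr (extL_ae s (b s) f)]
  refine ⟨fun hbs => formOperator_congr (fun _ _ _ h h' => h.congr h')
    (neumannOn_half hs hu hL hL' hL'' fun x hx => ?_) e1 e2,
    fun hbs => formOperator_congr (fun _ _ _ h h' => h.congr h')
    (dirichletOn_half hs hu hL hL' hL'' fun x hx => ?_) e1 e2⟩
  · refine partialD_last_eq_zero (hu.differentiable (by simp)) (fun y => ?_) hx
    rw [hpar, hbs, one_mul]
  · have h := hpar x
    rw [refl_eq_self hx] at h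
    rw [hbs, neg_one_mul] at h
    rw [hbs]
    exact self_eq_neg.1 h

lemma isHeatSemigroup_halfHeatL {b : ℝ → ℂ} (hb : ∀ s, b s = 1 ∨ b s = -1) :
    IsHeatSemigroup (halfLaplace b) (halfHeatL (n := n) b) := fun f =>
  ⟨tendsto_halfHeatL b f, fun t ht => ⟨_, halfLaplace_halfHeatL hb ht f, by
    rw [neg_neg]; exact hasDerivAt_halfHeatL b ht f⟩⟩

/-! ### The heat kernel on half-spaces -/

/-- The heat kernel of the half-space with sign `s`, for the parity `b`. -/
def halfKernelOn (s : ℝ) (b : ℂ) (t : ℝ) (x y : E n) : ℂ :=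
  (half n s ×ˢ half n s).indicator
    (fun p => gaussC t (p.1 - p.2) + b * gaussC t (p.1 - refl n p.2)) (x, y)

/-- The heat kernel of the half-spaces, for the parities `b 1` and `b (-1)`. -/
def halfKernel (b : ℝ → ℂ) (t : ℝ) (x y : E n) : ℂ :=
  halfKernelOn 1 (b 1) t x y + halfKernelOn (-1) (b (-1)) t x y

lemma measurable_halfKernel (b : ℝ → ℂ) (t : ℝ) :
    Measurable (Function.uncurry (halfKernel (n := n) b t)) := by
  have hg : Continuous (gaussC t : E n → ℂ) := Complex.continuous_ofReal.comp (continuous_gauss t)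
  have h : ∀ (s : ℝ) (b : ℂ), Measurable fun p : E n × E n => halfKernelOn s b t p.1 p.2 :=
    fun s b => by
      refine Measurable.indicator (Continuous.measurable ?_)
        ((measurableSet_half s).prod (measurableSet_half s))
      exact (hg.comp (continuous_fst.sub continuous_snd)).add (continuous_const.mul
        (hg.comp (continuous_fst.sub ((refl n).continuous.comp continuous_snd))))
  exact (h 1 (b 1)).add (h (-1) (b (-1)))

lemma halfKernel_of_mem (b : ℝ → ℂ) (t : ℝ) {s : ℝ} (hs : s = 1 ∨ s = -1) {x : E n}
    (hx : x ∈ half n s) (y : E n) : halfKernel b t x y =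
      (half n s).indicator (fun y => gaussC t (x - y) + b s * gaussC t (x - refl n y)) y := by
  have h4 := Set.disjoint_left.1 (disjoint_half (n := n) s) hx
  have h5 : ∀ b, halfKernelOn s b t x y =
      (half n s).indicator (fun y => gaussC t (x - y) + b * gaussC t (x - refl n y)) y := fun b => by
    by_cases hy : y ∈ half n s
    · rw [halfKernelOn, Set.indicator_of_mem (Set.mk_mem_prod hx hy), Set.indicator_of_mem hy]
    · rw [halfKernelOn, Set.indicator_of_notMem (fun h => hy h.2), Set.indicator_of_notMem hy]
  have h6 : ∀ b, halfKernelOn (-s) b t x y = 0 := fun b =>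
    Set.indicator_of_notMem (fun h => h4 h.1) _
  rw [halfKernel]
  rcases hs with rfl | rfl
  · rw [h5, h6, add_zero]
  · rw [neg_neg] at h6
    rw [h5, h6, zero_add]

/-- Method of images: the substitution `y ↦ refl n y` moves the reflection from the kernel to the
function. -/
lemma integral_halfKernel (b : ℝ → ℂ) {t : ℝ} (ht : 0 < t) {s : ℝ} (hs : s = 1 ∨ s = -1)
    {x : E n} (hx : x ∈ half n s) {f : E n → ℂ} (hf : PolyInt f) :
    Integrable (fun y => halfKernel b t x y * f y) ∧
      ∫ y, halfKernel b t x y * f y = euclHeat t (halfExt s (b s) f) x := by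
  have hi := hf.indicator (measurableSet_half (n := n) s)
  have hk := gaussDecay_gaussC (n := n) ht
  have i1 := hk.integrable_conv hi x
  have i2 := hk.integrable_conv (hi.comp_isometry (refl n)) x
  have hmp := (refl n).measurePreserving
  have i3 := (hmp.integrable_comp_emb measurableEmbedding_refl).2 i2
  have e3 := hmp.integral_comp measurableEmbedding_refl
    (fun y => gaussC t (x - y) * (half n s).indicator f (refl n y))
  simp only [Function.comp_def, refl_refl] at i3 e3
  have e : (fun y => halfKernel b t x y * f y) = fun y =>
      gaussC t (x - y) * (half n s).indicator f y +
        b s * (gaussC t (x - refl n y) * (half n s).indicator f y) := by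
    ext y
    rw [halfKernel_of_mem b t hs hx]
    by_cases hy : y ∈ half n s
    · simp only [Set.indicator_of_mem hy]; ring
    · simp only [Set.indicator_of_notMem hy]; ring
  rw [e]
  refine ⟨i1.add (i3.const_mul _), ?_⟩
  rw [integral_add i1 (i3.const_mul _), integral_const_mul, e3, euclHeat, conv,
    ← integral_const_mul, ← integral_add i1 (i2.const_mul _)]
  refine integral_congr_ae (ae_of_all _ fun y => ?_)
  simp only [halfExt]
  ring

lemma isHeatKernel_halfKernel {b : ℝ → ℂ} (hb : ∀ s, b s = 1 ∨ b s = -1) :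
    IsHeatKernel (halfLaplace b) (halfKernel (n := n) b) := by
  refine ⟨halfHeatL b, isHeatSemigroup_halfHeatL hb, fun t ht => ⟨measurable_halfKernel b t,
    fun f => ae_of_ae_half fun s hs => ?_⟩⟩
  filter_upwards [halfHeatL_ae b ht f hs, ae_restrict_mem (measurableSet_half s)] with x h1 hx
  obtain ⟨h2, h3⟩ := integral_halfKernel b ht hs hx (MemLp.polyInt (Lp.memLp f))
  exact ⟨h2, h1.trans h3.symm⟩

end

/-! ### Uniqueness of the heat semigroup -/

section Form

lemma partialD_sub {φ ψ : E n → ℂ} (hφ : Differentiable ℝ φ) (hψ : Differentiable ℝ ψ)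
    (i : Fin n) (x : E n) : partialD i (φ - ψ) x = partialD i φ x - partialD i ψ x := by
  rw [partialD, fderiv_sub (hφ x) (hψ x)]
  rfl

lemma IsTest.sub {Ω : Set (E n)} {φ ψ : E n → ℂ} (hφ : IsTest Ω φ) (hψ : IsTest Ω ψ) :
    IsTest Ω (φ - ψ) :=
  ⟨hφ.1.sub hψ.1, hφ.2.1.sub hψ.2.1,
    (tsupport_sub φ ψ).trans (Set.union_subset hφ.2.2 hψ.2.2)⟩

variable {Ω : Set (E n)} {u u' g g' : E n → ℂ} {G G' : Fin n → E n → ℂ}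

lemma IsW12.sub (h : IsW12 Ω u G) (h' : IsW12 Ω u' G') : IsW12 Ω (u - u') (G - G') := by
  refine ⟨h.1.sub h'.1, fun i => (h.2.1 i).sub (h'.2.1 i), fun φ hφ i => ?_⟩
  have hm := hφ.memLp.restrict Ω
  have hm' := (hφ.partialD i).memLp.restrict Ω
  simp only [Pi.sub_apply, sub_mul]
  rw [integral_sub (integrable_mul_of_memLp h.1 hm') (integrable_mul_of_memLp h'.1 hm'),
    integral_sub (integrable_mul_of_memLp (h.2.1 i) hm) (integrable_mul_of_memLp (h'.2.1 i) hm),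
    h.2.2 φ hφ i, h'.2.2 φ hφ i]
  ring

lemma tendsto_eLpNorm_sub {α : Type*} [MeasurableSpace α] {μ : Measure α} {F F' : ℕ → α → ℂ}
    {f f' : α → ℂ} (hF : ∀ k, MemLp (F k) 2 μ) (hF' : ∀ k, MemLp (F' k) 2 μ) (hf : MemLp f 2 μ)
    (hf' : MemLp f' 2 μ) (h : Tendsto (fun k => eLpNorm (F k - f) 2 μ) atTop (𝓝 0))
    (h' : Tendsto (fun k => eLpNorm (F' k - f') 2 μ) atTop (𝓝 0)) :
    Tendsto (fun k => eLpNorm ((F k - F' k) - (f - f')) 2 μ) atTop (𝓝 0) := by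
  have h2 := h.add h'
  rw [add_zero] at h2
  refine tendsto_of_tendsto_of_tendsto_of_le_of_le tendsto_const_nhds h2 (fun _ => zero_le)
    fun k => ?_
  simp only
  rw [show F k - F' k - (f - f') = (F k - f) - (F' k - f') by abel]
  exact eLpNorm_sub_le ((hF k).sub hf).1 ((hF' k).sub hf').1 (by norm_num)

lemma IsW012.sub (h : IsW012 Ω u G) (h' : IsW012 Ω u' G') : IsW012 Ω (u - u') (G - G') := by
  obtain ⟨h1, φ, hφ, h2, h3⟩ := h
  obtain ⟨h1', ψ, hψ, h2', h3'⟩ := h'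
  refine ⟨h1.sub h1', fun k => φ k - ψ k, fun k => (hφ k).sub (hψ k),
    tendsto_eLpNorm_sub (fun k => (hφ k).memLp.restrict Ω) (fun k => (hψ k).memLp.restrict Ω)
      h1.1 h1'.1 h2 h2', fun i => ?_⟩
  have e : ∀ k, partialD i (φ k - ψ k) = partialD i (φ k) - partialD i (ψ k) := fun k =>
    funext fun x => partialD_sub (hφ k).differentiable (hψ k).differentiable i x
  simp_rw [e]
  exact tendsto_eLpNorm_sub (fun k => ((hφ k).partialD i).memLp.restrict Ω)
    (fun k => ((hψ k).partialD i).memLp.restrict Ω) (h1.2.1 i) (h1'.2.1 i) (h3 i) (h3' i)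

variable {V : (E n → ℂ) → (Fin n → E n → ℂ) → Prop}

lemma formOperator_sub (hV : ∀ u G, V u G → IsW12 Ω u G)
    (hsub : ∀ u G u' G', V u G → V u' G' → V (u - u') (G - G'))
    (h : formOperator Ω V u g) (h' : formOperator Ω V u' g') :
    formOperator Ω V (u - u') (g - g') := by
  obtain ⟨h1, G, h2, h3⟩ := h
  obtain ⟨h1', G', h2', h3'⟩ := h'
  refine ⟨h1.sub h1', _, hsub _ _ _ _ h2 h2', fun v H hv => ?_⟩
  have hw := hV _ _ hv
  have hi : ∀ {K : Fin n → E n → ℂ}, (∀ i, MemLp (K i) 2 (volume.restrict Ω)) →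
      Integrable (fun x => ∑ i, K i x * conj (H i x)) (volume.restrict Ω) := fun hK =>
    integrable_finsetSum _ fun i _ => integrable_mul_of_memLp (hK i) (MemLp.conj (hw.2.1 i))
  simp only [Pi.sub_apply, sub_mul, Finset.sum_sub_distrib]
  rw [integral_sub (hi (hV _ _ h2).2.1) (hi (hV _ _ h2').2.1),
    integral_sub (integrable_mul_of_memLp h1 (MemLp.conj hw.1))
      (integrable_mul_of_memLp h1' (MemLp.conj hw.1)), h3 v H hv, h3' v H hv]

lemma formOperator_re_nonneg (h : formOperator Ω V u g) :
    0 ≤ (∫ x in Ω, g x * conj (u x)).re := by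
  obtain ⟨-, G, h2, h3⟩ := h
  rw [← h3 u G h2]
  have : (fun x => ∑ i, G i x * conj (G i x)) =
      fun x => ((∑ i, ‖G i x‖ ^ 2 : ℝ) : ℂ) := by
    ext x
    push_cast
    exact Finset.sum_congr rfl fun i _ => by rw [Complex.mul_conj, Complex.normSq_eq_norm_sq]; simp
  rw [this, integral_complex_ofReal, Complex.ofReal_re]
  exact integral_nonneg fun x => Finset.sum_nonneg fun i _ => by positivity

end Form

section Semigroup

variable [NeZero n] {b : ℝ → ℂ}

lemma halfLaplace_sub {u u' g g' : L2 n} (h : halfLaplace b u g) (h' : halfLaplace b u' g') :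
    halfLaplace b (u - u' : L2 n) (g - g' : L2 n) := by
  intro s hs
  have e1 := ae_restrict_of_ae (s := half n s) (Lp.coeFn_sub u u').symm
  have e2 := ae_restrict_of_ae (s := half n s) (Lp.coeFn_sub g g').symm
  exact ⟨fun hb => formOperator_congr (fun _ _ _ h h' => h.congr h') (formOperator_sub
      (fun _ _ h => h) (fun _ _ _ _ h h' => h.sub h') ((h s hs).1 hb) ((h' s hs).1 hb)) e1 e2,
    fun hb => formOperator_congr (fun _ _ _ h h' => h.congr h') (formOperator_sub
      (fun _ _ h => h.1) (fun _ _ _ _ h h' => h.sub h') ((h s hs).2 hb) ((h' s hs).2 hb)) e1 e2⟩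

lemma integral_eq_add_half {f : E n → ℂ} (hf : Integrable f) :
    ∫ x, f x = (∫ x in half n 1, f x) + ∫ x in half n (-1), f x := by
  rw [← integral_add_compl (measurableSet_half 1) hf]
  congr 1
  refine setIntegral_congr_set ?_
  filter_upwards [ae_mem_half (n := n) one_ne_zero] with x hx
  refine propext ⟨fun h => hx.resolve_left h, fun h h' => ?_⟩
  exact Set.disjoint_left.1 (disjoint_half (n := n) 1) h' h

lemma halfLaplace_accretive (hb : ∀ s, b s = 1 ∨ b s = -1) {u g : L2 n}
    (h : halfLaplace b u g) : 0 ≤ inner ℝ u g := by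
  have hi : Integrable (fun x => g x * conj (u x)) :=
    integrable_mul_of_memLp (Lp.memLp g) (MemLp.conj (Lp.memLp u))
  have h1 : ∀ s : ℝ, s = 1 ∨ s = -1 → 0 ≤ (∫ x in half n s, g x * conj (u x)).re := fun s hs => by
    rcases hb s with h2 | h2
    · exact formOperator_re_nonneg ((h s hs).1 h2)
    · exact formOperator_re_nonneg ((h s hs).2 h2)
  have e : inner ℝ u g = (∫ x, g x * conj (u x)).re := by
    rw [L2.inner_def]
    have := integral_re hi
    simp only [RCLike.re_eq_complex_re] at this
    rw [← this]
    refine integral_congr_ae (ae_of_all _ fun x => ?_)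
    simp only [Complex.inner]
  rw [e, integral_eq_add_half hi, Complex.add_re]
  exact add_nonneg (h1 1 (Or.inl rfl)) (h1 (-1) (Or.inr rfl))

/-- Energy argument: the difference of two solutions solves the same equation, so by nonnegativity
of the form its squared norm is nonincreasing for positive times; it tends to `0` at time `0`. -/
lemma isHeatSemigroup_unique (hb : ∀ s, b s = 1 ∨ b s = -1) {T T' : ℝ → L2 n →L[ℂ] L2 n}
    (hT : IsHeatSemigroup (halfLaplace b) T) (hT' : IsHeatSemigroup (halfLaplace b) T') {t : ℝ}
    (ht : 0 < t) : T t = T' t := by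
  ext1 f
  obtain ⟨h0, h1⟩ := hT f
  obtain ⟨h0', h1'⟩ := hT' f
  have hd : ∀ τ : ℝ, 0 < τ → ∃ c ≤ 0, HasDerivAt (fun σ => ‖T σ f - T' σ f‖ ^ 2) c τ :=
    fun τ hτ => by
      obtain ⟨g, hg, hd⟩ := h1 τ hτ
      obtain ⟨g', hg', hd'⟩ := h1' τ hτ
      refine ⟨_, ?_, (hd.sub hd').norm_sq⟩
      have := halfLaplace_accretive hb (halfLaplace_sub hg hg')
      rw [show -g - -g' = -(g - g') by abel, inner_neg_right]
      simp only [Pi.sub_apply]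
      linarith
  have hanti : AntitoneOn (fun σ => ‖T σ f - T' σ f‖ ^ 2) (Set.Ioi 0) := by
    refine antitoneOn_of_deriv_nonpos (convex_Ioi 0) (fun τ hτ => ?_) (fun τ hτ => ?_)
      fun τ hτ => ?_
    · obtain ⟨c, -, hc⟩ := hd τ hτ
      exact hc.continuousAt.continuousWithinAt
    · rw [interior_Ioi] at hτ
      obtain ⟨c, -, hc⟩ := hd τ hτ
      exact hc.differentiableAt.differentiableWithinAt
    · rw [interior_Ioi] at hτ
      obtain ⟨c, hc0, hc⟩ := hd τ hτ
      rw [hc.deriv]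
      exact hc0
  have hlim : Tendsto (fun σ => ‖T σ f - T' σ f‖ ^ 2) (𝓝[>] 0) (𝓝 0) := by
    simpa using (h0.sub h0').norm.pow 2
  have hle : ‖T t f - T' t f‖ ^ 2 ≤ 0 := by
    refine ge_of_tendsto hlim ?_
    filter_upwards [Ioo_mem_nhdsGT ht] with σ hσ
    exact hanti hσ.1 ht hσ.2.le
  have : ‖T t f - T' t f‖ = 0 := by
    have := norm_nonneg (T t f - T' t f)
    nlinarith
  exact sub_eq_zero.1 (norm_eq_zero.1 this)

end Semigroup

/-! ### Uniqueness of kernels -/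

/-- Finite intersections of a countable basis. Countability allows a single exceptional null set of
`x` for all test sets at once. -/
lemma exists_countable_piSystem (n : ℕ) : ∃ P : Set (Set (E n)), P.Countable ∧ IsPiSystem P ∧
    (inferInstance : MeasurableSpace (E n)) = MeasurableSpace.generateFrom P := by
  have hB := TopologicalSpace.isBasis_countableBasis (E n)
  set B := TopologicalSpace.countableBasis (E n) with hBdef
  refine ⟨(fun F => ⋂₀ F) '' {F | F.Finite ∧ F ⊆ B},
    (Set.countable_ofPred_finite_subset (TopologicalSpace.countable_countableBasis _)).image _,
    ?_, le_antisymm ?_ ?_⟩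
  · rintro _ ⟨F, ⟨hF, hFB⟩, rfl⟩ _ ⟨G, ⟨hG, hGB⟩, rfl⟩ -
    exact ⟨F ∪ G, ⟨hF.union hG, Set.union_subset hFB hGB⟩, Set.sInter_union F G⟩
  · have e : (inferInstance : MeasurableSpace (E n)) = MeasurableSpace.generateFrom B :=
      (BorelSpace.measurable_eq (α := E n)).trans hB.borel_eq_generateFrom
    rw [e]
    refine MeasurableSpace.generateFrom_mono fun s hs => ⟨{s}, ⟨Set.finite_singleton s, ?_⟩, ?_⟩
    · simpa using hs
    · simp
  · refine MeasurableSpace.generateFrom_le ?_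
    rintro _ ⟨F, ⟨hF, hFB⟩, rfl⟩
    exact MeasurableSet.sInter hF.countable fun s hs => (hB.isOpen (hFB hs)).measurableSet

/-- The null set of `x` in the hypothesis depends on `f`. Testing with indicators of countably many
sets removes this dependence, and a π-λ argument then gives zero integrals of `q x` over all
measurable sets. -/
lemma kernel_ae_eq_zero {q : E n → E n → ℂ} (h : ∀ f : L2 n, ∀ᵐ x,
    Integrable (fun y => q x y * f y) ∧ ∫ y, q x y * f y = 0) : ∀ᵐ x, q x =ᵐ[volume] 0 := by
  have hS : ∀ S : Set (E n), MeasurableSet S → volume S ≠ ⊤ → ∀ᵐ x,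
      IntegrableOn (q x) S ∧ ∫ y in S, q x y = 0 := fun S hSm hSv => by
    filter_upwards [h (indicatorConstLp 2 hSm hSv 1)] with x hx
    have e : (fun y => q x y * (indicatorConstLp 2 hSm hSv (1 : ℂ) : L2 n) y) =ᵐ[volume]
        S.indicator (q x) := by
      filter_upwards [indicatorConstLp_coeFn (p := 2) (hs := hSm) (hμs := hSv) (c := (1 : ℂ))]
        with y hy
      rw [hy]
      by_cases hyS : y ∈ S <;> simp [hyS]
    rw [integrable_congr e, integral_congr_ae e, integrable_indicator_iff hSm,
      integral_indicator hSm] at hx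
    exact hx
  obtain ⟨P, hPc, hPi, hP⟩ := exists_countable_piSystem n
  have hPm : ∀ t ∈ P, MeasurableSet t := fun t ht => by
    have := MeasurableSpace.measurableSet_generateFrom ht
    rwa [← hP] at this
  -- Inside a ball `q x` is integrable, as complements and countable unions require.
  have hball : ∀ m : ℕ, ∀ᵐ x, ∀ᵐ y, y ∈ Metric.ball (0 : E n) m → q x y = 0 := fun m => by
    have hBm : MeasurableSet (Metric.ball (0 : E n) m) := Metric.isOpen_ball.measurableSet
    have hB := hS _ hBm measure_ball_lt_top.ne
    have hall := MeasurableSpace.ae_induction_on_inter (μ := (volume : Measure (E n)))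
      (C := fun x t => ∫ y in t, q x y ∂volume.restrict (Metric.ball 0 m) = 0) hP hPi
      (ae_of_all _ fun x => by simp) ?_ ?_ ?_
    · filter_upwards [hB, hall] with x hx hx'
      have := hx.1.ae_eq_zero_of_forall_setIntegral_eq_zero fun t ht _ => hx' ht
      exact (ae_restrict_iff' hBm).1 this
    · refine (ae_ball_iff hPc).2 fun t ht => ?_
      have hfin : volume (t ∩ Metric.ball (0 : E n) m) ≠ ⊤ :=
        measure_ne_top_of_subset Set.inter_subset_right measure_ball_lt_top.ne
      filter_upwards [hS _ ((hPm t ht).inter hBm) hfin] with x hx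
      rw [Measure.restrict_restrict (hPm t ht)]
      exact hx.2
    · filter_upwards [hB] with x hx t ht h0
      rw [setIntegral_compl ht hx.1, h0, hx.2, sub_zero]
    · filter_upwards [hB] with x hx f hd hm h0
      rw [integral_iUnion hm hd hx.1.integrableOn]
      simp [h0]
  filter_upwards [ae_all_iff.2 hball] with x hx
  filter_upwards [ae_all_iff.2 hx] with y hy
  obtain ⟨m, hm⟩ := exists_nat_gt ‖y‖
  exact hy m (by simpa using hm)

/-! ### The heat kernels of the Laplacians -/

variable [NeZero n]

/-- The chosen kernel and the explicit image kernel represent the same semigroup on `L²`, so for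
almost every `x` they agree for almost every `y`. This no longer refers to a function in `L²`, so
the identity extends to all functions of polynomial growth. -/
lemma actsByReflection_halfLaplace {b : ℝ → ℂ} (hb : ∀ s, b s = 1 ∨ b s = -1) :
    ActsByReflection (n := n) (halfLaplace b) b := by
  have hp : IsHeatKernel (halfLaplace b) (heatKernel (halfLaplace (n := n) b)) := by
    have hex : ∃ p, IsHeatKernel (halfLaplace (n := n) b) p := ⟨_, isHeatKernel_halfKernel hb⟩
    rw [heatKernel, dif_pos hex]
    exact hex.choose_spec
  obtain ⟨T, hT, hk⟩ := hp
  obtain ⟨T', hT', hk'⟩ := isHeatKernel_halfKernel (n := n) hb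
  intro t ht f hf s hs
  have hq := kernel_ae_eq_zero (n := n)
    (q := fun x y => heatKernel (halfLaplace b) t x y - halfKernel b t x y) fun g => by
      filter_upwards [(hk t ht).2 g, (hk' t ht).2 g] with x h1 h2
      simp only [sub_mul]
      refine ⟨h1.1.sub h2.1, ?_⟩
      rw [integral_sub h1.1 h2.1, ← h1.2, ← h2.2, isHeatSemigroup_unique hb hT hT' ht, sub_self]
  filter_upwards [hq] with x hx hxs
  rw [← (integral_halfKernel b ht hs hxs hf).2, heat]
  refine integral_congr_ae ?_
  filter_upwards [hx] with y hy
  rw [sub_eq_zero.1 hy]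

/-! ### The three Laplacians as choices of parities. -/

lemma laplaceN_eq : laplaceN n = halfLaplace fun _ => 1 := by
  ext u g
  simp only [laplaceN, halfLaplace, ← half_one, ← half_neg_one]
  constructor
  · rintro ⟨h1, h2⟩ s (rfl | rfl)
    · exact ⟨fun _ => h1, fun h => by norm_num at h⟩
    · exact ⟨fun _ => h2, fun h => by norm_num at h⟩
  · exact fun h => ⟨(h 1 (Or.inl rfl)).1 trivial, (h (-1) (Or.inr rfl)).1 trivial⟩

lemma laplaceD_eq : laplaceD n = halfLaplace fun _ => -1 := by
  ext u g
  simp only [laplaceD, halfLaplace, ← half_one, ← half_neg_one]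
  constructor
  · rintro ⟨h1, h2⟩ s (rfl | rfl)
    · exact ⟨fun h => by norm_num at h, fun _ => h1⟩
    · exact ⟨fun h => by norm_num at h, fun _ => h2⟩
  · exact fun h => ⟨(h 1 (Or.inl rfl)).2 trivial, (h (-1) (Or.inr rfl)).2 trivial⟩

/-- The parities of `Δ_DN`. -/
def parityDN (s : ℝ) : ℂ := if 0 < s then 1 else -1

lemma parityDN_one : parityDN 1 = 1 := if_pos one_pos

lemma parityDN_neg_one : parityDN (-1) = -1 := if_neg (by norm_num)

lemma laplaceDN_eq : laplaceDN n = halfLaplace parityDN := by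
  ext u g
  simp only [laplaceDN, halfLaplace, ← half_one, ← half_neg_one]
  constructor
  · rintro ⟨h1, h2⟩ s (rfl | rfl)
    · rw [parityDN_one]
      exact ⟨fun _ => h1, fun h => by norm_num at h⟩
    · rw [parityDN_neg_one]
      exact ⟨fun h => by norm_num at h, fun _ => h2⟩
  · exact fun h => ⟨(h 1 (Or.inl rfl)).1 parityDN_one, (h (-1) (Or.inr rfl)).2 parityDN_neg_one⟩

lemma halfCond_one {b : ℂ} (hb : b = 1) {s : ℝ} {Ω : Set (E n)} (hΩ : half n s = Ω)
    {g : E n → ℂ} : HalfCond b s g ↔ Ω.domRestrict g ∈ BMOr Ω := by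
  subst hb hΩ
  exact ⟨fun h => h.1 rfl, fun h => ⟨fun _ => h, fun h' => by norm_num at h'⟩⟩

lemma halfCond_neg_one {b : ℂ} (hb : b = -1) {s : ℝ} {Ω : Set (E n)} (hΩ : half n s = Ω)
    {g : E n → ℂ} : HalfCond b s g ↔ Ω.domRestrict g ∈ BMOz Ω := by
  subst hb hΩ
  exact ⟨fun h => h.2 rfl, fun h => ⟨fun h' => by norm_num at h', fun _ => h⟩⟩

end HeatBMO

end

theorem proposition4p2 (n : ℕ) [NeZero n] :
    (HeatBMO.BMOop (HeatBMO.laplaceN n) = {f : HeatBMO.E n → ℂ | ∃ g ∈ HeatBMO.tempered n,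
      (HeatBMO.upper n).domRestrict g ∈ HeatBMO.BMOr (HeatBMO.upper n) ∧
      (HeatBMO.lower n).domRestrict g ∈ HeatBMO.BMOr (HeatBMO.lower n) ∧
      f - g ∈ HeatBMO.kernelSpace (HeatBMO.laplaceN n)}) ∧
    (HeatBMO.BMOop (HeatBMO.laplaceD n) = {f : HeatBMO.E n → ℂ | ∃ g ∈ HeatBMO.tempered n,
      (HeatBMO.upper n).domRestrict g ∈ HeatBMO.BMOz (HeatBMO.upper n) ∧
      (HeatBMO.lower n).domRestrict g ∈ HeatBMO.BMOz (HeatBMO.lower n) ∧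
      f - g ∈ HeatBMO.kernelSpace (HeatBMO.laplaceD n)}) ∧
    (HeatBMO.BMOop (HeatBMO.laplaceDN n) = {f : HeatBMO.E n → ℂ | ∃ g ∈ HeatBMO.tempered n,
      (HeatBMO.upper n).domRestrict g ∈ HeatBMO.BMOr (HeatBMO.upper n) ∧
      (HeatBMO.lower n).domRestrict g ∈ HeatBMO.BMOz (HeatBMO.lower n) ∧
      f - g ∈ HeatBMO.kernelSpace (HeatBMO.laplaceDN n)}) := by
  have hN : ∀ s : ℝ, (fun _ : ℝ => (1 : ℂ)) s = 1 ∨ (fun _ : ℝ => (1 : ℂ)) s = -1 :=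
    fun _ => Or.inl rfl
  have hD : ∀ s : ℝ, (fun _ : ℝ => (-1 : ℂ)) s = 1 ∨ (fun _ : ℝ => (-1 : ℂ)) s = -1 :=
    fun _ => Or.inr rfl
  have hDN : ∀ s, HeatBMO.parityDN s = 1 ∨ HeatBMO.parityDN s = -1 := fun s => by
    unfold HeatBMO.parityDN
    split_ifs
    · exact Or.inl rfl
    · exact Or.inr rfl
  refine ⟨?_, ?_, ?_⟩
  · rw [HeatBMO.laplaceN_eq,
      HeatBMO.BMOop_eq (HeatBMO.actsByReflection_halfLaplace hN) hN]
    simp only [HeatBMO.halfCond_one rfl HeatBMO.half_one,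
      HeatBMO.halfCond_one rfl HeatBMO.half_neg_one]
  · rw [HeatBMO.laplaceD_eq,
      HeatBMO.BMOop_eq (HeatBMO.actsByReflection_halfLaplace hD) hD]
    simp only [HeatBMO.halfCond_neg_one rfl HeatBMO.half_one,
      HeatBMO.halfCond_neg_one rfl HeatBMO.half_neg_one]
  · rw [HeatBMO.laplaceDN_eq,
      HeatBMO.BMOop_eq (HeatBMO.actsByReflection_halfLaplace hDN) hDN]
    simp only [HeatBMO.halfCond_one HeatBMO.parityDN_one HeatBMO.half_one,
      HeatBMO.halfCond_neg_one HeatBMO.parityDN_neg_one HeatBMO.half_neg_one]
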